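/- Let $0<\alpha<1$, let $U\subset\mathbb R^3$ be open, and consider the cones $P=\{x_3=0\}$, $Y=\{(r\cos\theta,r\sin\theta,x_3): r\ge 0,\ \theta\in\{0,\tfrac{2\pi}{3},\tfrac{4\pi}{3}\}\}$ and $T=\{ap_i+bp_j: a,b\ge 0,\ 1\le i<j\le 4\}$, where $p_1=(1,1,1)$, $p_2=(-1,-1,1)$, $p_3=(-1,1,-1)$, $p_4=(1,-1,-1)$. Let $\Sigma\subset U$ be a generalized surface of class $C^{1,\alpha}$: $\Sigma$ is relatively closed in $U$, and for every $p\in\Sigma$ there are a ball $B_r(p)\subset U$ and a $C^{1,\alpha}$ diffeomorphism $\phi$ of $B_r(p)$ onto an open subset of $\mathbb R^3$ with $\phi(p)=0$, $D\phi_p\in O(3)$ and $\phi(\Sigma\cap B_r(p))=\boldsymbol C\cap\phi(B_r(p))$ for some $\boldsymbol C\in\{P,Y,T\}$. Assume that $\Sigma$ is orientable in $U$: for each connected component $\Omega$ of $U\setminus\Sigma$ and each $p\in\Sigma$ there is $\rho>0$ with $B_\rho(p)\subset U$ such that $B_r(p)\cap \Omega$ is connected (possibly empty) for all $0<r<\rho$.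 Let $\mathcal A$ be the set of connected components $\Lambda$ (sheets) of the set $\mathrm{reg}(\Sigma)$ of points near which $\Sigma$ is an embedded $C^{1,\alpha}$ surface, and let $\mathcal L$ be the set of connected components $L$ ($Y$-curves) of the set of points of $\Sigma$ whose tangent cone is isometric to $Y$. For $L\in\mathcal L$ let $\Lambda_L^1,\Lambda_L^2,\Lambda_L^3$ be the three distinct sheets whose closure contains $L$. Closures $\overline\Lambda$ are taken in $U$, and $C^{1,\alpha}$ regularity is meant locally (near each point of $\overline\Lambda$, by extension to an open subset of $\mathbb R^3$). Let $\nu=(\nu_\Lambda)_{\Lambda\in\mathcal A}$ be a unit normal vector field on $\Sigma$ with $\nu_\Lambda\in C^{1,\alpha}(\overline\Lambda,\mathbb R^3)$ for every $\Lambda\in\mathcal A$. Orient every $L\in\mathcal L$, and for $p\in L$ let $\mathrm{sign}_L^i(p)=1$ if the orientation of $L$ at $p$ agrees with the boundary orientation induced from $\Lambda_L^i$ oriented by $\nu_{\Lambda_L^i}$, and $\mathrm{sign}_L^i(p)=-1$ otherwise. Let $f=(f_\Lambda)_{\Lambda\in\mathcal A}$ with $f_\Lambda\in C^{1,\alpha}(\overline\Lambda)$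 for every $\Lambda\in\mathcal A$, and write $f_L^i=f_{\Lambda_L^i}$. Then there is a vector field $V:\Sigma\to\mathbb R^3$ with $V|_{\overline\Lambda}\in C^{1,\alpha}(\overline\Lambda,\mathbb R^3)$ and $f_\Lambda=V\cdot\nu_\Lambda$ for every $\Lambda\in\mathcal A$ if and only if $$\sum_{i=1}^3\mathrm{sign}_L^i(p)\,f_L^i(p)=0\qquad\text{for every } L\in\mathcal L\text{ and every } p\in L .$$ -/

import Mathlib

open Set Topology
open scoped NNReal Matrix

namespace PlateauSurface

/-- Euclidean three-space. -/
abbrev E3 : Type := EuclideanSpace ℝ (Fin 3)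

/-! ### The three model cones -/

/-- The plane `x₃ = 0`. -/
def coneP : Set E3 := {x | x 2 = 0}

/-- Three half-planes meeting along the third axis at equal angles. -/
def coneY : Set E3 :=
  {x | ∃ r θ z : ℝ, 0 ≤ r ∧ (θ = 0 ∨ θ = 2 * Real.pi / 3 ∨ θ = 4 * Real.pi / 3) ∧
    x = !₂[r * Real.cos θ, r * Real.sin θ, z]}

/-- The vertices of a regular tetrahedron centred at the origin. -/
noncomputable def tetraVertex : Fin 4 → E3 :=
  ![!₂[1, 1, 1], !₂[-1, -1, 1], !₂[-1, 1, -1], !₂[1, -1, -1]]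

/-- The cone over the edges of a regular tetrahedron. -/
def coneT : Set E3 :=
  {x | ∃ (i j : Fin 4) (a b : ℝ), i < j ∧ 0 ≤ a ∧ 0 ≤ b ∧
    x = a • tetraVertex i + b • tetraVertex j}

/-! ### Hölder regularity `C^{1,α}` (in the local sense) -/

section Regularity

variable {F : Type*} [NormedAddCommGroup F] [NormedSpace ℝ F]

/-- `g` is of class `C^{1,α}` on the open set `W`: it is continuously differentiable there and its
derivative is `α`-Hölder continuous near every point of `W`. -/
def C1AlphaOnOpen (α : ℝ≥0) (W : Set E3) (g : E3 → F) : Prop :=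
  ContDiffOn ℝ 1 g W ∧
    ∀ x ∈ W, ∃ N ∈ 𝓝 x, ∃ C : ℝ≥0, HolderOnWith C α (fderiv ℝ g) N

/-- `g` is of class `C^{1,α}` on the arbitrary set `A` (for instance a surface together with its
boundary): near every point of `A` the restriction of `g` to `A` extends to a
`C^{1,α}` function on an open set of the ambient space. -/
def C1AlphaOn (α : ℝ≥0) (A : Set E3) (g : E3 → F) : Prop :=
  ∀ x ∈ A, ∃ W : Set E3, IsOpen W ∧ x ∈ W ∧
    ∃ G : E3 → F, C1AlphaOnOpen α W G ∧ EqOn G g (A ∩ W)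

end Regularity

/-! ### Generalized surfaces -/

/-- `φ` is a `C^{1,α}` diffeomorphism of the ball `B_r(p)` onto an open set, sending `p` to `0`, and
carrying `S` (within the ball) to the cone `C` (within the image of the ball). -/
structure IsConeChart (α : ℝ≥0) (S C : Set E3) (p : E3) (r : ℝ)
    (φ : OpenPartialHomeomorph E3 E3) : Prop where
  source_eq : φ.source = Metric.ball p r
  map_center : φ p = 0
  regular : C1AlphaOnOpen α φ.source φ
  regular_symm : C1AlphaOnOpen α φ.target φ.symm
  image_eq : φ '' (S ∩ Metric.ball p r) = C ∩ φ.target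

/-- `S` is a (relatively closed) generalized surface of class `C^{1,α}` in `U`: near each of
its points it is the image of one of the three cones under a `C^{1,α}` diffeomorphism whose
derivative at the point is orthogonal. -/
structure IsGeneralizedSurface (α : ℝ≥0) (U S : Set E3) : Prop where
  subset : S ⊆ U
  relClosed : closure S ∩ U ⊆ S
  chart : ∀ p ∈ S, ∃ C : Set E3, (C = coneP ∨ C = coneY ∨ C = coneT) ∧
    ∃ r : ℝ, 0 < r ∧ Metric.ball p r ⊆ U ∧ ∃ φ : OpenPartialHomeomorph E3 E3,
      IsConeChart α S C p r φ ∧ ∀ v : E3, ‖fderiv ℝ φ p v‖ = ‖v‖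

/-- The connected components of a set. -/
def components (A : Set E3) : Set (Set E3) := {K | ∃ x ∈ A, K = connectedComponentIn A x}

/-- `S` is orientable in `U`: near each point of `S`, every component of `U \ S` looks connected. -/
def IsOrientableIn (U S : Set E3) : Prop :=
  ∀ Ω ∈ components (U \ S), ∀ p ∈ S, ∃ ρ : ℝ, 0 < ρ ∧ Metric.ball p ρ ⊆ U ∧
    ∀ r : ℝ, 0 < r → r < ρ → IsPreconnected (Metric.ball p r ∩ Ω)

/-- The regular part: the points near which `S` is an embedded `C^{1,α}` surface. -/
def reg (α : ℝ≥0) (S : Set E3) : Set E3 :=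
  {p | p ∈ S ∧ ∃ r : ℝ, 0 < r ∧ ∃ φ : OpenPartialHomeomorph E3 E3, IsConeChart α S coneP p r φ}

/-- The tangent cone of `A` at `p`: the limits of `c n • (x n - p)` with `c n ≥ 0`, `x n ∈ A`,
`x n → p`. -/
def tangentCone (A : Set E3) (p : E3) : Set E3 := tangentConeAt ℝ≥0 A p

/-- The set of `Y`-points: the tangent cone is isometric to the cone `Y`. -/
def yPoints (S : Set E3) : Set E3 :=
  {p | p ∈ S ∧ ∃ O : E3 ≃ₗᵢ[ℝ] E3, tangentCone S p = O '' coneY}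

/-- The sheets of `S`: the connected components of the regular part. -/
def sheets (α : ℝ≥0) (S : Set E3) : Set (Set E3) := components (reg α S)

/-- The `Y`-curves of `S`: the connected components of the set of `Y`-points. -/
def yCurves (S : Set E3) : Set (Set E3) := components (yPoints S)

/-- The sheets that have `L` in their boundary. For a `Y`-curve `L` of an orientable generalized
surface there are exactly three. -/
def sheetsAlong (α : ℝ≥0) (S L : Set E3) : Set (Set E3) := {Λ ∈ sheets α S | L ⊆ closure Λ}

/-! ### Functions and fields on a generalized surface

A function on `S` is a family indexed by the sheets `Λ`, whose member at `Λ` matters only on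
the closure of `Λ` in `U`. A vector field on `S` is a single function on `S`. -/

/-- The family `f` is of class `C^{1,α}`: each `f Λ` is so on the closure of `Λ` in `U`. -/
def C1AlphaFamily {F : Type*} [NormedAddCommGroup F] [NormedSpace ℝ F] (α : ℝ≥0) (U S : Set E3)
    (f : Set E3 → E3 → F) : Prop :=
  ∀ Λ ∈ sheets α S, C1AlphaOn α (closure Λ ∩ U) (f Λ)

/-- `V` is a `C^{1,α}` vector field on `S`: its restriction to the closure in `U` of each sheet
is of class `C^{1,α}`. -/
def C1AlphaField (α : ℝ≥0) (U S : Set E3) (V : E3 → E3) : Prop :=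
  ∀ Λ ∈ sheets α S, C1AlphaOn α (closure Λ ∩ U) V

/-- `ν` is a unit normal on `S`: each `ν Λ` is a continuous unit normal field on `Λ`. -/
def IsUnitNormal (α : ℝ≥0) (S : Set E3) (ν : Set E3 → E3 → E3) : Prop :=
  ∀ Λ ∈ sheets α S, ContinuousOn (ν Λ) Λ ∧
    ∀ x ∈ Λ, ‖ν Λ x‖ = 1 ∧ ∀ v ∈ tangentCone Λ x, inner ℝ (ν Λ x) v = 0

/-- `f = V · ν` for some `C^{1,α}` vector field `V` on `S`. -/
def IsCompatible (α : ℝ≥0) (U S : Set E3) (ν : Set E3 → E3 → E3) (f : Set E3 → E3 → ℝ) : Prop :=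
  ∃ V : E3 → E3, C1AlphaField α U S V ∧
    ∀ Λ ∈ sheets α S, ∀ x ∈ closure Λ ∩ U, f Λ x = inner ℝ (V x) (ν Λ x)

/-! ### Orientations and signs -/

/-- `τ` orients every `Y`-curve of `S`: on each of them it is a continuous unit tangent field. -/
def IsOrientation (S : Set E3) (τ : E3 → E3) : Prop :=
  ∀ L ∈ yCurves S, ContinuousOn τ L ∧ ∀ p ∈ L, ‖τ p‖ = 1 ∧ τ p ∈ tangentCone L p

/-- The cross product on `E3`. -/
noncomputable def cross (v w : E3) : E3 := WithLp.toLp 2 (v.ofLp ⨯₃ w.ofLp)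

/-- `η` is the outward unit conormal of the surface `Λ` at its boundary point `p`, where `t` is a
tangent vector of the boundary curve. -/
def IsOutwardConormal (Λ : Set E3) (p t η : E3) : Prop :=
  ‖η‖ = 1 ∧ inner ℝ η t = 0 ∧ -η ∈ tangentCone Λ p

/-- The tangent vector `t` at the boundary point `p` of `Λ` has the direction induced by the
orientation of `Λ` given by the normal `n`: with `η` the outward conormal, `(η, t)` is
a positive basis of the tangent plane oriented by `n`. -/
def IsInducedDirection (Λ : Set E3) (n p t : E3) : Prop :=
  ∃ η : E3, IsOutwardConormal Λ p t η ∧ t = cross n η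

open Classical in
/-- The sign at `p` of the sheet `Λ` with normal `n` relative to the direction `t` of the
`Y`-curve through `p`: it is `1` if `t` is the induced boundary direction, and `-1` otherwise. -/
noncomputable def sheetSign (Λ : Set E3) (n p t : E3) : ℝ :=
  if IsInducedDirection Λ n p t then 1 else -1

end PlateauSurface

open PlateauSurface

set_option linter.unusedSectionVars false
set_option linter.unusedSimpArgs false

/-! Necessity. At a `Y`-point some chart has orthogonal derivative, so the three sheets meet at
equal angles and their outward unit conormals add up to zero. The sign is defined so that sign times
normal equals conormal × `τ`, whichever way the normal points. Hence the signed normals add up to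
zero (`sum_sheetSign_smul_normal`), and pairing this relation with `V p` gives the condition.

Sufficiency. The equation V · ν = f is affine in V, so a partition of unity reduces the problem to
neighbourhoods of single points (`isCompatible_of_hasLocalField`). Near a point it suffices to find
suitable fields W along the edges where faces meet: adding (f - W · ν) ν on each face corrects the
normal component there, and this correction vanishes on the edges, so the pieces still match
(`FaceSheets.hasLocalField_of_edges`). Near a regular point there is no edge. Along a `Y`-curve, two
of the three normals are independent, so two equations can be solved in class C^{1,α}; the third
then holds on the curve, because f and ν satisfy the same signed relation
(`SignCondition.inner_eq_of_inner_eq`). At a `T`-point four edges meet. The six equations for the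
value v at the vertex are consistent because they are so for the three faces along each edge
(`FaceSheets.exists_vertex_value`). Each edge field is normalized to equal v at the vertex and
pulled back by a projection onto its edge in the chart; the deviations from v are then added up
(`FanChart.hasLocalField_fin_four`).

The three cones are treated together as fans: the points where the minimum of 2, 3 or 4 linear forms
is attained at least twice. One active form means a complementary sector, two an open face, three an
edge. Charts are orthogonal only at their centre, so types of points are recognized by linear
invariants of the tangent cone: invariance under negation characterizes regular points, and
invariance under some translation separates Y from T. Orientability makes different sectors of a
chart lie in different components of the complement, so different faces lie in different sheets. -/

namespace PlateauSurface

open Filter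

/-! ### Germs of class `C^{1,α}` -/

section Germs

variable {E F G : Type*} [NormedAddCommGroup E] [NormedSpace ℝ E]
  [NormedAddCommGroup F] [NormedSpace ℝ F] [NormedAddCommGroup G] [NormedSpace ℝ G]

/-- `f` is `α`-Hölder continuous near `x`. -/
def HolderNear (α : ℝ≥0) (f : E → F) (x : E) : Prop :=
  ∃ N ∈ 𝓝 x, ∃ C : ℝ≥0, HolderOnWith C α f N

/-- `g` is of class `C^{1,α}` near `x`. -/
def C1AlphaAt (α : ℝ≥0) (g : E → F) (x : E) : Prop :=
  ContDiffAt ℝ 1 g x ∧ HolderNear α (fderiv ℝ g) x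

variable {α : ℝ≥0} {x : E}

theorem HolderNear.congr {f g : E → F} (hf : HolderNear α f x) (h : f =ᶠ[𝓝 x] g) :
    HolderNear α g x := by
  obtain ⟨N, hN, C, hC⟩ := hf
  refine ⟨N ∩ {y | f y = g y}, inter_mem hN h, C, ?_⟩
  rintro y ⟨hy, hy'⟩ z ⟨hz, hz'⟩
  rw [← show f y = g y from hy', ← show f z = g z from hz']
  exact hC y hy z hz

theorem HolderNear.prodMk {f : E → F} {g : E → G} (hf : HolderNear α f x)
    (hg : HolderNear α g x) : HolderNear α (fun y => (f y, g y)) x := by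
  obtain ⟨N, hN, C, hC⟩ := hf
  obtain ⟨M, hM, D, hD⟩ := hg
  refine ⟨N ∩ M, inter_mem hN hM, max C D, ?_⟩
  intro y hy z hz
  rw [Prod.edist_eq]
  refine max_le ?_ ?_
  · exact hC.mono_const (le_max_left C D) y hy.1 z hz.1
  · exact hD.mono_const (le_max_right C D) y hy.2 z hz.2

theorem HolderNear.comp_lipschitz_left {f : E → F} {g : F → G} (hf : HolderNear α f x)
    (hc : ContinuousAt f x) (hg : ∃ K, ∃ t ∈ 𝓝 (f x), LipschitzOnWith K g t) :
    HolderNear α (g ∘ f) x := by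
  obtain ⟨N, hN, C, hC⟩ := hf
  obtain ⟨K, t, ht, hK⟩ := hg
  refine ⟨N ∩ f ⁻¹' t, inter_mem hN (hc ht), K * C ^ ((1 : ℝ≥0) : ℝ), ?_⟩
  have := (holderOnWith_one.2 hK).comp (hC.mono (inter_subset_left (t := f ⁻¹' t)))
    (fun y hy => hy.2)
  rwa [one_mul] at this

theorem HolderNear.comp_lipschitz_right {f : E → F} {g : F → G} (hg : HolderNear α g (f x))
    (hf : ∃ K, ∃ t ∈ 𝓝 x, LipschitzOnWith K f t) :
    HolderNear α (g ∘ f) x := by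
  obtain ⟨N, hN, C, hC⟩ := hg
  obtain ⟨K, t, ht, hK⟩ := hf
  have hc : ContinuousAt f x := hK.continuousOn.continuousAt ht
  refine ⟨t ∩ f ⁻¹' N, inter_mem ht (hc hN), C * K ^ (α : ℝ), ?_⟩
  have := hC.comp (holderOnWith_one.2 (hK.mono (inter_subset_left (t := f ⁻¹' N))))
    (fun y hy => hy.2)
  rwa [mul_one] at this

theorem holderNear_of_lipschitz (hα1 : α ≤ 1) {f : E → F}
    (hf : ∃ K, ∃ t ∈ 𝓝 x, LipschitzOnWith K f t) : HolderNear α f x := by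
  obtain ⟨K, t, ht, hK⟩ := hf
  have h1 : Metric.ball x 1 ∈ 𝓝 x := Metric.ball_mem_nhds x one_pos
  refine ⟨t ∩ Metric.ball x 1, inter_mem ht h1, _,
    -- Lowering the Hölder exponent from 1 to `α` needs bounded distances; 2 bounds the diameter of
    -- a unit ball.
    ((holderOnWith_one.2 hK).mono inter_subset_left).of_le (D := 2) ?_ hα1⟩
  rintro y ⟨-, hy⟩ z ⟨-, hz⟩
  rw [edist_dist]
  have : dist y z ≤ 2 := by
    have := dist_triangle_right y z x
    rw [Metric.mem_ball] at hy hz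
    linarith
  calc ENNReal.ofReal (dist y z) ≤ ENNReal.ofReal 2 := ENNReal.ofReal_le_ofReal this
    _ = _ := by simp

theorem C1AlphaAt.continuousAt {g : E → F} (h : C1AlphaAt α g x) : ContinuousAt g x :=
  h.1.continuousAt

theorem C1AlphaAt.differentiableAt {g : E → F} (h : C1AlphaAt α g x) : DifferentiableAt ℝ g x :=
  h.1.differentiableAt one_ne_zero

theorem C1AlphaAt.continuousAt_fderiv {g : E → F} (h : C1AlphaAt α g x) :
    ContinuousAt (fderiv ℝ g) x :=
  h.1.continuousAt_fderiv one_ne_zero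

theorem C1AlphaAt.eventually {g : E → F} (h : C1AlphaAt α g x) : ∀ᶠ y in 𝓝 x, C1AlphaAt α g y := by
  obtain ⟨N, hN, C, hC⟩ := h.2
  filter_upwards [h.1.eventually (by simp), eventually_mem_nhds_iff.2 hN] with y hy hy'
  exact ⟨hy, N, hy', C, hC⟩

theorem c1AlphaAt_of_contDiffAt (hα1 : α ≤ 1) {g : E → F} (h : ContDiffAt ℝ 2 g x) :
    C1AlphaAt α g x := by
  refine ⟨h.of_le (by norm_num), holderNear_of_lipschitz hα1 ?_⟩
  have : ContDiffAt ℝ 1 (fderiv ℝ g) x := h.fderiv_right (by norm_num)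
  obtain ⟨K, t, ht, hK⟩ := this.exists_lipschitzOnWith
  exact ⟨K, t, ht, hK⟩

/-- The derivative Dg(f) ∘ Df is a bilinear, hence locally Lipschitz, function of two Hölder maps.
The first is Hölder with the same exponent because a C¹ map `f` is locally Lipschitz. -/
theorem C1AlphaAt.comp (g : F → G) {f : E → F} (hg : C1AlphaAt α g (f x))
    (hf : C1AlphaAt α f x) : C1AlphaAt α (g ∘ f) x := by
  refine ⟨hg.1.comp x hf.1, ?_⟩
  have hL : ∃ K, ∃ t ∈ 𝓝 x, LipschitzOnWith K f t := hf.1.exists_lipschitzOnWith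
  have h1 : HolderNear α (fun y => (fderiv ℝ g (f y), fderiv ℝ f y)) x :=
    (hg.2.comp_lipschitz_right hL).prodMk hf.2
  have h2 : ContinuousAt (fun y => (fderiv ℝ g (f y), fderiv ℝ f y)) x :=
    (hg.continuousAt_fderiv.comp hf.continuousAt).prodMk hf.continuousAt_fderiv
  have h3 : ContDiff ℝ 1 (fun q : (F →L[ℝ] G) × (E →L[ℝ] F) => q.1.comp q.2) :=
    isBoundedBilinearMap_comp.contDiff
  refine (h1.comp_lipschitz_left h2 (h3.contDiffAt.exists_lipschitzOnWith)).congr ?_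
  filter_upwards [hf.eventually, hf.continuousAt.eventually hg.eventually] with y hy hy'
  exact (fderiv_comp y hy'.differentiableAt hy.differentiableAt).symm

theorem C1AlphaAt.prodMk {f : E → F} {g : E → G} (hf : C1AlphaAt α f x)
    (hg : C1AlphaAt α g x) : C1AlphaAt α (fun y => (f y, g y)) x := by
  refine ⟨hf.1.prodMk hg.1, ?_⟩
  have h1 := hf.2.prodMk hg.2
  have h2 := hf.continuousAt_fderiv.prodMk hg.continuousAt_fderiv
  let L := ContinuousLinearMap.prodₗᵢ (𝕜 := ℝ) (E := E) (F := F) (G := G) ℝ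
  refine (h1.comp_lipschitz_left h2 (g := L)
    ⟨1, univ, univ_mem, L.lipschitz.lipschitzOnWith⟩).congr ?_
  filter_upwards [hf.eventually, hg.eventually] with y hy hy'
  exact (hy.differentiableAt.fderiv_prodMk hy'.differentiableAt).symm

theorem c1AlphaAt_const (c : F) : C1AlphaAt α (fun _ : E => c) x := by
  refine ⟨contDiffAt_const, univ, univ_mem, 0, fun y _ z _ => ?_⟩
  simp

/-- All algebraic operations on germs come from here: sums, products, inverses and inner products
are C² maps applied to a pair or to a single germ. -/
theorem C1AlphaAt.contDiff_comp (hα1 : α ≤ 1) {g : F → G} {f : E → F} (hf : C1AlphaAt α f x)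
    (hg : ContDiffAt ℝ 2 g (f x)) : C1AlphaAt α (fun y => g (f y)) x :=
  C1AlphaAt.comp g (c1AlphaAt_of_contDiffAt hα1 hg) hf

theorem C1AlphaAt.add (hα1 : α ≤ 1) {f g : E → F} (hf : C1AlphaAt α f x)
    (hg : C1AlphaAt α g x) : C1AlphaAt α (fun y => f y + g y) x :=
  (hf.prodMk hg).contDiff_comp hα1 (g := fun q : F × F => q.1 + q.2)
    (contDiff_fst.add contDiff_snd).contDiffAt

theorem C1AlphaAt.sub (hα1 : α ≤ 1) {f g : E → F} (hf : C1AlphaAt α f x)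
    (hg : C1AlphaAt α g x) : C1AlphaAt α (fun y => f y - g y) x :=
  (hf.prodMk hg).contDiff_comp hα1 (g := fun q : F × F => q.1 - q.2)
    (contDiff_fst.sub contDiff_snd).contDiffAt

theorem C1AlphaAt.smul (hα1 : α ≤ 1) {f : E → ℝ} {g : E → F} (hf : C1AlphaAt α f x)
    (hg : C1AlphaAt α g x) : C1AlphaAt α (fun y => f y • g y) x :=
  (hf.prodMk hg).contDiff_comp hα1 (g := fun q : ℝ × F => q.1 • q.2)
    (contDiff_fst.smul contDiff_snd).contDiffAt

theorem C1AlphaAt.mul (hα1 : α ≤ 1) {f g : E → ℝ} (hf : C1AlphaAt α f x)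
    (hg : C1AlphaAt α g x) : C1AlphaAt α (fun y => f y * g y) x :=
  C1AlphaAt.smul hα1 hf hg

theorem C1AlphaAt.inv (hα1 : α ≤ 1) {f : E → ℝ} (hf : C1AlphaAt α f x) (h0 : f x ≠ 0) :
    C1AlphaAt α (fun y => (f y)⁻¹) x :=
  hf.contDiff_comp hα1 (contDiffAt_inv ℝ h0)

theorem C1AlphaAt.sum (hα1 : α ≤ 1) {ι : Type*} {f : ι → E → F} {s : Finset ι}
    (hf : ∀ i ∈ s, C1AlphaAt α (f i) x) : C1AlphaAt α (fun y => ∑ i ∈ s, f i y) x := by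
  classical
  induction s using Finset.induction_on with
  | empty => simpa using c1AlphaAt_const (α := α) (x := x) (0 : F)
  | insert i s hi ih =>
    simp only [Finset.sum_insert hi]
    exact (hf i (Finset.mem_insert_self i s)).add hα1
      (ih fun j hj => hf j (Finset.mem_insert_of_mem hj))

end Germs

/-! ### Inner products of germs and linear systems with germ coefficients. -/

section Inner

variable {E F : Type*} [NormedAddCommGroup E] [NormedSpace ℝ E]
  [NormedAddCommGroup F] [InnerProductSpace ℝ F] {α : ℝ≥0} {x : E}

theorem C1AlphaAt.innerProd (hα1 : α ≤ 1) {f g : E → F} (hf : C1AlphaAt α f x)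
    (hg : C1AlphaAt α g x) : C1AlphaAt α (fun y => inner ℝ (f y) (g y)) x :=
  (hf.prodMk hg).contDiff_comp hα1 (g := fun q : F × F => inner ℝ q.1 q.2)
    contDiff_inner.contDiffAt

/-- Solving two linear equations: if `n₁ x` and `n₂ x` are linearly independent, there is a
`C^{1,α}` germ `W` with `W · n₁ = h₁` and `W · n₂ = h₂`, whose value at `x` may be prescribed. -/
theorem exists_c1AlphaAt_inner_eq (hα1 : α ≤ 1) {n₁ n₂ : E → F} {h₁ h₂ : E → ℝ}
    (hn₁ : C1AlphaAt α n₁ x) (hn₂ : C1AlphaAt α n₂ x) (hh₁ : C1AlphaAt α h₁ x)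
    (hh₂ : C1AlphaAt α h₂ x)
    (hind : inner ℝ (n₁ x) (n₁ x) * inner ℝ (n₂ x) (n₂ x) -
      inner ℝ (n₁ x) (n₂ x) * inner ℝ (n₁ x) (n₂ x) ≠ 0) (v : F) :
    ∃ W : E → F, C1AlphaAt α W x ∧
      (∀ᶠ y in 𝓝 x, inner ℝ (W y) (n₁ y) = h₁ y ∧ inner ℝ (W y) (n₂ y) = h₂ y) ∧
      (inner ℝ v (n₁ x) = h₁ x → inner ℝ v (n₂ x) = h₂ x → W x = v) := by
  let D : E → ℝ := fun y => inner ℝ (n₁ y) (n₁ y) * inner ℝ (n₂ y) (n₂ y) -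
    inner ℝ (n₁ y) (n₂ y) * inner ℝ (n₁ y) (n₂ y)
  let k₁ : E → ℝ := fun y => h₁ y - inner ℝ v (n₁ y)
  let k₂ : E → ℝ := fun y => h₂ y - inner ℝ v (n₂ y)
  have hv : C1AlphaAt α (fun _ : E => v) x := c1AlphaAt_const v
  have hD : C1AlphaAt α D x :=
    ((hn₁.innerProd hα1 hn₁).mul hα1 (hn₂.innerProd hα1 hn₂)).sub hα1
      ((hn₁.innerProd hα1 hn₂).mul hα1 (hn₁.innerProd hα1 hn₂))
  have hk₁ : C1AlphaAt α k₁ x := hh₁.sub hα1 (hv.innerProd hα1 hn₁)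
  have hk₂ : C1AlphaAt α k₂ x := hh₂.sub hα1 (hv.innerProd hα1 hn₂)
  -- Cramer's rule in the span of `n₁` and `n₂`, applied to the defects `k₁`, `k₂` of the constant
  -- field `v`; if `v` is already a solution at `x`, nothing is added there.
  refine ⟨fun y => v + (((D y)⁻¹ * (inner ℝ (n₂ y) (n₂ y) * k₁ y - inner ℝ (n₁ y) (n₂ y) * k₂ y))
    • n₁ y + ((D y)⁻¹ * (inner ℝ (n₁ y) (n₁ y) * k₂ y - inner ℝ (n₁ y) (n₂ y) * k₁ y)) • n₂ y),
    ?_, ?_, ?_⟩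
  · refine hv.add hα1 (C1AlphaAt.add hα1 ?_ ?_)
    · exact ((hD.inv hα1 hind).mul hα1 (((hn₂.innerProd hα1 hn₂).mul hα1 hk₁).sub hα1
        ((hn₁.innerProd hα1 hn₂).mul hα1 hk₂))).smul hα1 hn₁
    · exact ((hD.inv hα1 hind).mul hα1 (((hn₁.innerProd hα1 hn₁).mul hα1 hk₂).sub hα1
        ((hn₁.innerProd hα1 hn₂).mul hα1 hk₁))).smul hα1 hn₂
  · filter_upwards [hD.continuousAt.eventually_ne hind] with y hy
    have e : (D y)⁻¹ * D y = 1 := inv_mul_cancel₀ hy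
    simp only [inner_add_left, real_inner_smul_left, real_inner_comm (n₁ y) (n₂ y)]
    constructor
    · linear_combination k₁ y * e
    · linear_combination k₂ y * e
  · intro e₁ e₂
    simp [k₁, k₂, e₁, e₂]

end Inner

/-! ### From germs to C^{1,α} regularity on arbitrary sets. -/

section Open

variable {F : Type*} [NormedAddCommGroup F] [NormedSpace ℝ F] {α : ℝ≥0}

theorem C1AlphaOnOpen.c1AlphaAt {W : Set E3} {g : E3 → F} (h : C1AlphaOnOpen α W g)
    (hW : IsOpen W) {x : E3} (hx : x ∈ W) : C1AlphaAt α g x :=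
  ⟨h.1.contDiffAt (hW.mem_nhds hx), h.2 x hx⟩

/-- `g` coincides on `A`, near `x`, with a `C^{1,α}` germ. -/
def C1AlphaWithinAt (α : ℝ≥0) (g : E3 → F) (A : Set E3) (x : E3) : Prop :=
  ∃ G : E3 → F, C1AlphaAt α G x ∧ ∀ᶠ y in 𝓝 x, y ∈ A → G y = g y

/-- Being C^{1,α} at a point is an open condition on the point, so a germ provides the open set of
the definition. -/
theorem c1AlphaOn_iff {A : Set E3} {g : E3 → F} :
    C1AlphaOn α A g ↔ ∀ x ∈ A, C1AlphaWithinAt α g A x := by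
  refine forall₂_congr fun x hx => ⟨?_, ?_⟩
  · rintro ⟨W, hW, hxW, G, hG, hGg⟩
    refine ⟨G, hG.c1AlphaAt hW hxW, ?_⟩
    filter_upwards [hW.mem_nhds hxW] with y hy hyA
    exact hGg ⟨hyA, hy⟩
  · rintro ⟨G, hG, hGg⟩
    obtain ⟨W, hW, hWo, hxW⟩ := mem_nhds_iff.1 (hG.eventually.and hGg)
    refine ⟨W, hWo, hxW, G, ⟨fun y hy => (hW hy).1.1.contDiffWithinAt, fun y hy => (hW hy).1.2⟩,
      fun y hy => (hW hy.2).2 hy.1⟩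

end Open

/-! ### Tangent cones -/

/-- In c (φ(q + d) - φ(q)) = A(c d) + c o(d), the remainder is o(c d), and it tends to 0 because c d
converges. -/
theorem mem_tangentCone_of_map {φ : E3 → E3} {A : E3 →L[ℝ] E3} {q : E3} (hφ : HasFDerivAt φ A q)
    {S T : Set E3} (hST : ∀ᶠ y in 𝓝 q, y ∈ S → φ y ∈ T) {v : E3} (hv : v ∈ tangentCone S q) :
    A v ∈ tangentCone T (φ q) := by
  obtain ⟨ι, l, hl, c, d, hd, hdS, hcd⟩ := exists_fun_of_mem_tangentConeAt hv
  have hqd : Tendsto (fun n => q + d n) l (𝓝 q) := by simpa using hd.const_add q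
  refine mem_tangentConeAt_of_seq l c (fun n => φ (q + d n) - φ q) ?_ ?_ ?_
  · have := (hφ.continuousAt.tendsto.comp hqd).sub_const (φ q)
    simpa using this
  · filter_upwards [hdS, hqd.eventually hST] with n h1 h2
    simpa using h2 h1
  · have ho : (fun n => φ (q + d n) - φ q - A (d n)) =o[l] d := by
      have := hφ.isLittleO.comp_tendsto hqd
      simpa [Function.comp_def] using this
    have ho' : (fun n => c n • (φ (q + d n) - φ q - A (d n))) =o[l] fun n => c n • d n :=
      (Asymptotics.isBigO_refl (fun n => (c n : ℝ)) l).smul_isLittleO ho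
    have h0 : Tendsto (fun n => c n • (φ (q + d n) - φ q - A (d n))) l (𝓝 0) := by
      have : (fun n => c n • (φ (q + d n) - φ q - A (d n))) =o[l] fun _ => (1 : ℝ) :=
        ho'.trans_isBigO (hcd.isBigO_one ℝ)
      exact (Asymptotics.isLittleO_one_iff ℝ).1 this
    have h1 : Tendsto (fun n => A (c n • d n)) l (𝓝 (A v)) := (A.continuous.tendsto v).comp hcd
    have := h0.add h1
    rw [zero_add] at this
    refine this.congr fun n => ?_
    have : A (c n • d n) = c n • A (d n) := A.map_smul (c n : ℝ) (d n)
    rw [this, ← smul_add, sub_add_cancel]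

theorem mem_tangentCone_of_ray {T : Set E3} {x v : E3}
    (h : ∀ᶠ s : ℝ in 𝓝[>] 0, x + s • v ∈ T) : v ∈ tangentCone T x := by
  refine mem_tangentConeAt_of_seq (𝓝[>] (0 : ℝ)) (fun s => Real.toNNReal s⁻¹) (fun s => s • v)
    ?_ h ?_
  · have : Tendsto (fun s : ℝ => s • v) (𝓝 0) (𝓝 ((0 : ℝ) • v)) :=
      (continuous_id.smul continuous_const).tendsto 0
    rw [zero_smul] at this
    exact this.mono_left nhdsWithin_le_nhds
  · refine tendsto_const_nhds.congr' ?_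
    filter_upwards [self_mem_nhdsWithin] with s hs
    have hs : 0 < s := hs
    rw [NNReal.smul_def, Real.coe_toNNReal _ (inv_nonneg.2 hs.le), smul_smul,
      inv_mul_cancel₀ hs.ne', one_smul]

theorem tangentCone_subset_of_eventually {T K : Set E3} {x : E3} (hK : IsClosed K)
    (hKs : ∀ c : ℝ, 0 ≤ c → ∀ v ∈ K, c • v ∈ K) (h : ∀ᶠ y in 𝓝 x, y ∈ T → y - x ∈ K) :
    tangentCone T x ⊆ K := by
  intro v hv
  obtain ⟨ι, l, hl, c, d, hd, hdS, hcd⟩ := exists_fun_of_mem_tangentConeAt hv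
  have hqd : Tendsto (fun n => x + d n) l (𝓝 x) := by simpa using hd.const_add x
  refine hK.mem_of_tendsto hcd ?_
  filter_upwards [hdS, hqd.eventually h] with n h1 h2
  have := h2 h1
  rw [add_sub_cancel_left] at this
  exact hKs _ (c n).2 _ this

theorem tangentCone_eq_of_eventually {T K : Set E3} {x : E3} (hK : IsClosed K)
    (hKs : ∀ c : ℝ, 0 ≤ c → ∀ v ∈ K, c • v ∈ K) (h : ∀ᶠ y in 𝓝 x, y ∈ T ↔ y - x ∈ K) :
    tangentCone T x = K := by
  refine (tangentCone_subset_of_eventually hK hKs (h.mono fun y hy => hy.1)).antisymm ?_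
  intro v hv
  apply mem_tangentCone_of_ray
  have : Tendsto (fun s : ℝ => x + s • v) (𝓝 0) (𝓝 (x + (0 : ℝ) • v)) :=
    (continuous_const.add (continuous_id.smul continuous_const)).tendsto 0
  rw [zero_smul, add_zero] at this
  filter_upwards [(this.mono_left nhdsWithin_le_nhds).eventually h, self_mem_nhdsWithin]
    with s hs hs0
  rw [hs, add_sub_cancel_left]
  exact hKs s (le_of_lt hs0) v hv

/-- By the chain rule the derivatives of a chart and of its inverse are inverse to each other. -/
theorem exists_hasFDerivAt_equiv {φ : OpenPartialHomeomorph E3 E3} {q : E3} (hq : q ∈ φ.source)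
    (h : DifferentiableAt ℝ φ q) (h' : DifferentiableAt ℝ φ.symm (φ q)) :
    ∃ A : E3 ≃L[ℝ] E3, HasFDerivAt φ (A : E3 →L[ℝ] E3) q ∧
      HasFDerivAt φ.symm (A.symm : E3 →L[ℝ] E3) (φ q) := by
  have hq' : φ q ∈ φ.target := φ.map_source hq
  have hs : φ.symm (φ q) = q := φ.left_inv hq
  have e1 : (fderiv ℝ φ.symm (φ q)).comp (fderiv ℝ φ q) = ContinuousLinearMap.id ℝ E3 := by
    have h1 : HasFDerivAt (φ.symm ∘ φ) _ q := h'.hasFDerivAt.comp q h.hasFDerivAt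
    exact h1.unique ((hasFDerivAt_id q).congr_of_eventuallyEq (φ.eventually_left_inverse hq))
  have e2 : (fderiv ℝ φ q).comp (fderiv ℝ φ.symm (φ q)) = ContinuousLinearMap.id ℝ E3 := by
    have h0 : HasFDerivAt φ (fderiv ℝ φ q) (φ.symm (φ q)) := by rw [hs]; exact h.hasFDerivAt
    have h1 : HasFDerivAt (φ ∘ φ.symm) _ (φ q) := h0.comp (φ q) h'.hasFDerivAt
    exact h1.unique ((hasFDerivAt_id _).congr_of_eventuallyEq (φ.eventually_right_inverse hq'))
  exact ⟨ContinuousLinearEquiv.equivOfInverse (fderiv ℝ φ q) (fderiv ℝ φ.symm (φ q))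
    (fun v => congrArg (fun L => L v) e1) (fun v => congrArg (fun L => L v) e2),
    h.hasFDerivAt, h'.hasFDerivAt⟩

theorem mem_tangentCone_iff_of_chart {φ : OpenPartialHomeomorph E3 E3} {q : E3}
    (hq : q ∈ φ.source) {A : E3 ≃L[ℝ] E3} (hA : HasFDerivAt φ (A : E3 →L[ℝ] E3) q)
    (hA' : HasFDerivAt φ.symm (A.symm : E3 →L[ℝ] E3) (φ q)) {S T : Set E3}
    (hST : ∀ y ∈ φ.source, y ∈ S ↔ φ y ∈ T) (v : E3) :
    v ∈ tangentCone S q ↔ A v ∈ tangentCone T (φ q) := by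
  constructor
  · refine fun hv => mem_tangentCone_of_map hA ?_ hv
    filter_upwards [φ.open_source.mem_nhds hq] with y hy
    exact (hST y hy).1
  · intro hv
    have := mem_tangentCone_of_map hA' (T := S) ?_ hv
    · simpa [φ.left_inv hq] using this
    · filter_upwards [φ.open_target.mem_nhds (φ.map_source hq)] with y hy hyT
      rw [hST _ (φ.map_target hy), φ.right_inv hy]
      exact hyT

/-! ### Fans: the sets where a minimum of linear forms is attained at least twice -/

section Fan

variable {ι : Type*} [Finite ι] {ℓ : ι → E3}

/-- The linear forms of the family that realize the minimum at `x`. -/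
def active (ℓ : ι → E3) (x : E3) : Set ι := {k | ∀ m, inner ℝ (ℓ k) x ≤ inner ℝ (ℓ m) x}

/-- The points where the minimum of the forms indexed by `I` is attained at least twice. -/
def fanOn (ℓ : ι → E3) (I : Set ι) : Set E3 :=
  {x | ∃ k ∈ I, ∃ l ∈ I, k ≠ l ∧ inner ℝ (ℓ k) x = inner ℝ (ℓ l) x ∧
    ∀ m ∈ I, inner ℝ (ℓ k) x ≤ inner ℝ (ℓ m) x}

/-- The points where the minimum of the family is attained at least twice. -/
def fan (ℓ : ι → E3) : Set E3 := {x | ∃ k ∈ active ℓ x, ∃ l ∈ active ℓ x, k ≠ l}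

/-- The points where the minimum is attained exactly at `k` and `l`. -/
def openFace (ℓ : ι → E3) (k l : ι) : Set E3 :=
  {x | inner ℝ (ℓ k) x = inner ℝ (ℓ l) x ∧
    ∀ m, m ≠ k → m ≠ l → inner ℝ (ℓ k) x < inner ℝ (ℓ m) x}

/-- The points where the minimum is attained at `k` only. -/
def sector (ℓ : ι → E3) (k : ι) : Set E3 :=
  {x | ∀ m, m ≠ k → inner ℝ (ℓ k) x < inner ℝ (ℓ m) x}

/-- The family takes arbitrary values up to a common constant. -/
def FanIndep (ℓ : ι → E3) : Prop :=
  ∀ y : ι → ℝ, ∃ (x : E3) (c : ℝ), ∀ i, inner ℝ (ℓ i) x = y i + c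

theorem active_eq {x : E3} {k l : ι} (hk : k ∈ active ℓ x) (hl : l ∈ active ℓ x) :
    inner ℝ (ℓ k) x = inner ℝ (ℓ l) x :=
  le_antisymm (hk l) (hl k)

theorem mem_active_of_eq {x : E3} {k l : ι} (hk : k ∈ active ℓ x)
    (h : inner ℝ (ℓ k) x = inner ℝ (ℓ l) x) : l ∈ active ℓ x :=
  fun m => h ▸ hk m

theorem mem_active_of_mem_openFace {x : E3} {k l : ι} (h : x ∈ openFace ℓ k l) :
    k ∈ active ℓ x := by
  intro m
  by_cases h1 : m = k
  · rw [h1]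
  by_cases h2 : m = l
  · rw [h2, h.1]
  · exact (h.2 m h1 h2).le

theorem mem_active_of_mem_openFace' {x : E3} {k l : ι} (h : x ∈ openFace ℓ k l) :
    l ∈ active ℓ x :=
  mem_active_of_eq (mem_active_of_mem_openFace h) h.1

theorem mem_openFace_iff {x : E3} {k l : ι} : x ∈ openFace ℓ k l ↔ active ℓ x = {k, l} := by
  constructor
  · intro h
    ext m
    constructor
    · intro hm
      by_contra hne
      simp only [mem_insert_iff, mem_singleton_iff, not_or] at hne
      exact absurd (hm k) (not_le.2 (h.2 m hne.1 hne.2))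
    · rintro (rfl | rfl)
      · exact mem_active_of_mem_openFace h
      · exact mem_active_of_mem_openFace' h
  · intro h
    have hk : k ∈ active ℓ x := by rw [h]; simp
    have hl : l ∈ active ℓ x := by rw [h]; simp
    refine ⟨active_eq hk hl, fun m h1 h2 => lt_of_le_of_ne (hk m) fun he => ?_⟩
    have := mem_active_of_eq hk he
    rw [h] at this
    simp [h1, h2] at this

theorem openFace_comm (k l : ι) : openFace ℓ k l = openFace ℓ l k := by
  ext x
  rw [mem_openFace_iff, mem_openFace_iff, pair_comm]

theorem mem_sector_iff {x : E3} {k : ι} : x ∈ sector ℓ k ↔ active ℓ x = {k} := by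
  constructor
  · intro h
    ext m
    constructor
    · intro hm
      by_contra hne
      exact absurd (hm k) (not_le.2 (h m hne))
    · rintro rfl l
      by_cases hl : l = m
      · rw [hl]
      · exact (h l hl).le
  · intro h m hm
    have hk : k ∈ active ℓ x := by rw [h]; simp
    refine lt_of_le_of_ne (hk m) fun he => ?_
    have := mem_active_of_eq hk he
    rw [h] at this
    exact hm this

theorem active_nonempty [Nonempty ι] (x : E3) : (active ℓ x).Nonempty := by
  obtain ⟨k, hk⟩ := Finite.exists_min fun i => inner ℝ (ℓ i) x
  exact ⟨k, hk⟩

theorem notMem_fan_iff [Nonempty ι] {x : E3} : x ∉ fan ℓ ↔ ∃ k, x ∈ sector ℓ k := by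
  simp only [mem_sector_iff]
  constructor
  · intro h
    obtain ⟨k, hk⟩ := active_nonempty (ℓ := ℓ) x
    refine ⟨k, Subset.antisymm (fun l hl => ?_) (singleton_subset_iff.2 hk)⟩
    by_contra hne
    exact h ⟨k, hk, l, hl, fun e => hne e.symm⟩
  · rintro ⟨k, hk⟩ ⟨a, ha, b, hb, hab⟩
    rw [hk] at ha hb
    exact hab (ha.trans hb.symm)

theorem openFace_subset_fan {k l : ι} (h : k ≠ l) : openFace ℓ k l ⊆ fan ℓ := fun _ hx =>
  ⟨k, mem_active_of_mem_openFace hx, l, mem_active_of_mem_openFace' hx, h⟩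

theorem active_zero : active ℓ 0 = univ := by
  ext k
  simp [active]

theorem active_smul {x : E3} {c : ℝ} (hc : 0 < c) : active ℓ (c • x) = active ℓ x := by
  ext k
  simp only [active, mem_ofPred, real_inner_smul_right]
  exact forall_congr' fun m => mul_le_mul_iff_right₀ hc

theorem convex_openFace (k l : ι) : Convex ℝ (openFace ℓ k l) := by
  rintro x ⟨hx, hx'⟩ y ⟨hy, hy'⟩ a b ha hb hab
  simp only [openFace, mem_ofPred, inner_add_right, real_inner_smul_right]
  refine ⟨by rw [hx, hy], fun m h1 h2 => ?_⟩
  have e1 := hx' m h1 h2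
  have e2 := hy' m h1 h2
  rcases ha.eq_or_lt with rfl | ha
  · have : b = 1 := by linarith
    subst this
    linarith
  · have := mul_lt_mul_of_pos_left e1 ha
    have := mul_le_mul_of_nonneg_left e2.le hb
    linarith

theorem convex_sector (k : ι) : Convex ℝ (sector ℓ k) := by
  intro x hx y hy a b ha hb hab m hm
  simp only [inner_add_right, real_inner_smul_right]
  have e1 := hx m hm
  have e2 := hy m hm
  rcases ha.eq_or_lt with rfl | ha
  · have : b = 1 := by linarith
    subst this
    linarith
  · have := mul_lt_mul_of_pos_left e1 ha
    have := mul_le_mul_of_nonneg_left e2.le hb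
    linarith

theorem isOpen_sector (k : ι) : IsOpen (sector ℓ k) := by
  have : sector ℓ k = ⋂ m, {x | m ≠ k → inner ℝ (ℓ k) x < inner ℝ (ℓ m) x} := by
    ext x; simp [sector]
  rw [this]
  refine isOpen_iInter_of_finite fun m => ?_
  by_cases hm : m = k
  · simp [hm]
  · simp only [ne_eq, hm, not_false_eq_true, true_imp_iff]
    exact isOpen_lt (by fun_prop) (by fun_prop)

theorem eventually_lt_of_lt (x : E3) :
    ∀ᶠ y in 𝓝 x, ∀ k m : ι, inner ℝ (ℓ k) x < inner ℝ (ℓ m) x →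
      inner ℝ (ℓ k) y < inner ℝ (ℓ m) y := by
  refine eventually_all.2 fun k => eventually_all.2 fun m => ?_
  by_cases h : inner ℝ (ℓ k) x < inner ℝ (ℓ m) x
  · have : IsOpen {y : E3 | inner ℝ (ℓ k) y < inner ℝ (ℓ m) y} :=
      isOpen_lt (by fun_prop) (by fun_prop)
    filter_upwards [this.mem_nhds h] with y hy _ using hy
  · exact Eventually.of_forall fun y hy => absurd hy h

theorem eventually_active_subset (x : E3) : ∀ᶠ y in 𝓝 x, active ℓ y ⊆ active ℓ x := by
  filter_upwards [eventually_lt_of_lt (ℓ := ℓ) x] with y hy k hk m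
  by_contra h
  exact absurd (hk m) (not_le.2 (hy m k (not_le.1 h)))

theorem isClosed_fanOn (I : Set ι) : IsClosed (fanOn ℓ I) := by
  have : fanOn ℓ I = ⋃ k, ⋃ l, {x | (k ∈ I ∧ l ∈ I ∧ k ≠ l) ∧
      inner ℝ (ℓ k) x = inner ℝ (ℓ l) x ∧ ∀ m ∈ I, inner ℝ (ℓ k) x ≤ inner ℝ (ℓ m) x} := by
    ext x
    simp only [fanOn, mem_ofPred, mem_iUnion]
    constructor
    · rintro ⟨k, hk, l, hl, h, h'⟩
      exact ⟨k, l, ⟨hk, hl, h⟩, h'⟩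
    · rintro ⟨k, l, ⟨hk, hl, h⟩, h'⟩
      exact ⟨k, hk, l, hl, h, h'⟩
  rw [this]
  refine isClosed_iUnion_of_finite fun k => isClosed_iUnion_of_finite fun l => ?_
  refine IsClosed.inter isClosed_const (IsClosed.inter (isClosed_eq (by fun_prop) (by fun_prop)) ?_)
  have h : IsClosed {x : E3 | ∀ m ∈ I, inner ℝ (ℓ k) x ≤ inner ℝ (ℓ m) x} := by
    have : {x : E3 | ∀ m ∈ I, inner ℝ (ℓ k) x ≤ inner ℝ (ℓ m) x} =
        ⋂ m ∈ I, {x | inner ℝ (ℓ k) x ≤ inner ℝ (ℓ m) x} := by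
      ext x; simp
    rw [this]
    exact isClosed_biInter fun m _ => isClosed_le (by fun_prop) (by fun_prop)
  exact h

theorem smul_mem_fanOn {I : Set ι} {c : ℝ} (hc : 0 ≤ c) {v : E3} (hv : v ∈ fanOn ℓ I) :
    c • v ∈ fanOn ℓ I := by
  obtain ⟨k, hk, l, hl, hkl, h, h'⟩ := hv
  refine ⟨k, hk, l, hl, hkl, ?_, fun m hm => ?_⟩
  · simp only [real_inner_smul_right, h]
  · simp only [real_inner_smul_right]
    exact mul_le_mul_of_nonneg_left (h' m hm) hc

/-- Near `x` only the forms active at `x` compete for the minimum, and they share one value at `x`;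
so `y` lies in the fan exactly when `y - x` lies in the fan of the active forms. -/
theorem tangentCone_fan (x : E3) : tangentCone (fan ℓ) x = fanOn ℓ (active ℓ x) := by
  refine tangentCone_eq_of_eventually (isClosed_fanOn _) (fun c hc v hv => smul_mem_fanOn hc hv) ?_
  filter_upwards [eventually_lt_of_lt (ℓ := ℓ) x, eventually_active_subset (ℓ := ℓ) x] with y hy hy'
  constructor
  · rintro ⟨k, hk, l, hl, hkl⟩
    refine ⟨k, hy' hk, l, hy' hl, hkl, ?_, fun m hm => ?_⟩
    · rw [inner_sub_right, inner_sub_right, active_eq hk hl, active_eq (hy' hk) (hy' hl)]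
    · rw [inner_sub_right, inner_sub_right, active_eq (hy' hk) hm]
      linarith [hk m]
  · rintro ⟨k, hk, l, hl, hkl, h, h'⟩
    rw [inner_sub_right, inner_sub_right, active_eq hk hl] at h
    have hk' : k ∈ active ℓ y := by
      intro m
      by_cases hm : m ∈ active ℓ x
      · have := h' m hm
        rw [inner_sub_right, inner_sub_right, active_eq hk hm] at this
        linarith
      · refine (hy k m (lt_of_le_of_ne (hk m) fun he => hm (mem_active_of_eq hk he))).le
    exact ⟨k, hk', l, mem_active_of_eq hk' (by linarith), hkl⟩

/-- A set closed under negation. -/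
def NegClosed (K : Set E3) : Prop := ∀ v ∈ K, -v ∈ K

/-- A set invariant under some nontrivial translation. -/
def TranslationInvariant (K : Set E3) : Prop := ∃ v : E3, v ≠ 0 ∧ ∀ x ∈ K, x + v ∈ K

theorem negClosed_fanOn {I : Set ι} {k l : ι} (hI : I ⊆ {k, l}) : NegClosed (fanOn ℓ I) := by
  rintro v ⟨a, ha, b, hb, hab, h, -⟩
  refine ⟨a, ha, b, hb, hab, by simp [inner_neg_right, h], fun m hm => ?_⟩
  have : m = a ∨ m = b := by
    have h1 := hI ha
    have h2 := hI hb
    have h3 := hI hm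
    simp only [mem_insert_iff, mem_singleton_iff] at h1 h2 h3
    grind
  rcases this with rfl | rfl
  · rfl
  · simp [inner_neg_right, h]

/-- Raising the form `j` alone gives a point of the fan, the minimum being shared by `k` and `l`; at
the opposite point `j` is the only minimizer. -/
theorem not_negClosed_fanOn (hℓ : FanIndep ℓ) {I : Set ι} {k l j : ι} (hk : k ∈ I) (hl : l ∈ I)
    (hj : j ∈ I) (hkl : k ≠ l) (hkj : k ≠ j) (hlj : l ≠ j) : ¬ NegClosed (fanOn ℓ I) := by
  classical
  intro hneg
  obtain ⟨x, c, hx⟩ := hℓ fun i => if i = j then 1 else 0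
  obtain ⟨a, ha, b, hb, hab, h, h'⟩ := hneg x ⟨k, hk, l, hl, hkl, by simp [hx, hkj, hlj],
    fun m _ => by simp only [hx, hkj, if_false]; split_ifs <;> linarith⟩
  have h1 := h' j hj
  simp only [inner_neg_right, hx, if_true] at h h1
  split_ifs at h h1 with e1 e2
  · exact hab (e1.trans e2.symm)
  all_goals linarith

/-- Two differences of forms span at most a plane of three-space, so all forms of `I` agree on some
nonzero `v`; translating by `v` shifts them by the same amount. -/
theorem translationInvariant_fanOn {I : Set ι} {k l j : ι} (hI : I ⊆ {k, l, j}) :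
    TranslationInvariant (fanOn ℓ I) := by
  let s : Set E3 := {ℓ k - ℓ l, ℓ k - ℓ j}
  have hs : Module.finrank ℝ (Submodule.span ℝ s) ≤ 2 := by
    classical
    have := finrank_span_finset_le_card (R := ℝ) ({ℓ k - ℓ l, ℓ k - ℓ j} : Finset E3)
    rw [Finset.coe_pair] at this
    exact this.trans Finset.card_le_two
  have h3 := (Submodule.span ℝ s).finrank_add_finrank_orthogonal
  rw [finrank_euclideanSpace_fin] at h3
  have hpos : 0 < Module.finrank ℝ (Submodule.span ℝ s)ᗮ := by omega
  have := Module.finrank_pos_iff.1 hpos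
  obtain ⟨⟨v, hv⟩, hv0⟩ := exists_ne (0 : (Submodule.span ℝ s)ᗮ)
  have h1 : inner ℝ (ℓ k) v = inner ℝ (ℓ l) v := by
    have := (Submodule.mem_orthogonal _ _).1 hv (ℓ k - ℓ l) (Submodule.subset_span (by simp [s]))
    rw [inner_sub_left] at this
    linarith
  have h2 : inner ℝ (ℓ k) v = inner ℝ (ℓ j) v := by
    have := (Submodule.mem_orthogonal _ _).1 hv (ℓ k - ℓ j) (Submodule.subset_span (by simp [s]))
    rw [inner_sub_left] at this
    linarith
  have hall : ∀ m ∈ I, inner ℝ (ℓ m) v = inner ℝ (ℓ k) v := by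
    intro m hm
    rcases hI hm with rfl | rfl | rfl
    · rfl
    · exact h1.symm
    · exact h2.symm
  refine ⟨v, fun h0 => hv0 (Subtype.ext h0), ?_⟩
  rintro x ⟨a, ha, b, hb, hab, h, h'⟩
  refine ⟨a, ha, b, hb, hab, ?_, fun m hm => ?_⟩
  · rw [inner_add_right, inner_add_right, hall a ha, hall b hb, h]
  · rw [inner_add_right, inner_add_right, hall a ha, hall m hm]
    linarith [h' m hm]

theorem fanOn_univ : fanOn ℓ univ = fan ℓ := by
  ext x
  constructor
  · rintro ⟨k, -, l, -, hkl, h, h'⟩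
    have hk : k ∈ active ℓ x := fun m => h' m (mem_univ m)
    exact ⟨k, hk, l, mem_active_of_eq hk h, hkl⟩
  · rintro ⟨k, hk, l, hl, hkl⟩
    exact ⟨k, mem_univ k, l, mem_univ l, hkl, active_eq hk hl, fun m _ => hk m⟩

theorem exists_mem_openFace (hℓ : FanIndep ℓ) (k l : ι) : (openFace ℓ k l).Nonempty := by
  classical
  obtain ⟨x, c, hx⟩ := hℓ fun i => if i = k ∨ i = l then 0 else 1
  exact ⟨x, by simp [hx], fun m h1 h2 => by simp [hx, h1, h2]⟩

/-- Take `x` in an open face. The fan is a cone, so invariance under `v` puts x + t v in the fan for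
every t > 0. For small t only `k` and `l` can be active there, which forces them to agree on `v`.
This holds for every pair. -/
theorem not_translationInvariant_fan (hℓ : FanIndep ℓ)
    (hinj : ∀ v, (∀ i j, inner ℝ (ℓ i) v = inner ℝ (ℓ j) v) → v = 0) :
    ¬ TranslationInvariant (fan ℓ) := by
  rintro ⟨v, hv0, hv⟩
  refine hv0 (hinj v fun k l => ?_)
  by_cases hkl : k = l
  · rw [hkl]
  obtain ⟨x, hx⟩ := exists_mem_openFace hℓ k l
  have hx' := mem_openFace_iff.1 hx
  have hlim : Tendsto (fun t : ℝ => x + t • v) (𝓝[>] 0) (𝓝 x) := by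
    have : Tendsto (fun s : ℝ => x + s • v) (𝓝 0) (𝓝 (x + (0 : ℝ) • v)) :=
      (continuous_const.add (continuous_id.smul continuous_const)).tendsto 0
    rw [zero_smul, add_zero] at this
    exact this.mono_left nhdsWithin_le_nhds
  obtain ⟨t, ht, ht0⟩ := ((hlim.eventually (eventually_active_subset (ℓ := ℓ) x)).and
    self_mem_nhdsWithin).exists
  have ht0 : 0 < t := ht0
  have h1 : t⁻¹ • x ∈ fan ℓ := by
    have := openFace_subset_fan hkl hx
    simp only [fan, mem_ofPred, active_smul (inv_pos.2 ht0)]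
    exact this
  have h2 := hv _ h1
  have e : t⁻¹ • x + v = t⁻¹ • (x + t • v) := by
    rw [smul_add, smul_smul, inv_mul_cancel₀ ht0.ne', one_smul]
  rw [e] at h2
  simp only [fan, mem_ofPred, active_smul (inv_pos.2 ht0)] at h2
  obtain ⟨a, ha, b, hb, hab⟩ := h2
  have h3 := ht ha
  have h4 := ht hb
  rw [hx'] at h3 h4
  have h5 := active_eq ha hb
  have hkl' : inner ℝ (ℓ k) (x + t • v) = inner ℝ (ℓ l) (x + t • v) := by
    rcases h3 with rfl | rfl <;> rcases h4 with rfl | rfl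
    · exact absurd rfl hab
    · exact h5
    · exact h5.symm
    · exact absurd rfl hab
  rw [inner_add_right, inner_add_right, real_inner_smul_right, real_inner_smul_right, hx.1] at hkl'
  exact mul_left_cancel₀ ht0.ne' (by linarith)

/-- From a point where `k` and `l` are active one can move into the open face of `k` and `l`. -/
theorem exists_ray_openFace (hℓ : FanIndep ℓ) {x : E3} {k l : ι} (hk : k ∈ active ℓ x)
    (hl : l ∈ active ℓ x) : ∃ v : E3, ∀ s : ℝ, 0 < s → x + s • v ∈ openFace ℓ k l := by
  obtain ⟨v, hv⟩ := exists_mem_openFace hℓ k l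
  refine ⟨v, fun s hs => ⟨?_, fun m h1 h2 => ?_⟩⟩
  · simp only [inner_add_right, real_inner_smul_right, active_eq hk hl, hv.1]
  · simp only [inner_add_right, real_inner_smul_right]
    have := mul_lt_mul_of_pos_left (hv.2 m h1 h2) hs
    linarith [hk m]

/-- From a point where `k` is active one can move into the sector of `k`. -/
theorem exists_ray_sector (hℓ : FanIndep ℓ) {x : E3} {k : ι} (hk : k ∈ active ℓ x) :
    ∃ v : E3, ∀ s : ℝ, 0 < s → x + s • v ∈ sector ℓ k := by
  classical
  obtain ⟨v, c, hv⟩ := hℓ fun i => if i = k then 0 else 1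
  refine ⟨v, fun s hs m hm => ?_⟩
  simp only [inner_add_right, real_inner_smul_right, hv, hm, if_true, if_false]
  linarith [hk m]

/-- The relative interior of a face is open in the plane of the face. -/
theorem eventually_mem_openFace {x v : E3} {k l : ι} (hx : x ∈ openFace ℓ k l)
    (hv : inner ℝ (ℓ k) v = inner ℝ (ℓ l) v) : ∀ᶠ s : ℝ in 𝓝[>] 0, x + s • v ∈ openFace ℓ k l := by
  have hlim : Tendsto (fun t : ℝ => x + t • v) (𝓝[>] 0) (𝓝 x) := by
    have : Tendsto (fun s : ℝ => x + s • v) (𝓝 0) (𝓝 (x + (0 : ℝ) • v)) :=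
      (continuous_const.add (continuous_id.smul continuous_const)).tendsto 0
    rw [zero_smul, add_zero] at this
    exact this.mono_left nhdsWithin_le_nhds
  filter_upwards [hlim.eventually (eventually_lt_of_lt (ℓ := ℓ) x)] with s hs
  exact ⟨by rw [inner_add_right, inner_add_right, real_inner_smul_right, real_inner_smul_right,
    hx.1, hv], fun m h1 h2 => hs k m (hx.2 m h1 h2)⟩

end Fan

/-! ### The model cones are fans -/

/-- The linear forms defining the plane. -/
noncomputable def formsP : Fin 2 → E3 := ![!₂[0, 0, 1], !₂[0, 0, -1]]

/-- The linear forms defining the cone `Y`. -/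
noncomputable def formsY : Fin 3 → E3 :=
  ![!₂[1, 0, 0], !₂[-(1 / 2), √3 / 2, 0], !₂[-(1 / 2), -(√3 / 2), 0]]

theorem inner_eq_sum (x y : E3) : inner ℝ x y = x 0 * y 0 + x 1 * y 1 + x 2 * y 2 := by
  simp [PiLp.inner_apply, Fin.sum_univ_three, mul_comm]

/-- Each of the three families sums to zero, so the common constant must be minus the mean of `y`.
The witness is the sum of the vectors y_i ℓ_i times 1/2, 2/3 and 1/4 respectively. -/
theorem fanIndep_formsP : FanIndep formsP := by
  intro y
  refine ⟨!₂[0, 0, (y 0 - y 1) / 2], -(y 0 + y 1) / 2, fun i => ?_⟩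
  fin_cases i <;> simp [formsP, inner_eq_sum] <;> ring

theorem fanIndep_formsY : FanIndep formsY := by
  intro y
  have h3 : √3 * √3 = 3 := Real.mul_self_sqrt (by norm_num)
  refine ⟨!₂[(2 * y 0 - y 1 - y 2) / 3, (y 1 - y 2) * √3 / 3, 0], -(y 0 + y 1 + y 2) / 3,
    fun i => ?_⟩
  fin_cases i <;> simp [formsY, inner_eq_sum] <;> linarith [congrArg (fun t => t * (y 1 - y 2)) h3]

theorem fanIndep_tetraVertex : FanIndep tetraVertex := by
  intro y
  refine ⟨!₂[(y 0 - y 1 - y 2 + y 3) / 4, (y 0 - y 1 + y 2 - y 3) / 4,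
    (y 0 + y 1 - y 2 - y 3) / 4], -(y 0 + y 1 + y 2 + y 3) / 4, fun i => ?_⟩
  fin_cases i <;> simp [tetraVertex, inner_eq_sum] <;> ring

theorem eq_zero_of_inner_tetraVertex_eq (v : E3)
    (h : ∀ i j, inner ℝ (tetraVertex i) v = inner ℝ (tetraVertex j) v) : v = 0 := by
  have h1 := h 0 1
  have h2 := h 0 2
  have h3 := h 0 3
  simp [tetraVertex, inner_eq_sum] at h1 h2 h3
  ext i
  fin_cases i <;> simp <;> linarith

theorem coneP_eq_fan : coneP = fan formsP := by
  ext x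
  simp only [coneP, fan, active, mem_ofPred, Fin.forall_fin_two, Fin.exists_fin_two, formsP,
    inner_eq_sum]
  simp
  constructor
  · intro h
    simp [h]
  · rintro (h | h) <;> linarith [h.1, h.2]

/-- The forms are unit vectors at angles 0, 2π/3 and 4π/3. Two of them tie for the minimum on the
half-plane in the direction of the third. -/
theorem coneY_eq_fan : coneY = fan formsY := by
  have h3 : √3 * √3 = 3 := Real.mul_self_sqrt (by norm_num)
  have h30 : 0 < √3 := Real.sqrt_pos.2 (by norm_num)
  have c1 : Real.cos (2 * Real.pi / 3) = -(1 / 2) := by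
    rw [show 2 * Real.pi / 3 = Real.pi - Real.pi / 3 by ring, Real.cos_pi_sub,
      Real.cos_pi_div_three]
  have s1 : Real.sin (2 * Real.pi / 3) = √3 / 2 := by
    rw [show 2 * Real.pi / 3 = Real.pi - Real.pi / 3 by ring, Real.sin_pi_sub,
      Real.sin_pi_div_three]
  have c2 : Real.cos (4 * Real.pi / 3) = -(1 / 2) := by
    rw [show 4 * Real.pi / 3 = Real.pi / 3 + Real.pi by ring, Real.cos_add_pi,
      Real.cos_pi_div_three]
  have s2 : Real.sin (4 * Real.pi / 3) = -(√3 / 2) := by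
    rw [show 4 * Real.pi / 3 = Real.pi / 3 + Real.pi by ring, Real.sin_add_pi,
      Real.sin_pi_div_three]
  have e0 (x : E3) : inner ℝ (formsY 0) x = x 0 := by simp [formsY, inner_eq_sum]
  have e1 (x : E3) : inner ℝ (formsY 1) x = -(1 / 2) * x 0 + √3 / 2 * x 1 := by
    simp [formsY, inner_eq_sum]
  have e2 (x : E3) : inner ℝ (formsY 2) x = -(1 / 2) * x 0 - √3 / 2 * x 1 := by
    simp [formsY, inner_eq_sum]; ring
  ext x
  constructor
  · rintro ⟨r, θ, z, hr, rfl | rfl | rfl, rfl⟩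
    · refine ⟨1, ?_, 2, ?_, by decide⟩ <;> intro m <;> fin_cases m <;> simp [e0, e1, e2] <;>
        linarith
    · refine ⟨0, ?_, 2, ?_, by decide⟩ <;> intro m <;> fin_cases m <;>
        simp [e0, e1, e2, c1, s1] <;> nlinarith
    · refine ⟨0, ?_, 1, ?_, by decide⟩ <;> intro m <;> fin_cases m <;>
        simp [e0, e1, e2, c2, s2] <;> nlinarith
  · have key (r θ : ℝ) (hr : 0 ≤ r) (hθ : θ = 0 ∨ θ = 2 * Real.pi / 3 ∨ θ = 4 * Real.pi / 3)
        (h0 : x 0 = r * Real.cos θ) (h1 : x 1 = r * Real.sin θ) : x ∈ coneY := by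
      refine ⟨r, θ, x 2, hr, hθ, ?_⟩
      ext i
      fin_cases i <;> simp [h0, h1]
    have k12 (h : inner ℝ (formsY 1) x = inner ℝ (formsY 2) x)
        (h' : inner ℝ (formsY 1) x ≤ inner ℝ (formsY 0) x) : x ∈ coneY := by
      rw [e1, e2] at h
      rw [e0, e1] at h'
      have : √3 * x 1 = 0 := by linarith
      have hx : x 1 = 0 := by simpa [h30.ne'] using this
      refine key (x 0) 0 ?_ (Or.inl rfl) (by simp) (by simp [hx])
      rw [hx] at h'
      linarith
    have k02 (h : inner ℝ (formsY 0) x = inner ℝ (formsY 2) x)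
        (h' : inner ℝ (formsY 0) x ≤ inner ℝ (formsY 1) x) : x ∈ coneY := by
      rw [e0, e2] at h
      rw [e0, e1] at h'
      refine key (-2 * x 0) _ (by linarith) (Or.inr (Or.inl rfl)) (by rw [c1]; ring) ?_
      rw [s1]
      refine mul_left_cancel₀ h30.ne' ?_
      linear_combination 2 * h + x 0 * h3
    have k01 (h : inner ℝ (formsY 0) x = inner ℝ (formsY 1) x)
        (h' : inner ℝ (formsY 0) x ≤ inner ℝ (formsY 2) x) : x ∈ coneY := by
      rw [e0, e1] at h
      rw [e0, e2] at h'
      refine key (-2 * x 0) _ (by linarith) (Or.inr (Or.inr rfl)) (by rw [c2]; ring) ?_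
      rw [s2]
      refine mul_left_cancel₀ h30.ne' ?_
      linear_combination -2 * h - x 0 * h3
    rintro ⟨k, hk, l, hl, hkl⟩
    have h := active_eq hk hl
    fin_cases k <;> fin_cases l <;> first | exact absurd rfl hkl | skip
    · exact k01 h (hk 2)
    · exact k02 h (hk 1)
    · exact k01 h.symm (hl 2)
    · exact k12 h (hk 0)
    · exact k02 h.symm (hl 1)
    · exact k12 h.symm (hl 0)

/-- At a p_i + b p_j the other two forms both equal -(a + b), which is the minimum, while the form i
equals 3a - b. This gives the correspondence between complementary pairs and the formula for a as a
quarter of a difference of forms. -/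
theorem coneT_eq_fan : coneT = fan tetraVertex := by
  have e0 (x : E3) : inner ℝ (tetraVertex 0) x = x 0 + x 1 + x 2 := by
    simp [tetraVertex, inner_eq_sum]
  have e1 (x : E3) : inner ℝ (tetraVertex 1) x = -x 0 - x 1 + x 2 := by
    simp [tetraVertex, inner_eq_sum]; ring
  have e2 (x : E3) : inner ℝ (tetraVertex 2) x = -x 0 + x 1 - x 2 := by
    simp [tetraVertex, inner_eq_sum]; ring
  have e3 (x : E3) : inner ℝ (tetraVertex 3) x = x 0 - x 1 - x 2 := by
    simp [tetraVertex, inner_eq_sum]; ring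
  ext x
  constructor
  · have key (i j k l : Fin 4) (a b : ℝ) (ha : 0 ≤ a) (hb : 0 ≤ b) (hkl : k ≠ l)
        (hk : k ∈ active tetraVertex (a • tetraVertex i + b • tetraVertex j))
        (hl : inner ℝ (tetraVertex k) (a • tetraVertex i + b • tetraVertex j) =
          inner ℝ (tetraVertex l) (a • tetraVertex i + b • tetraVertex j)) :
        a • tetraVertex i + b • tetraVertex j ∈ fan tetraVertex :=
      ⟨k, hk, l, mem_active_of_eq hk hl, hkl⟩
    rintro ⟨i, j, a, b, hij, ha, hb, rfl⟩
    fin_cases i <;> fin_cases j <;> first | exact absurd hij (by decide) | skip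
    · refine key 0 1 2 3 a b ha hb (by decide) (fun m => ?_) ?_
      · fin_cases m <;> simp [e0, e1, e2, e3] <;> simp [tetraVertex] <;> linarith
      · simp [e2, e3]; simp [tetraVertex]; try ring
    · refine key 0 2 1 3 a b ha hb (by decide) (fun m => ?_) ?_
      · fin_cases m <;> simp [e0, e1, e2, e3] <;> simp [tetraVertex] <;> linarith
      · simp [e1, e3]; simp [tetraVertex]; try ring
    · refine key 0 3 1 2 a b ha hb (by decide) (fun m => ?_) ?_
      · fin_cases m <;> simp [e0, e1, e2, e3] <;> simp [tetraVertex] <;> linarith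
      · simp [e1, e2]; simp [tetraVertex]; try ring
    · refine key 1 2 0 3 a b ha hb (by decide) (fun m => ?_) ?_
      · fin_cases m <;> simp [e0, e1, e2, e3] <;> simp [tetraVertex] <;> linarith
      · simp [e0, e3]; simp [tetraVertex]; try ring
    · refine key 1 3 0 2 a b ha hb (by decide) (fun m => ?_) ?_
      · fin_cases m <;> simp [e0, e1, e2, e3] <;> simp [tetraVertex] <;> linarith
      · simp [e0, e2]; simp [tetraVertex]; try ring
    · refine key 2 3 0 1 a b ha hb (by decide) (fun m => ?_) ?_
      · fin_cases m <;> simp [e0, e1, e2, e3] <;> simp [tetraVertex] <;> linarith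
      · simp [e0, e1]; simp [tetraVertex]; try ring
  · have key (i j k l : Fin 4) (hij : i < j) (hk : k ∈ active tetraVertex x)
        (hx : x = ((inner ℝ (tetraVertex i) x - inner ℝ (tetraVertex k) x) / 4) • tetraVertex i +
          ((inner ℝ (tetraVertex j) x - inner ℝ (tetraVertex k) x) / 4) • tetraVertex j) :
        x ∈ coneT :=
      ⟨i, j, _, _, hij, by linarith [hk i], by linarith [hk j], hx⟩
    have main (k l : Fin 4) (hkl : k < l) (hk : k ∈ active tetraVertex x)
        (h : inner ℝ (tetraVertex k) x = inner ℝ (tetraVertex l) x) : x ∈ coneT := by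
      fin_cases k <;> fin_cases l <;> first | exact absurd hkl (by decide) | skip
      · refine key 2 3 0 1 (by decide) hk ?_
        simp [e0, e1] at h
        ext m; fin_cases m <;> simp [e0, e1, e2, e3] <;> simp [tetraVertex] <;> linarith
      · refine key 1 3 0 2 (by decide) hk ?_
        simp [e0, e2] at h
        ext m; fin_cases m <;> simp [e0, e1, e2, e3] <;> simp [tetraVertex] <;> linarith
      · refine key 1 2 0 3 (by decide) hk ?_
        simp [e0, e3] at h
        ext m; fin_cases m <;> simp [e0, e1, e2, e3] <;> simp [tetraVertex] <;> linarith
      · refine key 0 3 1 2 (by decide) hk ?_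
        simp [e1, e2] at h
        ext m; fin_cases m <;> simp [e0, e1, e2, e3] <;> simp [tetraVertex] <;> linarith
      · refine key 0 2 1 3 (by decide) hk ?_
        simp [e1, e3] at h
        ext m; fin_cases m <;> simp [e0, e1, e2, e3] <;> simp [tetraVertex] <;> linarith
      · refine key 0 1 2 3 (by decide) hk ?_
        simp [e2, e3] at h
        ext m; fin_cases m <;> simp [e0, e1, e2, e3] <;> simp [tetraVertex] <;> linarith
    rintro ⟨k, hk, l, hl, hkl⟩
    rcases lt_or_gt_of_ne hkl with h | h
    · exact main k l h hk (active_eq hk hl)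
    · exact main l k h hl (active_eq hl hk)

/-! ### Charts onto fans -/

/-- `φ` is a `C^{1,α}` chart at `p`, with values in a ball around the origin, carrying `S` to
the fan of `ℓ`. -/
structure FanChart {ι : Type*} (α : ℝ≥0) (U S : Set E3) (ℓ : ι → E3) (p : E3)
    (φ : OpenPartialHomeomorph E3 E3) : Prop where
  indep : FanIndep ℓ
  mem_source : p ∈ φ.source
  map_center : φ p = 0
  target_eq : ∃ ε > 0, φ.target = Metric.ball 0 ε
  source_subset : φ.source ⊆ U
  regular : ∀ x ∈ φ.source, C1AlphaAt α φ x
  regular_symm : ∀ y ∈ φ.target, C1AlphaAt α φ.symm y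
  mem_iff : ∀ x ∈ φ.source, x ∈ S ↔ φ x ∈ fan ℓ

section Charts

variable {α : ℝ≥0} {U S : Set E3}

theorem IsConeChart.exists_fanChart {ι : Type*} {ℓ : ι → E3} {p : E3} {r : ℝ}
    {φ : OpenPartialHomeomorph E3 E3} (h : IsConeChart α S (fan ℓ) p r φ) (hℓ : FanIndep ℓ)
    (hr : 0 < r) (hU : Metric.ball p r ⊆ U) :
    ∃ ψ : OpenPartialHomeomorph E3 E3, FanChart α U S ℓ p ψ ∧ fderiv ℝ ψ p = fderiv ℝ φ p := by
  have hp : p ∈ φ.source := by rw [h.source_eq]; exact Metric.mem_ball_self hr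
  have h0 : (0 : E3) ∈ φ.target := by rw [← h.map_center]; exact φ.map_source hp
  obtain ⟨ε, hε, hball⟩ := Metric.isOpen_iff.1 φ.open_target 0 h0
  -- The chart is shrunk on the target side, so that the image is a ball and meets convex sets in
  -- connected sets.
  let ψ := (φ.symm.restrOpen (Metric.ball 0 ε) Metric.isOpen_ball).symm
  have hψ : (ψ : E3 → E3) = φ := rfl
  have hψs : (ψ.symm : E3 → E3) = φ.symm := rfl
  have hsrc : ψ.source = φ.source ∩ φ ⁻¹' Metric.ball 0 ε := rfl
  have htgt : ψ.target = φ.target ∩ Metric.ball 0 ε := rfl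
  have htgt' : ψ.target = Metric.ball 0 ε := by rw [htgt, inter_eq_right.2 hball]
  have hsub : ψ.source ⊆ φ.source := by rw [hsrc]; exact inter_subset_left
  refine ⟨ψ, ⟨hℓ, ?_, h.map_center, ⟨ε, hε, htgt'⟩, ?_, ?_, ?_, ?_⟩, rfl⟩
  · rw [hsrc]
    exact ⟨hp, by simpa [h.map_center] using hε⟩
  · exact hsub.trans (h.source_eq ▸ hU)
  · exact fun x hx => h.regular.c1AlphaAt φ.open_source (hsub hx)
  · intro y hy
    rw [htgt'] at hy
    exact h.regular_symm.c1AlphaAt φ.open_target (hball hy)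
  · intro x hx
    have hx' : x ∈ φ.source := hsub hx
    have hxb : x ∈ Metric.ball p r := h.source_eq ▸ hx'
    have himg := h.image_eq
    constructor
    · intro hxS
      have : φ x ∈ φ '' (S ∩ Metric.ball p r) := mem_image_of_mem φ ⟨hxS, hxb⟩
      rw [himg] at this
      exact this.1
    · intro hxf
      have : φ x ∈ φ '' (S ∩ Metric.ball p r) := by
        rw [himg]
        exact ⟨hxf, φ.map_source hx'⟩
      obtain ⟨y, ⟨hyS, hyb⟩, hy⟩ := this
      rw [← h.source_eq] at hyb
      rwa [← φ.injOn hyb hx' hy]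

theorem negClosed_iff_of_equiv {K K' : Set E3} (A : E3 ≃L[ℝ] E3) (h : ∀ v, v ∈ K ↔ A v ∈ K') :
    NegClosed K ↔ NegClosed K' := by
  constructor
  · intro hK v hv
    have := hK (A.symm v) (by rw [h]; simpa using hv)
    rw [h] at this
    simpa using this
  · intro hK v hv
    rw [h] at hv ⊢
    simpa using hK _ hv

theorem translationInvariant_iff_of_equiv {K K' : Set E3} (A : E3 ≃L[ℝ] E3)
    (h : ∀ v, v ∈ K ↔ A v ∈ K') : TranslationInvariant K ↔ TranslationInvariant K' := by
  constructor
  · rintro ⟨v, hv0, hv⟩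
    refine ⟨A v, by simpa using hv0, fun x hx => ?_⟩
    have := hv (A.symm x) (by rw [h]; simpa using hx)
    rw [h] at this
    simpa using this
  · rintro ⟨v, hv0, hv⟩
    refine ⟨A.symm v, by simpa using hv0, fun x hx => ?_⟩
    rw [h] at hx ⊢
    simpa using hv _ hx

namespace FanChart

variable {ι : Type*} [Finite ι] {ℓ : ι → E3} {p : E3} {φ : OpenPartialHomeomorph E3 E3}

theorem exists_equiv (h : FanChart α U S ℓ p φ) {q : E3} (hq : q ∈ φ.source) :
    ∃ A : E3 ≃L[ℝ] E3, HasFDerivAt φ (A : E3 →L[ℝ] E3) q ∧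
      HasFDerivAt φ.symm (A.symm : E3 →L[ℝ] E3) (φ q) :=
  exists_hasFDerivAt_equiv hq (h.regular q hq).differentiableAt
    (h.regular_symm _ (φ.map_source hq)).differentiableAt

theorem exists_mem_tangentCone_iff (h : FanChart α U S ℓ p φ) {q : E3} (hq : q ∈ φ.source) :
    ∃ A : E3 ≃L[ℝ] E3, HasFDerivAt φ (A : E3 →L[ℝ] E3) q ∧
      ∀ v, v ∈ tangentCone S q ↔ A v ∈ fanOn ℓ (active ℓ (φ q)) := by
  obtain ⟨A, hA, hA'⟩ := h.exists_equiv hq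
  refine ⟨A, hA, fun v => ?_⟩
  rw [mem_tangentCone_iff_of_chart hq hA hA' h.mem_iff, tangentCone_fan]

theorem negClosed_iff (h : FanChart α U S ℓ p φ) {q : E3} (hq : q ∈ φ.source) :
    NegClosed (tangentCone S q) ↔ NegClosed (fanOn ℓ (active ℓ (φ q))) := by
  obtain ⟨A, -, hA⟩ := h.exists_mem_tangentCone_iff hq
  exact negClosed_iff_of_equiv A hA

theorem translationInvariant_iff (h : FanChart α U S ℓ p φ) {q : E3} (hq : q ∈ φ.source) :
    TranslationInvariant (tangentCone S q) ↔
      TranslationInvariant (fanOn ℓ (active ℓ (φ q))) := by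
  obtain ⟨A, -, hA⟩ := h.exists_mem_tangentCone_iff hq
  exact translationInvariant_iff_of_equiv A hA

theorem mem_target_center (h : FanChart α U S ℓ p φ) : (0 : E3) ∈ φ.target := by
  rw [← h.map_center]
  exact φ.map_source h.mem_source

theorem active_center (h : FanChart α U S ℓ p φ) : active ℓ (φ p) = univ := by
  rw [h.map_center, active_zero]

end FanChart

theorem IsGeneralizedSurface.exists_fanChart (hS : IsGeneralizedSurface α U S) {p : E3}
    (hp : p ∈ S) : ∃ φ : OpenPartialHomeomorph E3 E3, (∀ v, ‖fderiv ℝ φ p v‖ = ‖v‖) ∧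
      ((FanChart α U S formsP p φ ∧ p ∈ reg α S) ∨ FanChart α U S formsY p φ ∨
        FanChart α U S tetraVertex p φ) := by
  obtain ⟨C, hC, r, hr, hball, φ, hφ, hiso⟩ := hS.chart p hp
  rcases hC with rfl | rfl | rfl
  · have hreg : p ∈ reg α S := ⟨hp, r, hr, φ, hφ⟩
    rw [coneP_eq_fan] at hφ
    obtain ⟨ψ, hψ, e⟩ := hφ.exists_fanChart fanIndep_formsP hr hball
    exact ⟨ψ, fun v => by rw [e, hiso], Or.inl ⟨hψ, hreg⟩⟩
  · rw [coneY_eq_fan] at hφ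
    obtain ⟨ψ, hψ, e⟩ := hφ.exists_fanChart fanIndep_formsY hr hball
    exact ⟨ψ, fun v => by rw [e, hiso], Or.inr (Or.inl hψ)⟩
  · rw [coneT_eq_fan] at hφ
    obtain ⟨ψ, hψ, e⟩ := hφ.exists_fanChart fanIndep_tetraVertex hr hball
    exact ⟨ψ, fun v => by rw [e, hiso], Or.inr (Or.inr hψ)⟩

theorem FanChart.not_negClosed_of_formsY {p : E3} {φ : OpenPartialHomeomorph E3 E3}
    (h : FanChart α U S formsY p φ) : ¬ NegClosed (tangentCone S p) := by
  rw [h.negClosed_iff h.mem_source, h.active_center]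
  exact not_negClosed_fanOn h.indep (mem_univ 0) (mem_univ 1) (mem_univ 2) (by decide)
    (by decide) (by decide)

theorem FanChart.not_negClosed_of_tetraVertex {p : E3} {φ : OpenPartialHomeomorph E3 E3}
    (h : FanChart α U S tetraVertex p φ) : ¬ NegClosed (tangentCone S p) := by
  rw [h.negClosed_iff h.mem_source, h.active_center]
  exact not_negClosed_fanOn h.indep (mem_univ 0) (mem_univ 1) (mem_univ 2) (by decide)
    (by decide) (by decide)

theorem FanChart.negClosed_of_formsP {p : E3} {φ : OpenPartialHomeomorph E3 E3}
    (h : FanChart α U S formsP p φ) : NegClosed (tangentCone S p) := by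
  rw [h.negClosed_iff h.mem_source, h.active_center]
  refine negClosed_fanOn (k := 0) (l := 1) fun m _ => ?_
  fin_cases m <;> simp

/-- This replaces the existence of a flat chart by a property of the tangent cone, which can be
tested in any chart around the point. -/
theorem IsGeneralizedSurface.mem_reg_iff (hS : IsGeneralizedSurface α U S) {q : E3} (hq : q ∈ S) :
    q ∈ reg α S ↔ NegClosed (tangentCone S q) := by
  constructor
  · rintro ⟨-, r, hr, φ, hφ⟩
    rw [coneP_eq_fan] at hφ
    -- The ball in the definition of `reg` need not lie in `U`, so the ambient set of this chart is
    -- `univ`.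
    obtain ⟨ψ, hψ, -⟩ := hφ.exists_fanChart fanIndep_formsP hr (subset_univ _)
    exact hψ.negClosed_of_formsP
  · intro h
    obtain ⟨φ, -, ⟨-, hr⟩ | hφ | hφ⟩ := hS.exists_fanChart hq
    · exact hr
    · exact absurd h hφ.not_negClosed_of_formsY
    · exact absurd h hφ.not_negClosed_of_tetraVertex

theorem not_negClosed_of_mem_yPoints {q : E3} (hq : q ∈ yPoints S) :
    ¬ NegClosed (tangentCone S q) ∧ TranslationInvariant (tangentCone S q) := by
  obtain ⟨-, O, hO⟩ := hq
  have hO' : ∀ v, v ∈ tangentCone S q ↔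
      (O.symm.toContinuousLinearEquiv : E3 ≃L[ℝ] E3) v ∈ fanOn formsY univ := by
    intro v
    rw [hO, fanOn_univ, ← coneY_eq_fan]
    constructor
    · rintro ⟨w, hw, rfl⟩
      simpa using hw
    · intro hv
      exact ⟨_, hv, by simp⟩
  rw [negClosed_iff_of_equiv _ hO', translationInvariant_iff_of_equiv _ hO']
  refine ⟨not_negClosed_fanOn fanIndep_formsY (mem_univ 0) (mem_univ 1) (mem_univ 2) (by decide)
    (by decide) (by decide), translationInvariant_fanOn (k := 0) (l := 1) (j := 2) fun m _ => ?_⟩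
  fin_cases m <;> simp

/-- A `Y`-point has a chart onto the cone `Y` whose derivative is orthogonal. -/
theorem IsGeneralizedSurface.exists_fanChart_formsY (hS : IsGeneralizedSurface α U S) {q : E3}
    (hq : q ∈ S) (h : ¬ NegClosed (tangentCone S q)) (h' : TranslationInvariant (tangentCone S q)) :
    ∃ φ : OpenPartialHomeomorph E3 E3, (∀ v, ‖fderiv ℝ φ q v‖ = ‖v‖) ∧
      FanChart α U S formsY q φ := by
  obtain ⟨φ, hiso, ⟨hφ, -⟩ | hφ | hφ⟩ := hS.exists_fanChart hq
  · exact absurd hφ.negClosed_of_formsP h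
  · exact ⟨φ, hiso, hφ⟩
  · rw [hφ.translationInvariant_iff hφ.mem_source, hφ.active_center, fanOn_univ] at h'
    exact absurd h' (not_translationInvariant_fan hφ.indep eq_zero_of_inner_tetraVertex_eq)

/-- The invariants only determine the cone up to a linear map. The isometry comes from the chart
centred at `q` itself, whose derivative there preserves norms. -/
theorem IsGeneralizedSurface.mem_yPoints_iff (hS : IsGeneralizedSurface α U S) {q : E3}
    (hq : q ∈ S) : q ∈ yPoints S ↔
      ¬ NegClosed (tangentCone S q) ∧ TranslationInvariant (tangentCone S q) := by
  refine ⟨not_negClosed_of_mem_yPoints, fun ⟨h, h'⟩ => ⟨hq, ?_⟩⟩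
  obtain ⟨φ, hiso, hφ⟩ := hS.exists_fanChart_formsY hq h h'
  obtain ⟨A, hA, hAm⟩ := hφ.exists_mem_tangentCone_iff hφ.mem_source
  rw [hφ.active_center, fanOn_univ, ← coneY_eq_fan] at hAm
  have hAi : ∀ v, ‖A v‖ = ‖v‖ := fun v => by
    rw [← hiso v, hA.fderiv]; rfl
  let B : E3 ≃ₗᵢ[ℝ] E3 := ⟨A.toLinearEquiv, hAi⟩
  refine ⟨B.symm, ?_⟩
  ext v
  rw [hAm]
  constructor
  · intro hv
    exact ⟨A v, hv, B.symm_apply_apply v⟩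
  · rintro ⟨w, hw, rfl⟩
    have : A (B.symm w) = w := B.apply_symm_apply w
    rwa [this]

namespace FanChart

variable {ι : Type*} [Finite ι] {ℓ : ι → E3} {p : E3} {φ : OpenPartialHomeomorph E3 E3}

theorem mem_reg_iff (hS : IsGeneralizedSurface α U S) (h : FanChart α U S ℓ p φ) {q : E3}
    (hq : q ∈ φ.source) : q ∈ reg α S ↔ ∃ k l, k ≠ l ∧ φ q ∈ openFace ℓ k l := by
  constructor
  · intro hr
    have hqS : q ∈ S := hr.1
    rw [hS.mem_reg_iff hqS, h.negClosed_iff hq] at hr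
    obtain ⟨k, hk, l, hl, hkl⟩ := (h.mem_iff q hq).1 hqS
    refine ⟨k, l, hkl, mem_openFace_iff.2 (Subset.antisymm (fun j hj => ?_) ?_)⟩
    · by_contra hne
      simp only [mem_insert_iff, mem_singleton_iff, not_or] at hne
      exact not_negClosed_fanOn h.indep hk hl hj hkl (Ne.symm hne.1) (Ne.symm hne.2) hr
    · rintro j (rfl | rfl)
      · exact hk
      · exact hl
  · rintro ⟨k, l, hkl, hq'⟩
    have hqS : q ∈ S := (h.mem_iff q hq).2 (openFace_subset_fan hkl hq')
    rw [hS.mem_reg_iff hqS, h.negClosed_iff hq, mem_openFace_iff.1 hq']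
    exact negClosed_fanOn Subset.rfl

theorem mem_yPoints_of_active (hS : IsGeneralizedSurface α U S) (h : FanChart α U S ℓ p φ) {q : E3}
    (hq : q ∈ φ.source) {k l j : ι} (hkl : k ≠ l) (hkj : k ≠ j) (hlj : l ≠ j)
    (ha : active ℓ (φ q) = {k, l, j}) : q ∈ yPoints S := by
  have hk : k ∈ active ℓ (φ q) := by simp [ha]
  have hl : l ∈ active ℓ (φ q) := by simp [ha]
  have hj : j ∈ active ℓ (φ q) := by simp [ha]
  have hqS : q ∈ S := (h.mem_iff q hq).2 ⟨k, hk, l, hl, hkl⟩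
  rw [hS.mem_yPoints_iff hqS, h.negClosed_iff hq, h.translationInvariant_iff hq]
  exact ⟨not_negClosed_fanOn h.indep hk hl hj hkl hkj hlj, translationInvariant_fanOn ha.subset⟩

theorem exists_three_active (h : FanChart α U S ℓ p φ) {q : E3}
    (hq : q ∈ φ.source) (hy : q ∈ yPoints S) : ∃ k ∈ active ℓ (φ q), ∃ l ∈ active ℓ (φ q),
      ∃ j ∈ active ℓ (φ q), k ≠ l ∧ k ≠ j ∧ l ≠ j := by
  have hqS : q ∈ S := hy.1
  obtain ⟨k, hk, l, hl, hkl⟩ := (h.mem_iff q hq).1 hqS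
  have := (not_negClosed_of_mem_yPoints hy).1
  rw [h.negClosed_iff hq] at this
  by_contra hcon
  refine this (negClosed_fanOn (k := k) (l := l) fun j hj => ?_)
  by_contra hne
  simp only [mem_insert_iff, mem_singleton_iff, not_or] at hne
  exact hcon ⟨k, hk, l, hl, j, hj, hkl, Ne.symm hne.1, Ne.symm hne.2⟩

end FanChart

end Charts

/-! ### Sheets and complementary components near a point -/

section Components

variable {A : Set E3}

theorem subset_of_mem_components {K : Set E3} (hK : K ∈ components A) : K ⊆ A := by
  obtain ⟨x, -, rfl⟩ := hK
  exact connectedComponentIn_subset A x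

theorem isPreconnected_of_mem_components {K : Set E3} (hK : K ∈ components A) :
    IsPreconnected K := by
  obtain ⟨x, -, rfl⟩ := hK
  exact isPreconnected_connectedComponentIn

theorem eq_connectedComponentIn_of_mem {K : Set E3} (hK : K ∈ components A) {y : E3}
    (hy : y ∈ K) : K = connectedComponentIn A y := by
  obtain ⟨x, -, rfl⟩ := hK
  exact connectedComponentIn_eq hy

theorem components_eq_of_mem {K K' : Set E3} (hK : K ∈ components A) (hK' : K' ∈ components A)
    {y : E3} (hy : y ∈ K) (hy' : y ∈ K') : K = K' :=
  (eq_connectedComponentIn_of_mem hK hy).trans (eq_connectedComponentIn_of_mem hK' hy').symm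

theorem exists_component_of_isPreconnected {G : Set E3} (hG : IsPreconnected G) (hGA : G ⊆ A)
    (hne : G.Nonempty) : ∃ K ∈ components A, G ⊆ K := by
  obtain ⟨x, hx⟩ := hne
  exact ⟨_, ⟨x, hGA hx, rfl⟩, hG.subset_connectedComponentIn hx hGA⟩

theorem apply_eq_of_isPreconnected {β : Type*} (hA : IsPreconnected A) {g : E3 → β}
    (hg : ∀ x ∈ A, ∀ᶠ y in 𝓝 x, y ∈ A → g y = g x) {x y : E3} (hx : x ∈ A) (hy : y ∈ A) :
    g x = g y := by
  have := isPreconnected_iff_preconnectedSpace.1 hA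
  have hloc : IsLocallyConstant fun z : A => g z := by
    rw [IsLocallyConstant.iff_eventually_eq]
    intro z
    filter_upwards [continuous_subtype_val.continuousAt.eventually (hg z z.2)] with w hw
    exact hw w.2
  exact hloc.apply_eq_of_preconnectedSpace ⟨x, hx⟩ ⟨y, hy⟩

end Components

section Sheets

variable {α : ℝ≥0} {U S : Set E3}

namespace FanChart

variable {ι : Type*} [Finite ι] {ℓ : ι → E3} {p : E3} {φ : OpenPartialHomeomorph E3 E3}

/-- The target of the chart is a ball, so this set is the image of a convex set under the inverse
chart. -/
theorem isPreconnected_preimage (h : FanChart α U S ℓ p φ) {F : Set E3} (hF : Convex ℝ F) :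
    IsPreconnected (φ.source ∩ φ ⁻¹' F) := by
  obtain ⟨ε, -, hε⟩ := h.target_eq
  have : φ.source ∩ φ ⁻¹' F = φ.symm '' (φ.target ∩ F) := by
    rw [φ.symm_image_target_inter_eq F]
    ext x
    simp only [mem_inter_iff, mem_preimage]
    exact ⟨fun hx => ⟨hx.1, φ.map_source hx.1, hx.2⟩, fun hx => ⟨hx.1, hx.2.2⟩⟩
  rw [this, hε]
  refine ((convex_ball 0 ε).inter hF).isPreconnected.image _ (φ.continuousOn_symm.mono ?_)
  rw [hε]
  exact inter_subset_left

theorem _root_.OpenPartialHomeomorph.mem_closure_preimage_of_ray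
    (φ : OpenPartialHomeomorph E3 E3) {F : Set E3} {q v : E3}
    (hq : q ∈ φ.source) (hv : ∀ s : ℝ, 0 < s → φ q + s • v ∈ F) :
    q ∈ closure (φ.source ∩ φ ⁻¹' F) := by
  have hlim : Tendsto (fun s : ℝ => φ q + s • v) (𝓝[>] 0) (𝓝 (φ q)) := by
    have : Tendsto (fun s : ℝ => φ q + s • v) (𝓝 0) (𝓝 (φ q + (0 : ℝ) • v)) :=
      (continuous_const.add (continuous_id.smul continuous_const)).tendsto 0
    rw [zero_smul, add_zero] at this
    exact this.mono_left nhdsWithin_le_nhds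
  have hlim' : Tendsto (fun s : ℝ => φ.symm (φ q + s • v)) (𝓝[>] 0) (𝓝 q) := by
    have := (φ.continuousAt_symm (φ.map_source hq)).tendsto.comp hlim
    rwa [φ.left_inv hq] at this
  refine mem_closure_of_tendsto hlim' ?_
  filter_upwards [hlim.eventually (φ.open_target.mem_nhds (φ.map_source hq)),
    self_mem_nhdsWithin] with s hs hs0
  exact ⟨φ.map_target hs, by rw [mem_preimage, φ.right_inv hs]; exact hv s hs0⟩

theorem preimage_nonempty (h : FanChart α U S ℓ p φ) {F : Set E3} {v : E3}
    (hv : ∀ s : ℝ, 0 < s → φ p + s • v ∈ F) : (φ.source ∩ φ ⁻¹' F).Nonempty :=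
  closure_nonempty_iff.1 ⟨p, φ.mem_closure_preimage_of_ray h.mem_source hv⟩

theorem eventually_active_subset (_h : FanChart α U S ℓ p φ) {q : E3} (hq : q ∈ φ.source) :
    ∀ᶠ y in 𝓝 q, y ∈ φ.source ∧ active ℓ (φ y) ⊆ active ℓ (φ q) :=
  (φ.open_source.eventually_mem hq).and
    ((φ.continuousAt hq).eventually (PlateauSurface.eventually_active_subset (ℓ := ℓ) (φ q)))

/-- The components of the complement near a chart are indexed by the sectors. -/
theorem exists_complement_components [Nonempty ι] (hor : IsOrientableIn U S)
    (h : FanChart α U S ℓ p φ) : ∃ κ : ι → Set E3, Function.Injective κ ∧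
      (∀ k, κ k ∈ components (U \ S)) ∧ ∀ q ∈ φ.source, ∀ Ω ∈ components (U \ S),
        q ∈ closure Ω ↔ ∃ k ∈ active ℓ (φ q), Ω = κ k := by
  have hH : ∀ k, ∃ K ∈ components (U \ S), φ.source ∩ φ ⁻¹' sector ℓ k ⊆ K := by
    intro k
    obtain ⟨v, hv⟩ := exists_ray_sector h.indep (x := φ p) (k := k) (by simp [h.active_center])
    refine exists_component_of_isPreconnected (h.isPreconnected_preimage (convex_sector k)) ?_
      (h.preimage_nonempty hv)
    rintro x ⟨hx, hxk⟩
    refine ⟨h.source_subset hx, fun hxS => ?_⟩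
    exact (notMem_fan_iff (ℓ := ℓ)).2 ⟨k, hxk⟩ ((h.mem_iff x hx).1 hxS)
  choose κ hκ hHκ using hH
  have hmem : ∀ q ∈ φ.source, ∀ Ω ∈ components (U \ S), q ∈ Ω →
      ∃ k, φ q ∈ sector ℓ k ∧ Ω = κ k := by
    intro q hq Ω hΩ hqΩ
    have : φ q ∉ fan ℓ := fun hf =>
      (subset_of_mem_components hΩ hqΩ).2 ((h.mem_iff q hq).2 hf)
    obtain ⟨k, hk⟩ := notMem_fan_iff.1 this
    exact ⟨k, hk, components_eq_of_mem hΩ (hκ k) hqΩ (hHκ k ⟨hq, hk⟩)⟩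
  have hcl : ∀ q ∈ φ.source, ∀ k ∈ active ℓ (φ q),
      q ∈ closure (φ.source ∩ φ ⁻¹' sector ℓ k) := by
    intro q hq k hk
    obtain ⟨v, hv⟩ := exists_ray_sector h.indep hk
    exact φ.mem_closure_preimage_of_ray hq hv
  refine ⟨κ, fun k l hkl => ?_, hκ, fun q hq Ω hΩ => ⟨fun hqΩ => ?_, ?_⟩⟩
  -- If two sectors lay in one component, orientability would make a small ball around `p` meet it
  -- in a connected set; yet that set is covered by disjoint open sectors, at least two of which it
  -- meets.
  · by_contra hne
    have hpS : p ∈ S := (h.mem_iff p h.mem_source).2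
      ⟨k, by simp [h.active_center], l, by simp [h.active_center], hne⟩
    obtain ⟨ρ, hρ, -, hconn⟩ := hor (κ k) (hκ k) p hpS
    obtain ⟨ε, hε, hball⟩ := Metric.isOpen_iff.1 φ.open_source p h.mem_source
    have hr : 0 < min ε (ρ / 2) := lt_min hε (by linarith)
    have hpre := hconn _ hr ((min_le_right _ _).trans_lt (by linarith))
    have hsub : Metric.ball p (min ε (ρ / 2)) ⊆ φ.source :=
      (Metric.ball_subset_ball (min_le_left _ _)).trans hball
    have hopen : ∀ m, IsOpen (φ.source ∩ φ ⁻¹' sector ℓ m) := fun m =>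
      φ.isOpen_inter_preimage (isOpen_sector m)
    have hne' : ∀ m, κ k = κ m → ((Metric.ball p (min ε (ρ / 2)) ∩ κ k) ∩
        (φ.source ∩ φ ⁻¹' sector ℓ m)).Nonempty := by
      intro m hm
      obtain ⟨y, hy, hym⟩ := mem_closure_iff.1
        (hcl p h.mem_source m (by simp [h.active_center])) _ Metric.isOpen_ball
        (Metric.mem_ball_self hr)
      exact ⟨y, ⟨hy, hm ▸ hHκ m hym⟩, hym⟩
    have hcover : Metric.ball p (min ε (ρ / 2)) ∩ κ k ⊆ (φ.source ∩ φ ⁻¹' sector ℓ k) ∪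
        ⋃ m ∈ {m | m ≠ k}, φ.source ∩ φ ⁻¹' sector ℓ m := by
      rintro y ⟨hyb, hyκ⟩
      obtain ⟨m, hm, -⟩ := hmem y (hsub hyb) _ (hκ k) hyκ
      by_cases hmk : m = k
      · exact Or.inl ⟨hsub hyb, hmk ▸ hm⟩
      · exact Or.inr (mem_iUnion₂.2 ⟨m, hmk, hsub hyb, hm⟩)
    have hother : ((Metric.ball p (min ε (ρ / 2)) ∩ κ k) ∩
        ⋃ m ∈ {m | m ≠ k}, φ.source ∩ φ ⁻¹' sector ℓ m).Nonempty := by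
      obtain ⟨y, hy, hy'⟩ := hne' l hkl
      exact ⟨y, hy, mem_iUnion₂.2 ⟨l, fun e => hne e.symm, hy'⟩⟩
    obtain ⟨y, -, hy1, hy2⟩ := hpre _ _ (hopen k) (isOpen_biUnion fun m _ => hopen m) hcover
      (hne' k rfl) hother
    obtain ⟨m, hm, hym⟩ := mem_iUnion₂.1 hy2
    have e1 := mem_sector_iff.1 hy1.2
    rw [mem_sector_iff.1 hym.2, singleton_eq_singleton_iff] at e1
    exact hm e1
  · obtain ⟨y, hyΩ, hy, hya⟩ := (mem_closure_iff_frequently.1 hqΩ).and_eventually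
      (h.eventually_active_subset hq) |>.exists
    obtain ⟨k, hk, rfl⟩ := hmem y hy Ω hΩ hyΩ
    refine ⟨k, hya ?_, rfl⟩
    rw [mem_sector_iff.1 hk]
    rfl
  · rintro ⟨k, hk, rfl⟩
    exact closure_mono (hHκ k) (hcl q hq k hk)

end FanChart

/-- The components of the complement adjacent to a point are constant along each sheet. -/
theorem adjacent_components_eq (hS : IsGeneralizedSurface α U S) (hor : IsOrientableIn U S)
    {Λ : Set E3} (hΛ : Λ ∈ sheets α S) {x y : E3} (hx : x ∈ Λ) (hy : y ∈ Λ) :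
    {Ω ∈ components (U \ S) | x ∈ closure Ω} = {Ω ∈ components (U \ S) | y ∈ closure Ω} := by
  refine apply_eq_of_isPreconnected (isPreconnected_of_mem_components hΛ)
    (g := fun x => {Ω ∈ components (U \ S) | x ∈ closure Ω}) (fun q hq => ?_) hx hy
  have hqr : q ∈ reg α S := subset_of_mem_components hΛ hq
  obtain ⟨φ, -, ⟨hφ, -⟩ | hφ | hφ⟩ := hS.exists_fanChart hqr.1
  · obtain ⟨κ, -, -, hκ⟩ := hφ.exists_complement_components hor
    -- With only two forms, a point of the fan has both of them active.
    have huniv : ∀ z ∈ φ.source, z ∈ S → active formsP (φ z) = univ := by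
      intro z hz hzS
      obtain ⟨k, hk, l, hl, hkl⟩ := (hφ.mem_iff z hz).1 hzS
      ext m
      have : m = k ∨ m = l := by omega
      rcases this with rfl | rfl <;> simp [hk, hl]
    filter_upwards [φ.open_source.mem_nhds hφ.mem_source] with z hz hzΛ
    have hzS : z ∈ S := (subset_of_mem_components hΛ hzΛ).1
    ext Ω
    refine and_congr_right fun hΩ => ?_
    rw [hκ z hz Ω hΩ, hκ q hφ.mem_source Ω hΩ, huniv z hz hzS, huniv q hφ.mem_source hqr.1]
  · exact absurd ((hS.mem_reg_iff hqr.1).1 hqr) hφ.not_negClosed_of_formsY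
  · exact absurd ((hS.mem_reg_iff hqr.1).1 hqr) hφ.not_negClosed_of_tetraVertex

/-- `Λ k l` is the sheet containing the face of `k` and `l` of the chart `φ`. -/
structure FaceSheets {ι : Type*} (α : ℝ≥0) (S : Set E3) (ℓ : ι → E3)
    (φ : OpenPartialHomeomorph E3 E3) (Λ : ι → ι → Set E3) : Prop where
  mem_sheets : ∀ k l, k ≠ l → Λ k l ∈ sheets α S
  symm : ∀ k l, Λ k l = Λ l k
  mem_iff : ∀ k l, k ≠ l → ∀ q ∈ φ.source, q ∈ Λ k l ↔ φ q ∈ openFace ℓ k l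
  mem_closure_iff : ∀ k l, k ≠ l → ∀ q ∈ φ.source,
    q ∈ closure (Λ k l) ↔ k ∈ active ℓ (φ q) ∧ l ∈ active ℓ (φ q)
  exists_eq : ∀ K ∈ sheets α S, (closure K ∩ φ.source).Nonempty → ∃ k l, k ≠ l ∧ K = Λ k l
  pair_eq : ∀ k l k' l', k ≠ l → k' ≠ l' → Λ k l = Λ k' l' → ({k, l} : Set ι) = {k', l'}

theorem FanChart.exists_faceSheets {ι : Type*} [Finite ι] [Nonempty ι] {ℓ : ι → E3} {p : E3}
    {φ : OpenPartialHomeomorph E3 E3} (hS : IsGeneralizedSurface α U S)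
    (hor : IsOrientableIn U S) (h : FanChart α U S ℓ p φ) :
    ∃ Λ : ι → ι → Set E3, FaceSheets α S ℓ φ Λ := by
  obtain ⟨κ, hκi, hκ, hκc⟩ := h.exists_complement_components hor
  let G : ι → ι → Set E3 := fun k l => φ.source ∩ φ ⁻¹' openFace ℓ k l
  have hGne : ∀ k l, (G k l).Nonempty := by
    intro k l
    obtain ⟨v, hv⟩ := exists_ray_openFace h.indep (x := φ p) (k := k) (l := l)
      (by simp [h.active_center]) (by simp [h.active_center])
    exact h.preimage_nonempty hv
  have hGreg : ∀ k l, k ≠ l → G k l ⊆ reg α S := fun k l hkl q hq =>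
    (h.mem_reg_iff hS hq.1).2 ⟨k, l, hkl, hq.2⟩
  -- Taking all components through points of the face avoids choosing one of them, which makes the
  -- symmetry in `k`, `l` immediate.
  let Λ : ι → ι → Set E3 := fun k l => {x | ∃ y ∈ G k l, x ∈ connectedComponentIn (reg α S) y}
  have hΛ : ∀ k l, k ≠ l → Λ k l ∈ sheets α S ∧ G k l ⊆ Λ k l := by
    intro k l hkl
    obtain ⟨K, hK, hGK⟩ := exists_component_of_isPreconnected
      (h.isPreconnected_preimage (convex_openFace k l)) (hGreg k l hkl) (hGne k l)
    have : Λ k l = K := by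
      obtain ⟨z, hz⟩ := hGne k l
      ext x
      constructor
      · rintro ⟨y, hy, hx⟩
        rwa [eq_connectedComponentIn_of_mem hK (hGK hy)]
      · intro hx
        exact ⟨z, hz, by rwa [← eq_connectedComponentIn_of_mem hK (hGK hz)]⟩
    rw [this]
    exact ⟨hK, hGK⟩
  -- The sheet remembers the pair: the components κ k and κ l adjacent to a face are constant along
  -- the sheet, and κ is injective.
  have hpair : ∀ k l k' l', k ≠ l → ∀ q ∈ φ.source, q ∈ Λ k l → φ q ∈ openFace ℓ k' l' →
      ({k', l'} : Set ι) = {k, l} := by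
    intro k l k' l' hkl q hq hqΛ hq'
    obtain ⟨z, hz⟩ := hGne k l
    have hadj := adjacent_components_eq hS hor (hΛ k l hkl).1 hqΛ ((hΛ k l hkl).2 hz)
    have hmem : ∀ m, m ∈ ({k', l'} : Set ι) ↔ m ∈ ({k, l} : Set ι) := by
      intro m
      have h1 : κ m ∈ {Ω ∈ components (U \ S) | q ∈ closure Ω} ↔
          κ m ∈ {Ω ∈ components (U \ S) | z ∈ closure Ω} := by rw [hadj]
      have h2 : ∀ w ∈ φ.source, κ m ∈ {Ω ∈ components (U \ S) | w ∈ closure Ω} ↔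
          m ∈ active ℓ (φ w) := by
        intro w hw
        have := hκc w hw (κ m) (hκ m)
        constructor
        · intro hm
          obtain ⟨k, hk, e⟩ := this.1 hm.2
          rwa [hκi e]
        · exact fun hm => ⟨hκ m, this.2 ⟨m, hm, rfl⟩⟩
      rwa [h2 q hq, h2 z hz.1, mem_openFace_iff.1 hq', mem_openFace_iff.1 hz.2] at h1
    exact Set.ext hmem
  have hiff : ∀ k l, k ≠ l → ∀ q ∈ φ.source, q ∈ Λ k l ↔ φ q ∈ openFace ℓ k l := by
    intro k l hkl q hq
    refine ⟨fun hqΛ => ?_, fun hf => (hΛ k l hkl).2 ⟨hq, hf⟩⟩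
    obtain ⟨k', l', -, hq'⟩ :=
      (h.mem_reg_iff hS hq).1 (subset_of_mem_components (hΛ k l hkl).1 hqΛ)
    rw [mem_openFace_iff, ← hpair k l k' l' hkl q hq hqΛ hq']
    exact mem_openFace_iff.1 hq'
  refine ⟨Λ, fun k l hkl => (hΛ k l hkl).1, fun k l => ?_, hiff, fun k l hkl q hq => ?_,
    ?_, ?_⟩
  · have : G k l = G l k := by simp only [G, openFace_comm]
    simp only [Λ, this]
  · constructor
    · intro hqc
      obtain ⟨y, hyΛ, hy, hya⟩ := (mem_closure_iff_frequently.1 hqc).and_eventually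
        (h.eventually_active_subset hq) |>.exists
      rw [mem_openFace_iff.1 ((hiff k l hkl y hy).1 hyΛ)] at hya
      exact ⟨hya (by simp), hya (by simp)⟩
    · rintro ⟨hk, hl⟩
      obtain ⟨v, hv⟩ := exists_ray_openFace h.indep hk hl
      exact closure_mono (hΛ k l hkl).2 (φ.mem_closure_preimage_of_ray hq hv)
  · rintro K hK ⟨q, hqK, hq⟩
    obtain ⟨y, hyK, hy⟩ := (mem_closure_iff_frequently.1 hqK).and_eventually
        (φ.open_source.eventually_mem hq) |>.exists
    obtain ⟨k, l, hkl, hy'⟩ := (h.mem_reg_iff hS hy).1 (subset_of_mem_components hK hyK)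
    exact ⟨k, l, hkl, components_eq_of_mem hK (hΛ k l hkl).1 hyK ((hΛ k l hkl).2 ⟨hy, hy'⟩)⟩
  · intro k l k' l' hkl hkl' he
    obtain ⟨z, hz⟩ := hGne k' l'
    exact (hpair k l k' l' hkl z hz.1 (he ▸ (hΛ k' l' hkl').2 hz) hz.2).symm

end Sheets

/-! ### Normals along the faces of a chart, and signs along the `Y`-curves -/

/-- Used to carry identities known on an open sheet, or on an open edge, to its boundary points. -/
theorem eq_of_mem_closure {β : Type*} [TopologicalSpace β] [T2Space β] {g : E3 → β} {c : β}
    {Λ : Set E3} {x : E3} (hg : ContinuousAt g x) (hx : x ∈ closure Λ)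
    (h : ∀ᶠ z in 𝓝 x, z ∈ Λ → g z = c) : g x = c := by
  have := mem_closure_iff_nhdsWithin_neBot.1 hx
  refine tendsto_nhds_unique (hg.tendsto.mono_left nhdsWithin_le_nhds)
    ((tendsto_const_nhds (x := c) (f := 𝓝[Λ] x)).congr' ?_)
  filter_upwards [nhdsWithin_le_nhds h, self_mem_nhdsWithin] with z hz hz'
  exact (hz hz').symm

section Normals

variable {α : ℝ≥0} {U S : Set E3} {ι : Type*} [Finite ι] {ℓ : ι → E3} {p : E3}
  {φ : OpenPartialHomeomorph E3 E3} {Λ : ι → ι → Set E3} {ν : Set E3 → E3 → E3}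

theorem FaceSheets.mem_tangentCone_iff (h : FanChart α U S ℓ p φ) (hΛ : FaceSheets α S ℓ φ Λ)
    {k l : ι} (hkl : k ≠ l) {z : E3} (hz : z ∈ φ.source) {A : E3 ≃L[ℝ] E3}
    (hA : HasFDerivAt φ (A : E3 →L[ℝ] E3) z) (v : E3) :
    v ∈ tangentCone (Λ k l) z ↔ A v ∈ tangentCone (openFace ℓ k l) (φ z) := by
  obtain ⟨B, hB, hB'⟩ := h.exists_equiv hz
  have : A = B := ContinuousLinearEquiv.ext (congrArg (fun L : E3 →L[ℝ] E3 => (L : E3 → E3))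
    (hA.unique hB))
  subst this
  exact mem_tangentCone_iff_of_chart hz hB hB' (hΛ.mem_iff k l hkl) v

/-- The normals are unit vectors orthogonal to the faces, up to the boundary of the faces. -/
theorem FaceSheets.normal (h : FanChart α U S ℓ p φ) (hΛ : FaceSheets α S ℓ φ Λ)
    (hν : IsUnitNormal α S ν) (hνreg : C1AlphaFamily α U S ν) {k l : ι} (hkl : k ≠ l) {x : E3}
    (hx : x ∈ φ.source) (hk : k ∈ active ℓ (φ x)) (hl : l ∈ active ℓ (φ x)) :
    ‖ν (Λ k l) x‖ = 1 ∧ ∀ v, inner ℝ (ℓ k) v = inner ℝ (ℓ l) v →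
      inner ℝ (ν (Λ k l) x) (fderiv ℝ φ.symm (φ x) v) = 0 := by
  have hxc : x ∈ closure (Λ k l) := (hΛ.mem_closure_iff k l hkl x hx).2 ⟨hk, hl⟩
  have hxU : x ∈ closure (Λ k l) ∩ U := ⟨hxc, h.source_subset hx⟩
  -- Orthogonality is assumed on the open sheet only; the germ `N` extending the normal carries it
  -- to the boundary by continuity.
  obtain ⟨N, hN, hNν⟩ := c1AlphaOn_iff.1 (hνreg _ (hΛ.mem_sheets k l hkl)) x hxU
  have hNx : N x = ν (Λ k l) x := hNν.self_of_nhds hxU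
  have hev : ∀ᶠ z in 𝓝 x, z ∈ Λ k l → z ∈ φ.source ∧ N z = ν (Λ k l) z := by
    filter_upwards [φ.open_source.mem_nhds hx, hNν] with z hz hzN hzΛ
    exact ⟨hz, hzN ⟨subset_closure hzΛ, h.source_subset hz⟩⟩
  rw [← hNx]
  constructor
  · refine eq_of_mem_closure (g := fun z => ‖N z‖) hN.continuousAt.norm hxc (hev.mono fun z hz hzΛ => ?_)
    rw [(hz hzΛ).2]
    exact ((hν _ (hΛ.mem_sheets k l hkl)).2 z hzΛ).1
  · intro v hv
    have hc : ContinuousAt (fun z => inner ℝ (N z) (fderiv ℝ φ.symm (φ z) v)) x := by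
      refine hN.continuousAt.inner ?_
      have h1 : ContinuousAt (fun z => fderiv ℝ φ.symm (φ z)) x :=
        ContinuousAt.comp (f := φ) (g := fderiv ℝ φ.symm)
          (h.regular_symm _ (φ.map_source hx)).continuousAt_fderiv (φ.continuousAt hx)
      exact h1.clm_apply continuousAt_const
    refine eq_of_mem_closure (g := fun z => inner ℝ (N z) (fderiv ℝ φ.symm (φ z) v)) hc hxc (hev.mono fun z hz hzΛ => ?_)
    obtain ⟨hzs, hzN⟩ := hz hzΛ
    obtain ⟨A, hA, hA'⟩ := h.exists_equiv hzs
    rw [hzN, hA'.fderiv]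
    refine ((hν _ (hΛ.mem_sheets k l hkl)).2 z hzΛ).2 _ ?_
    rw [hΛ.mem_tangentCone_iff h hkl hzs hA]
    have : A ((A.symm : E3 →L[ℝ] E3) v) = v := A.apply_symm_apply v
    rw [this]
    exact mem_tangentCone_of_ray (eventually_mem_openFace ((hΛ.mem_iff k l hkl z hzs).1 hzΛ) hv)

/-- The normals to two adjacent faces are linearly independent. -/
theorem FaceSheets.gram_ne_zero (h : FanChart α U S ℓ p φ) (hΛ : FaceSheets α S ℓ φ Λ)
    (hν : IsUnitNormal α S ν) (hνreg : C1AlphaFamily α U S ν) {k l j : ι} (hkl : k ≠ l)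
    (hkj : k ≠ j) (hlj : l ≠ j) {x : E3} (hx : x ∈ φ.source) (hk : k ∈ active ℓ (φ x))
    (hl : l ∈ active ℓ (φ x)) (hj : j ∈ active ℓ (φ x)) :
    inner ℝ (ν (Λ k l) x) (ν (Λ k l) x) * inner ℝ (ν (Λ k j) x) (ν (Λ k j) x) -
      inner ℝ (ν (Λ k l) x) (ν (Λ k j) x) * inner ℝ (ν (Λ k l) x) (ν (Λ k j) x) ≠ 0 := by
  classical
  obtain ⟨u1, o1⟩ := hΛ.normal h hν hνreg hkl hx hk hl
  obtain ⟨u2, o2⟩ := hΛ.normal h hν hνreg hkj hx hk hj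
  set n₁ := ν (Λ k l) x
  set n₂ := ν (Λ k j) x
  have i1 : inner ℝ n₁ n₁ = 1 := by rw [real_inner_self_eq_norm_sq, u1, one_pow]
  have i2 : inner ℝ n₂ n₂ = 1 := by rw [real_inner_self_eq_norm_sq, u2, one_pow]
  rw [i1, i2]
  intro h0
  -- Equality in Cauchy–Schwarz makes the unit normals parallel. Then `n₁` is orthogonal to the
  -- images of two different planes, which together span the space, so it would vanish.
  have e : n₁ = inner ℝ n₁ n₂ • n₂ := by
    rw [← sub_eq_zero, ← inner_self_eq_zero (𝕜 := ℝ)]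
    simp only [inner_sub_left, inner_sub_right, real_inner_smul_left, real_inner_smul_right, i1, i2,
      real_inner_comm n₁ n₂]
    linarith
  obtain ⟨A, hA, hA'⟩ := h.exists_equiv hx
  rw [hA'.fderiv] at o1 o2
  have hn : ∀ u, inner ℝ n₁ ((A.symm : E3 →L[ℝ] E3) u) = 0 := by
    intro u
    -- This splits `u` as `w` in the plane where `k` and `j` agree, plus `u - w` in the plane where
    -- `k` and `l` agree.
    obtain ⟨w, c, hw⟩ := h.indep fun i => if i = l then inner ℝ (ℓ l) u - inner ℝ (ℓ k) u else 0
    have hw1 : inner ℝ n₂ ((A.symm : E3 →L[ℝ] E3) w) = 0 := o2 w (by simp [hw, hkl, hlj.symm])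
    have hw2 : inner ℝ n₁ ((A.symm : E3 →L[ℝ] E3) (u - w)) = 0 :=
      o1 (u - w) (by simp [inner_sub_right, hw, hkl]; ring)
    have hw3 : inner ℝ n₁ ((A.symm : E3 →L[ℝ] E3) w) = 0 := by
      have := congrArg (fun t => inner ℝ t ((A.symm : E3 →L[ℝ] E3) w)) e
      simpa only [real_inner_smul_left, hw1, mul_zero] using this
    rw [map_sub, inner_sub_right, hw3, sub_zero] at hw2
    exact hw2
  have := hn (A n₁)
  have hs : (A.symm : E3 →L[ℝ] E3) (A n₁) = n₁ := A.symm_apply_apply n₁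
  rw [hs, i1] at this
  exact one_ne_zero this

end Normals

/-! ### Cross products and orthonormal triples. -/

section Cross

theorem cross_apply (a b : E3) : cross a b =
    !₂[a 1 * b 2 - a 2 * b 1, a 2 * b 0 - a 0 * b 2, a 0 * b 1 - a 1 * b 0] := by
  simp [cross, _root_.cross_apply]

theorem cross_cross_eq (a b c : E3) :
    cross a (cross b c) = (inner ℝ a c : ℝ) • b - (inner ℝ a b : ℝ) • c := by
  ext i
  fin_cases i <;> simp [cross_apply, inner_eq_sum] <;> ring

theorem cross_swap (a b : E3) : cross a b = -cross b a := by
  ext i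
  fin_cases i <;> simp [cross_apply] <;> ring

theorem cross_add_left (a b c : E3) : cross (a + b) c = cross a c + cross b c := by
  ext i
  fin_cases i <;> simp [cross_apply] <;> ring

theorem cross_smul_left (r : ℝ) (a b : E3) : cross (r • a) b = r • cross a b := by
  ext i
  fin_cases i <;> simp [cross_apply] <;> ring

theorem cross_zero_left (a : E3) : cross 0 a = 0 := by
  ext i
  fin_cases i <;> simp [cross_apply]

theorem inner_cross_self (a b : E3) : inner ℝ (cross a b) (cross a b) =
    inner ℝ a a * inner ℝ b b - inner ℝ a b * (inner ℝ a b : ℝ) := by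
  simp only [cross_apply, inner_eq_sum]
  simp
  ring

/-- In an orthonormal triple `(n, η, t)`, either `n = η × t` and `n × η = t`, or
`n = -(η × t)` and `n × η = -t`. -/
theorem eq_cross_or_eq_neg_cross {n η t : E3} (hn : ‖n‖ = 1) (hη : ‖η‖ = 1) (ht : ‖t‖ = 1)
    (hnη : inner ℝ n η = 0) (hnt : inner ℝ n t = 0) (hηt : inner ℝ η t = 0) :
    (n = cross η t ∧ cross n η = t) ∨ (n = -cross η t ∧ cross n η = -t) := by
  have in1 : inner ℝ n n = 1 := by rw [real_inner_self_eq_norm_sq, hn, one_pow]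
  have iη : inner ℝ η η = 1 := by rw [real_inner_self_eq_norm_sq, hη, one_pow]
  have it : inner ℝ t t = 1 := by rw [real_inner_self_eq_norm_sq, ht, one_pow]
  have iw : inner ℝ (cross η t) (cross η t) = 1 := by rw [inner_cross_self, iη, it, hηt]; ring
  have h0 : cross n (cross η t) = 0 := by rw [cross_cross_eq, hnη, hnt, zero_smul, zero_smul, sub_zero]
  have h1 : n = inner ℝ (cross η t) n • cross η t := by
    have := cross_cross_eq (cross η t) n (cross η t)
    rw [h0, iw, one_smul, cross_swap, cross_zero_left, neg_zero] at this
    exact (sub_eq_zero.1 this.symm)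
  have h2 : cross (cross η t) η = t := by
    rw [cross_swap, cross_cross_eq, iη, hηt]
    simp
  set c : ℝ := inner ℝ (cross η t) n with hc
  have hc2 : c * c = 1 := by
    have := in1
    rw [h1, real_inner_smul_left, real_inner_smul_right, iw] at this
    linarith
  have h3 : cross n η = c • t := by rw [h1, cross_smul_left, h2]
  rcases mul_self_eq_one_iff.1 hc2 with e | e
  · left
    rw [e, one_smul] at h1 h3
    exact ⟨h1, h3⟩
  · right
    rw [e, neg_one_smul] at h1 h3
    exact ⟨h1, h3⟩

end Cross

/-! ### The sheets around a `Y`-curve. -/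

section YCurves

variable {α : ℝ≥0} {U S : Set E3} {ν : Set E3 → E3 → E3}

theorem FanChart.active_eq_univ_of_mem_yPoints {ℓ : Fin 3 → E3} {p : E3}
    {φ : OpenPartialHomeomorph E3 E3} (h : FanChart α U S ℓ p φ) {q : E3} (hq : q ∈ φ.source)
    (hy : q ∈ yPoints S) : active ℓ (φ q) = univ := by
  obtain ⟨k, hk, l, hl, j, hj, h1, h2, h3⟩ := h.exists_three_active hq hy
  refine eq_univ_of_forall fun m => ?_
  have : m = k ∨ m = l ∨ m = j := by omega
  rcases this with rfl | rfl | rfl <;> assumption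

theorem IsGeneralizedSurface.exists_fanChart_of_mem_yPoints (hS : IsGeneralizedSurface α U S)
    {q : E3} (hq : q ∈ yPoints S) : ∃ φ : OpenPartialHomeomorph E3 E3,
      (∀ v, ‖fderiv ℝ φ q v‖ = ‖v‖) ∧ FanChart α U S formsY q φ :=
  hS.exists_fanChart_formsY hq.1 (not_negClosed_of_mem_yPoints hq).1
    (not_negClosed_of_mem_yPoints hq).2

/-- The sheets along a `Y`-curve are the sheets adherent to any one of its points. -/
theorem sheetsAlong_eq (hS : IsGeneralizedSurface α U S) (hor : IsOrientableIn U S) {L : Set E3}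
    (hL : L ∈ yCurves S) {q : E3} (hq : q ∈ L) :
    sheetsAlong α S L = {Λ ∈ sheets α S | q ∈ closure Λ} := by
  have hconst : ∀ x ∈ L, {Λ ∈ sheets α S | x ∈ closure Λ} = {Λ ∈ sheets α S | q ∈ closure Λ} := by
    intro x hx
    refine apply_eq_of_isPreconnected (isPreconnected_of_mem_components hL)
      (g := fun x => {Λ ∈ sheets α S | x ∈ closure Λ}) (fun x hx => ?_) hx hq
    obtain ⟨φ, -, hφ⟩ := hS.exists_fanChart_of_mem_yPoints (subset_of_mem_components hL hx)
    obtain ⟨Λ, hΛ⟩ := hφ.exists_faceSheets hS hor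
    have key : ∀ y z, y ∈ φ.source → z ∈ φ.source → z ∈ L → ∀ K ∈ sheets α S,
        y ∈ closure K → z ∈ closure K := by
      intro y z hy hz hzL K hK hyK
      obtain ⟨k, l, hkl, rfl⟩ := hΛ.exists_eq K hK ⟨y, hyK, hy⟩
      rw [hΛ.mem_closure_iff k l hkl z hz,
        hφ.active_eq_univ_of_mem_yPoints hz (subset_of_mem_components hL hzL)]
      simp
    filter_upwards [φ.open_source.mem_nhds hφ.mem_source] with z hz hzL
    ext K
    exact and_congr_right fun hK =>
      ⟨key z x hz hφ.mem_source hx K hK, key x z hφ.mem_source hz hzL K hK⟩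
  ext K
  constructor
  · exact fun hK => ⟨hK.1, hK.2 hq⟩
  · refine fun hK => ⟨hK.1, fun x hx => ?_⟩
    have : K ∈ {Λ ∈ sheets α S | x ∈ closure Λ} := by rw [hconst x hx]; exact hK
    exact this.2

/-- Makes the signed sums independent of the numbering of the sheets, so that the numbering given by
a chart can be used. -/
theorem sum_eq_sum_of_range_eq {β M : Type*} [AddCommMonoid M] {n m : ℕ} {a : Fin n → β}
    {b : Fin m → β} (ha : Function.Injective a) (hb : Function.Injective b) (h : range a = range b)
    (F : β → M) : ∑ i, F (a i) = ∑ i, F (b i) := by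
  rw [← finsum_eq_sum_of_fintype, ← finsum_eq_sum_of_fintype, ← finsum_mem_range ha,
    ← finsum_mem_range hb, h]

/-- The sheets at a point with three active forms are numbered by the form that each omits, with
indices modulo 3. The enumeration `e` lets this apply to edges inside a chart with any number of
forms. -/
theorem range_oppositeSheet {ι : Type*} {ℓ : ι → E3} {φ : OpenPartialHomeomorph E3 E3}
    {Λ : ι → ι → Set E3} (hΛ : FaceSheets α S ℓ φ Λ) {e : Fin 3 → ι}
    (he : Function.Injective e) {q : E3} (hq : q ∈ φ.source) (ha : active ℓ (φ q) = range e) :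
    Function.Injective (fun m => Λ (e (m + 1)) (e (m + 2))) ∧
      range (fun m => Λ (e (m + 1)) (e (m + 2))) = {K ∈ sheets α S | q ∈ closure K} := by
  have hne : ∀ m : Fin 3, e (m + 1) ≠ e (m + 2) := fun m h => by
    have := he h
    omega
  constructor
  · intro m m' h
    have := hΛ.pair_eq _ _ _ _ (hne m) (hne m') h
    have h1 : e (m' + 1) ∈ ({e (m + 1), e (m + 2)} : Set ι) := by rw [this]; simp
    have h2 : e (m' + 2) ∈ ({e (m + 1), e (m + 2)} : Set ι) := by rw [this]; simp
    simp only [mem_insert_iff, mem_singleton_iff, he.eq_iff] at h1 h2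
    omega
  · ext K
    constructor
    · rintro ⟨m, rfl⟩
      refine ⟨hΛ.mem_sheets _ _ (hne m), ?_⟩
      rw [hΛ.mem_closure_iff _ _ (hne m) q hq, ha]
      simp
    · rintro ⟨hK, hqK⟩
      obtain ⟨k, l, hkl, rfl⟩ := hΛ.exists_eq K hK ⟨q, hqK, hq⟩
      rw [hΛ.mem_closure_iff k l hkl q hq, ha] at hqK
      obtain ⟨⟨a, rfl⟩, ⟨b, rfl⟩⟩ := hqK
      have hab : a ≠ b := fun h => hkl (by rw [h])
      have : (b = a + 1) ∨ (a = b + 1) := by omega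
      rcases this with rfl | rfl
      · refine ⟨a + 2, ?_⟩
        have e1 : a + 2 + 1 = a := by omega
        have e2 : a + 2 + 2 = a + 1 := by omega
        simp only [e1, e2]
      · refine ⟨b + 2, ?_⟩
        have e1 : b + 2 + 1 = b := by omega
        have e2 : b + 2 + 2 = b + 1 := by omega
        simp only [e1, e2]
        exact hΛ.symm _ _

end YCurves

/-! ### The sign relation at the `Y`-points -/

theorem inner_formsY_self (m : Fin 3) : inner ℝ (formsY m) (formsY m) = 1 := by
  have h3 : √3 * √3 = 3 := Real.mul_self_sqrt (by norm_num)
  fin_cases m <;> simp only [formsY, inner_eq_sum] <;> simp <;> linarith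

theorem norm_formsY (m : Fin 3) : ‖formsY m‖ = 1 := by
  rw [norm_eq_sqrt_real_inner, inner_formsY_self, Real.sqrt_one]

theorem inner_formsY_of_ne {k m : Fin 3} (h : k ≠ m) :
    inner ℝ (formsY k) (formsY m) = -(1 / 2) := by
  have h3 : √3 * √3 = 3 := Real.mul_self_sqrt (by norm_num)
  fin_cases k <;> fin_cases m <;> first | exact absurd rfl h | skip
  all_goals simp only [formsY, inner_eq_sum]; simp; try linarith

theorem sum_formsY : formsY 0 + formsY 1 + formsY 2 = 0 := by
  ext i
  fin_cases i <;> simp [formsY]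
  ring

theorem inner_formsY_eq_zero {v : E3} (h0 : v 0 = 0) (h1 : v 1 = 0) (m : Fin 3) :
    inner ℝ (formsY m) v = 0 := by
  fin_cases m <;> simp [formsY, inner_eq_sum, h0, h1]

theorem eq_zero_of_active_formsY {v : E3} (h : active formsY v = univ) : v 0 = 0 ∧ v 1 = 0 := by
  have h30 : √3 ≠ 0 := (Real.sqrt_pos.2 (by norm_num)).ne'
  have h1 := active_eq (ℓ := formsY) (x := v) (k := 0) (l := 1) (by simp [h]) (by simp [h])
  have h2 := active_eq (ℓ := formsY) (x := v) (k := 0) (l := 2) (by simp [h]) (by simp [h])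
  simp [formsY, inner_eq_sum] at h1 h2
  have h0 : v 0 = 0 := by linarith
  refine ⟨h0, ?_⟩
  have : √3 * v 1 = 0 := by linarith
  simpa [h30] using this

/-- For horizontal unit `u` the three forms sum to 0 and their squares to 3/2. If two of them agree,
the third is ±1, and the inequality selects 1. -/
theorem eq_formsY_of_mem {u : E3} {m : Fin 3} (hu : ‖u‖ = 1) (h2 : u 2 = 0)
    (h : inner ℝ (formsY (m + 1)) u = inner ℝ (formsY (m + 2)) u)
    (h' : inner ℝ (formsY (m + 1)) u ≤ inner ℝ (formsY m) u) : u = formsY m := by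
  have h3 : √3 * √3 = 3 := Real.mul_self_sqrt (by norm_num)
  have e0 : inner ℝ (formsY 0) u = u 0 := by simp [formsY, inner_eq_sum]
  have e1 : inner ℝ (formsY 1) u = -(1 / 2) * u 0 + √3 / 2 * u 1 := by
    simp [formsY, inner_eq_sum]
  have e2 : inner ℝ (formsY 2) u = -(1 / 2) * u 0 - √3 / 2 * u 1 := by
    simp [formsY, inner_eq_sum]; ring
  have hsum : inner ℝ (formsY 0) u + inner ℝ (formsY 1) u + inner ℝ (formsY 2) u = 0 := by
    rw [e0, e1, e2]; ring
  have hsq : inner ℝ (formsY 0) u * inner ℝ (formsY 0) u + inner ℝ (formsY 1) u *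
      inner ℝ (formsY 1) u + inner ℝ (formsY 2) u * (inner ℝ (formsY 2) u : ℝ) = 3 / 2 := by
    have : inner ℝ u u = 1 := by rw [real_inner_self_eq_norm_sq, hu, one_pow]
    rw [inner_eq_sum, h2] at this
    rw [e0, e1, e2]
    linear_combination (3 / 2) * this + (1 / 2) * u 1 * u 1 * h3
  have hsum' : inner ℝ (formsY m) u + inner ℝ (formsY (m + 1)) u +
      inner ℝ (formsY (m + 2)) u = 0 := by
    rw [← hsum]
    fin_cases m <;> simp <;> ring
  have hsq' : inner ℝ (formsY m) u * inner ℝ (formsY m) u + inner ℝ (formsY (m + 1)) u *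
      inner ℝ (formsY (m + 1)) u + inner ℝ (formsY (m + 2)) u *
        (inner ℝ (formsY (m + 2)) u : ℝ) = 3 / 2 := by
    rw [← hsq]
    fin_cases m <;> simp <;> ring
  have ht : inner ℝ (formsY m) u = 1 := by
    set t : ℝ := inner ℝ (formsY m) u
    set s : ℝ := inner ℝ (formsY (m + 1)) u
    rw [← h] at hsum' hsq'
    have hs : s = -t / 2 := by linarith
    rw [hs] at hsq' h'
    have : (t - 1) * (t + 1) = 0 := by linarith
    rcases mul_eq_zero.1 this with h | h <;> linarith
  exact ((inner_eq_one_iff_of_norm_eq_one (norm_formsY m) hu).1 ht).symm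

section Signs

variable {α : ℝ≥0} {U S : Set E3} {ν : Set E3 → E3 → E3} {τ : E3 → E3}

/-- At a `Y`-point, the signed normals of the three sheets add up to zero. -/
theorem sum_sheetSign_smul_normal (hS : IsGeneralizedSurface α U S) (hor : IsOrientableIn U S)
    (hν : IsUnitNormal α S ν) (hνreg : C1AlphaFamily α U S ν) (hτ : IsOrientation S τ)
    {L : Set E3} (hL : L ∈ yCurves S) {Λ' : Fin 3 → Set E3} (hinj : Function.Injective Λ')
    (hrange : range Λ' = sheetsAlong α S L) {q : E3} (hq : q ∈ L) :
    ∑ i, sheetSign (Λ' i) (ν (Λ' i) q) q (τ q) • ν (Λ' i) q = 0 := by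
  obtain ⟨φ, hiso, hφ⟩ := hS.exists_fanChart_of_mem_yPoints (subset_of_mem_components hL hq)
  obtain ⟨Λ, hΛ⟩ := hφ.exists_faceSheets hS hor
  have hqs := hφ.mem_source
  obtain ⟨hM, hMr⟩ := range_oppositeSheet hΛ Function.injective_id hqs
    (by rw [hφ.active_center, range_id])
  rw [sheetsAlong_eq hS hor hL hq, ← hMr] at hrange
  rw [sum_eq_sum_of_range_eq hinj hM hrange
    (fun K => sheetSign K (ν K q) q (τ q) • ν K q)]
  simp only [id]
  obtain ⟨A, hA, hA'⟩ := hφ.exists_equiv hqs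
  have hAi : ∀ v, ‖A v‖ = ‖v‖ := fun v => by
    rw [← hiso v, hA.fderiv]; rfl
  have hAin : ∀ v w, inner ℝ (A v) (A w) = inner ℝ v w :=
    fun v w => LinearIsometryEquiv.inner_map_map (⟨A.toLinearEquiv, hAi⟩ : E3 ≃ₗᵢ[ℝ] E3) v w
  have hAs : ∀ v, A (A.symm v) = v := A.apply_symm_apply
  have hcl0 : ∀ i : Fin 3, Continuous fun v : E3 => v i := fun i => by fun_prop
  obtain ⟨hτ1, hτt⟩ := (hτ L hL).2 q hq
  -- In the chart all `Y`-points lie on the third axis, hence so do the tangent vectors of `L`.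
  have hAτ : (A (τ q)) 0 = 0 ∧ (A (τ q)) 1 = 0 := by
    have h1 : A (τ q) ∈ tangentCone {v : E3 | v 0 = 0 ∧ v 1 = 0} (φ q) := by
      refine mem_tangentCone_of_map hA ?_ hτt
      filter_upwards [φ.open_source.mem_nhds hqs] with y hy hyL
      exact eq_zero_of_active_formsY
        (hφ.active_eq_univ_of_mem_yPoints hy (subset_of_mem_components hL hyL))
    refine tangentCone_subset_of_eventually (T := {v : E3 | v 0 = 0 ∧ v 1 = 0})
      (K := {v : E3 | v 0 = 0 ∧ v 1 = 0}) (IsClosed.inter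
      (isClosed_eq (hcl0 0) continuous_const) (isClosed_eq (hcl0 1) continuous_const)) ?_ ?_ h1
    · rintro c - v ⟨h, h'⟩
      exact ⟨by simp [h], by simp [h']⟩
    · refine Eventually.of_forall fun y hy => ?_
      rw [hφ.map_center, sub_zero]
      exact hy
  have hAτ2 : (A (τ q)) 2 ≠ 0 := by
    intro h
    have : A (τ q) = 0 := by ext i; fin_cases i <;> simp [hAτ.1, hAτ.2, h]
    have h1 := hAi (τ q)
    rw [this, hτ1, norm_zero] at h1
    exact zero_ne_one h1
  -- The outward conormal of the face omitting `m` is `-A.symm (formsY m)`. Reversing the normal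
  -- reverses the sign, so the product does not depend on the choice.
  have hterm : ∀ m : Fin 3, sheetSign (Λ (m + 1) (m + 2)) (ν (Λ (m + 1) (m + 2)) q) q (τ q) •
      ν (Λ (m + 1) (m + 2)) q = cross (-A.symm (formsY m)) (τ q) := by
    intro m
    have hm12 : m + 1 ≠ m + 2 := by omega
    have hm1 : m + 1 ≠ m := by omega
    have hm2 : m + 2 ≠ m := by omega
    obtain ⟨n1, no⟩ := hΛ.normal hφ hν hνreg hm12 hqs (by simp [hφ.active_center])
      (by simp [hφ.active_center])
    rw [hA'.fderiv] at no
    set n := ν (Λ (m + 1) (m + 2)) q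
    have hnη : inner ℝ n (-A.symm (formsY m)) = 0 := by
      rw [inner_neg_right, neg_eq_zero]
      exact no _ (by rw [inner_formsY_of_ne hm1, inner_formsY_of_ne hm2])
    have hnτ : inner ℝ n (τ q) = 0 := by
      have := no (A (τ q)) (by rw [inner_formsY_eq_zero hAτ.1 hAτ.2,
        inner_formsY_eq_zero hAτ.1 hAτ.2])
      have e : (A.symm : E3 →L[ℝ] E3) (A (τ q)) = τ q := A.symm_apply_apply _
      rwa [e] at this
    have hη1 : ‖-A.symm (formsY m)‖ = 1 := by
      rw [norm_neg, ← hAi, hAs, norm_formsY]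
    have hητ : inner ℝ (-A.symm (formsY m)) (τ q) = 0 := by
      rw [inner_neg_left, ← hAin, hAs, inner_formsY_eq_zero hAτ.1 hAτ.2, neg_zero]
    have hcon : IsOutwardConormal (Λ (m + 1) (m + 2)) q (τ q) (-A.symm (formsY m)) := by
      refine ⟨hη1, hητ, ?_⟩
      rw [hΛ.mem_tangentCone_iff hφ hm12 hqs hA, neg_neg, hAs, hφ.map_center]
      refine mem_tangentCone_of_ray ?_
      filter_upwards [self_mem_nhdsWithin] with s hs
      have hs : 0 < s := hs
      rw [zero_add]
      refine ⟨?_, fun j h1 h2 => ?_⟩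
      · simp only [real_inner_smul_right, inner_formsY_of_ne hm1, inner_formsY_of_ne hm2]
      · have : j = m := by omega
        subst this
        simp only [real_inner_smul_right, inner_formsY_of_ne hm1, inner_formsY_self]
        linarith
    -- The induced direction is defined by the existence of some conormal, so the sign -1 requires
    -- excluding every other candidate.
    have huniq : ∀ η, IsOutwardConormal (Λ (m + 1) (m + 2)) q (τ q) η →
        η = -A.symm (formsY m) := by
      rintro η ⟨h1, h2, h3⟩
      rw [hΛ.mem_tangentCone_iff hφ hm12 hqs hA] at h3
      have hsub := tangentCone_subset_of_eventually (T := openFace formsY (m + 1) (m + 2))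
        (K := {v : E3 | inner ℝ (formsY (m + 1)) v = inner ℝ (formsY (m + 2)) v ∧
          inner ℝ (formsY (m + 1)) v ≤ inner ℝ (formsY m) v}) (x := φ q)
        (IsClosed.inter
          (isClosed_eq (f := fun v : E3 => inner ℝ (formsY (m + 1)) v)
            (g := fun v : E3 => inner ℝ (formsY (m + 2)) v) (by fun_prop) (by fun_prop))
          (isClosed_le (f := fun v : E3 => inner ℝ (formsY (m + 1)) v)
            (g := fun v : E3 => inner ℝ (formsY m) v) (by fun_prop) (by fun_prop)))
        (by
          rintro c hc v ⟨hv, hv'⟩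
          simp only [mem_ofPred, real_inner_smul_right]
          exact ⟨by rw [hv], mul_le_mul_of_nonneg_left hv' hc⟩)
        (Eventually.of_forall fun y hy => by
          rw [hφ.map_center, sub_zero]
          exact ⟨hy.1, (hy.2 m hm1.symm hm2.symm).le⟩) h3
      have h4 : (A (-η)) 2 = 0 := by
        have : inner ℝ (A (-η)) (A (τ q)) = 0 := by
          rw [hAin, inner_neg_left, h2, neg_zero]
        rw [inner_eq_sum, hAτ.1, hAτ.2] at this
        simpa [hAτ2] using this
      have h5 := eq_formsY_of_mem (by rw [hAi, norm_neg, h1]) h4 hsub.1 hsub.2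
      rw [← h5, A.symm_apply_apply, neg_neg]
    rcases eq_cross_or_eq_neg_cross n1 hη1 hτ1 hnη hnτ hητ with ⟨e1, e2⟩ | ⟨e1, e2⟩
    · have : IsInducedDirection (Λ (m + 1) (m + 2)) n q (τ q) := ⟨_, hcon, e2.symm⟩
      rw [sheetSign, if_pos this, one_smul]
      exact e1
    · have : ¬ IsInducedDirection (Λ (m + 1) (m + 2)) n q (τ q) := by
        rintro ⟨η, hη, he⟩
        rw [huniq η hη, e2] at he
        have h0 : τ q = 0 := by
          have : (2 : ℝ) • τ q = 0 := by
            rw [two_smul]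
            nth_rewrite 1 [he]
            rw [neg_add_cancel]
          simpa using this
        rw [h0, norm_zero] at hτ1
        exact zero_ne_one hτ1
      rw [sheetSign, if_neg this, neg_one_smul, e1, neg_neg]
  rw [Fin.sum_univ_three, hterm, hterm, hterm, ← cross_add_left, ← cross_add_left, ← neg_add,
    ← neg_add, ← map_add, ← map_add, sum_formsY, map_zero, neg_zero, cross_zero_left]

/-- The compatibility condition along the `Y`-curves. -/
def SignCondition (α : ℝ≥0) (S : Set E3) (ν : Set E3 → E3 → E3) (τ : E3 → E3)
    (f : Set E3 → E3 → ℝ) : Prop :=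
  ∀ L ∈ yCurves S, ∀ Λ : Fin 3 → Set E3,
    Function.Injective Λ → range Λ = sheetsAlong α S L →
      ∀ p ∈ L, ∑ i, sheetSign (Λ i) (ν (Λ i) p) p (τ p) * f (Λ i) p = 0

theorem IsCompatible.signCondition (hS : IsGeneralizedSurface α U S) (hor : IsOrientableIn U S)
    (hν : IsUnitNormal α S ν) (hνreg : C1AlphaFamily α U S ν) (hτ : IsOrientation S τ)
    {f : Set E3 → E3 → ℝ} (hf : IsCompatible α U S ν f) : SignCondition α S ν τ f := by
  obtain ⟨V, -, hV⟩ := hf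
  intro L hL Λ hinj hrange p hp
  have hp' : p ∈ U := hS.subset (subset_of_mem_components hL hp).1
  have hmem : ∀ i, Λ i ∈ sheetsAlong α S L := fun i => hrange ▸ mem_range_self i
  have h0 := sum_sheetSign_smul_normal hS hor hν hνreg hτ hL hinj hrange hp
  have : ∀ i, sheetSign (Λ i) (ν (Λ i) p) p (τ p) * f (Λ i) p =
      inner ℝ (V p) (sheetSign (Λ i) (ν (Λ i) p) p (τ p) • ν (Λ i) p) := by
    intro i
    rw [real_inner_smul_right, hV _ (hmem i).1 p ⟨(hmem i).2 hp, hp'⟩]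
  simp only [this]
  rw [← inner_sum, h0, inner_zero_right]

theorem sheetSign_ne_zero (Λ : Set E3) (n p t : E3) : sheetSign Λ n p t ≠ 0 := by
  unfold sheetSign
  split_ifs <;> norm_num

/-- At a `Y`-point, two of the three equations `w · ν = f` imply the third. -/
theorem SignCondition.inner_eq_of_inner_eq {ι : Type*} [Finite ι] {ℓ : ι → E3} {p : E3}
    {φ : OpenPartialHomeomorph E3 E3} {Λ : ι → ι → Set E3} {f : Set E3 → E3 → ℝ}
    (hf : SignCondition α S ν τ f)
    (hS : IsGeneralizedSurface α U S) (hor : IsOrientableIn U S)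
    (hν : IsUnitNormal α S ν) (hνreg : C1AlphaFamily α U S ν) (hτ : IsOrientation S τ)
    (h : FanChart α U S ℓ p φ) (hΛ : FaceSheets α S ℓ φ Λ) {k l j : ι} (hkl : k ≠ l)
    (hkj : k ≠ j) (hlj : l ≠ j) {q : E3} (hq : q ∈ φ.source) (ha : active ℓ (φ q) = {k, l, j})
    {w : E3} (h1 : inner ℝ w (ν (Λ k l) q) = f (Λ k l) q)
    (h2 : inner ℝ w (ν (Λ k j) q) = f (Λ k j) q) :
    inner ℝ w (ν (Λ l j) q) = f (Λ l j) q := by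
  have hy : q ∈ yPoints S := h.mem_yPoints_of_active hS hq hkl hkj hlj ha
  let L := connectedComponentIn (yPoints S) q
  have hL : L ∈ yCurves S := ⟨q, hy, rfl⟩
  have hqL : q ∈ L := mem_connectedComponentIn hy
  let e : Fin 3 → ι := ![k, l, j]
  have he : Function.Injective e := by
    intro a b hab
    fin_cases a <;> fin_cases b <;> simp_all [e, Ne.symm hkl, Ne.symm hkj, Ne.symm hlj]
  have hr : range e = {k, l, j} := by
    ext x
    simp [e, eq_comm]
    tauto
  obtain ⟨hM, hMr⟩ := range_oppositeSheet hΛ he hq (ha.trans hr.symm)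
  rw [← sheetsAlong_eq hS hor hL hqL] at hMr
  have s1 := hf L hL _ hM hMr q hqL
  have s2 := sum_sheetSign_smul_normal hS hor hν hνreg hτ hL hM hMr hqL
  have s3 := congrArg (fun t => inner ℝ w t) s2
  simp only [inner_sum, real_inner_smul_right, inner_zero_right] at s3
  rw [Fin.sum_univ_three] at s1 s3
  have e0 : Λ (e (0 + 1)) (e (0 + 2)) = Λ l j := rfl
  have e1 : Λ (e (1 + 1)) (e (1 + 2)) = Λ k j := hΛ.symm _ _
  have e2 : Λ (e (2 + 1)) (e (2 + 2)) = Λ k l := rfl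
  rw [e0, e1, e2] at s1 s3
  rw [h1, h2] at s3
  -- Subtracting the two signed relations leaves only a nonzero multiple of the third defect.
  exact mul_left_cancel₀ (sheetSign_ne_zero (Λ l j) (ν (Λ l j) q) q (τ q)) (by linarith)

end Signs

/-! ### Local construction of the vector field -/

section Local

variable {α : ℝ≥0} {U S : Set E3} {ν : Set E3 → E3 → E3} {τ : E3 → E3} {f : Set E3 → E3 → ℝ}

/-- Near `p`, some `C^{1,α}` vector field has normal component `f` on all the sheets. -/
def HasLocalField (α : ℝ≥0) (S : Set E3) (ν : Set E3 → E3 → E3) (f : Set E3 → E3 → ℝ)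
    (p : E3) : Prop :=
  ∃ N : Set E3, IsOpen N ∧ p ∈ N ∧ ∃ V : E3 → E3, ∀ K ∈ sheets α S, ∀ x ∈ closure K ∩ N,
    C1AlphaWithinAt α V (closure K) x ∧ f K x = inner ℝ (V x) (ν K x)

/-- `N` and `F` are `C^{1,α}` germs at `p` extending `ν` and `f` from the sheets. -/
structure ExtendsAt (α : ℝ≥0) (S : Set E3) (ν : Set E3 → E3 → E3) (f : Set E3 → E3 → ℝ) (p : E3)
    (N : Set E3 → E3 → E3) (F : Set E3 → E3 → ℝ) : Prop where
  normal : ∀ K ∈ sheets α S, p ∈ closure K → C1AlphaAt α (N K) p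
  func : ∀ K ∈ sheets α S, p ∈ closure K → C1AlphaAt α (F K) p
  eventually_eq : ∀ K ∈ sheets α S, p ∈ closure K → ∀ᶠ q in 𝓝 p, q ∈ closure K →
    N K q = ν K q ∧ F K q = f K q

theorem exists_extendsAt (hU : IsOpen U) (hνreg : C1AlphaFamily α U S ν)
    (hf : C1AlphaFamily α U S f) {p : E3} (hp : p ∈ U) :
    ∃ N F, ExtendsAt α S ν f p N F := by
  have h1 : ∀ K, ∃ N : E3 → E3, K ∈ sheets α S → p ∈ closure K →
      C1AlphaAt α N p ∧ ∀ᶠ q in 𝓝 p, q ∈ closure K ∩ U → N q = ν K q := by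
    intro K
    by_cases hK : K ∈ sheets α S ∧ p ∈ closure K
    · obtain ⟨N, hN, hN'⟩ := c1AlphaOn_iff.1 (hνreg K hK.1) p ⟨hK.2, hp⟩
      exact ⟨N, fun _ _ => ⟨hN, hN'⟩⟩
    · exact ⟨0, fun a b => absurd ⟨a, b⟩ hK⟩
  have h2 : ∀ K, ∃ F : E3 → ℝ, K ∈ sheets α S → p ∈ closure K →
      C1AlphaAt α F p ∧ ∀ᶠ q in 𝓝 p, q ∈ closure K ∩ U → F q = f K q := by
    intro K
    by_cases hK : K ∈ sheets α S ∧ p ∈ closure K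
    · obtain ⟨N, hN, hN'⟩ := c1AlphaOn_iff.1 (hf K hK.1) p ⟨hK.2, hp⟩
      exact ⟨N, fun _ _ => ⟨hN, hN'⟩⟩
    · exact ⟨0, fun a b => absurd ⟨a, b⟩ hK⟩
  choose N hN using h1
  choose F hF using h2
  refine ⟨N, F, fun K a b => (hN K a b).1, fun K a b => (hF K a b).1, fun K a b => ?_⟩
  filter_upwards [(hN K a b).2, (hF K a b).2, hU.mem_nhds hp] with q h1 h2 hqU hqK
  exact ⟨h1 ⟨hqK, hqU⟩, h2 ⟨hqK, hqU⟩⟩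

/-- Fields `X k l` given on the faces and coinciding on common edges glue together. -/
theorem FaceSheets.hasLocalField_of_faces {ι : Type*} [Finite ι] {ℓ : ι → E3} {p : E3}
    {φ : OpenPartialHomeomorph E3 E3} {Λ : ι → ι → Set E3} (h : FanChart α U S ℓ p φ)
    (hΛ : FaceSheets α S ℓ φ Λ) {X : ι → ι → E3 → E3}
    (hX : ∀ k l, k ≠ l → C1AlphaAt α (X k l) p)
    (hXf : ∀ᶠ q in 𝓝 p, ∀ k l, k ≠ l → k ∈ active ℓ (φ q) → l ∈ active ℓ (φ q) →
      f (Λ k l) q = inner ℝ (X k l q) (ν (Λ k l) q))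
    (hXX : ∀ᶠ q in 𝓝 p, ∀ k l k' l', k ≠ l → k' ≠ l' → k ∈ active ℓ (φ q) →
      l ∈ active ℓ (φ q) → k' ∈ active ℓ (φ q) → l' ∈ active ℓ (φ q) → X k l q = X k' l' q) :
    HasLocalField α S ν f p := by
  classical
  have hXe : ∀ᶠ q in 𝓝 p, ∀ k l, k ≠ l → C1AlphaAt α (X k l) q := by
    refine eventually_all.2 fun k => eventually_all.2 fun l => ?_
    by_cases hkl : k = l
    · exact Eventually.of_forall fun q h => absurd hkl h
    · exact (hX k l hkl).eventually.mono fun q h _ => h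
  obtain ⟨N, hN, hNo, hpN⟩ := mem_nhds_iff.1
    (hXe.and (hXf.and (hXX.and (φ.open_source.eventually_mem h.mem_source))))
  -- Any pair of active forms may be chosen, since the fields of two such pairs agree; where fewer
  -- than two forms are active the value 0 is irrelevant.
  let V : E3 → E3 := fun q =>
    if hq : ∃ e : ι × ι, e.1 ≠ e.2 ∧ e.1 ∈ active ℓ (φ q) ∧ e.2 ∈ active ℓ (φ q) then
      X hq.choose.1 hq.choose.2 q else 0
  have hV : ∀ q ∈ N, ∀ k l, k ≠ l → k ∈ active ℓ (φ q) → l ∈ active ℓ (φ q) →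
      V q = X k l q := by
    intro q hq k l hkl hk hl
    have hex : ∃ e : ι × ι, e.1 ≠ e.2 ∧ e.1 ∈ active ℓ (φ q) ∧ e.2 ∈ active ℓ (φ q) :=
      ⟨(k, l), hkl, hk, hl⟩
    have hc := hex.choose_spec
    simp only [V, dif_pos hex]
    exact (hN hq).2.2.1 _ _ _ _ hc.1 hkl hc.2.1 hc.2.2 hk hl
  refine ⟨N, hNo, hpN, V, ?_⟩
  rintro K hK x ⟨hxK, hxN⟩
  obtain ⟨k, l, hkl, rfl⟩ := hΛ.exists_eq K hK ⟨x, hxK, (hN hxN).2.2.2⟩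
  obtain ⟨hk, hl⟩ := (hΛ.mem_closure_iff k l hkl x (hN hxN).2.2.2).1 hxK
  refine ⟨⟨X k l, (hN hxN).1 k l hkl, ?_⟩, ?_⟩
  · filter_upwards [hNo.mem_nhds hxN] with y hy hyK
    obtain ⟨hk', hl'⟩ := (hΛ.mem_closure_iff k l hkl y (hN hy).2.2.2).1 hyK
    exact (hV y hy k l hkl hk' hl').symm
  · rw [hV x hxN k l hkl hk hl]
    exact (hN hxN).2.1 k l hkl hk hl

/-- It is enough to have the right fields along the edges: on each face the normal component can
then be corrected. -/
theorem FaceSheets.hasLocalField_of_edges (hα1 : α ≤ 1) {ι : Type*} [Finite ι] {ℓ : ι → E3}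
    {p : E3} {φ : OpenPartialHomeomorph E3 E3} {Λ : ι → ι → Set E3}
    (hν : IsUnitNormal α S ν) (hνreg : C1AlphaFamily α U S ν)
    (h : FanChart α U S ℓ p φ) (hΛ : FaceSheets α S ℓ φ Λ)
    {N : Set E3 → E3 → E3} {F : Set E3 → E3 → ℝ} (hNF : ExtendsAt α S ν f p N F)
    {W : ι → ι → E3 → E3} (hW : ∀ k l, k ≠ l → C1AlphaAt α (W k l) p)
    (hsymm : ∀ᶠ q in 𝓝 p, ∀ k l, k ≠ l → k ∈ active ℓ (φ q) → l ∈ active ℓ (φ q) →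
      W k l q = W l k q)
    (hedge : ∀ᶠ q in 𝓝 p, ∀ k l j, k ≠ l → k ≠ j → l ≠ j → k ∈ active ℓ (φ q) →
      l ∈ active ℓ (φ q) → j ∈ active ℓ (φ q) → W k l q = W k j q ∧
        inner ℝ (W k l q) (ν (Λ k l) q) = f (Λ k l) q) :
    HasLocalField α S ν f p := by
  have hcl : ∀ k l, k ≠ l → p ∈ closure (Λ k l) := fun k l hkl =>
    (hΛ.mem_closure_iff k l hkl p h.mem_source).2 (by simp [h.active_center])
  -- The correction along the unit normal sets the normal component to f on the face and vanishes
  -- wherever W already has it.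
  let X : ι → ι → E3 → E3 := fun k l q =>
    W k l q + (F (Λ k l) q - inner ℝ (W k l q) (N (Λ k l) q)) • N (Λ k l) q
  have hNFe : ∀ᶠ q in 𝓝 p, ∀ k l, k ≠ l → q ∈ closure (Λ k l) →
      N (Λ k l) q = ν (Λ k l) q ∧ F (Λ k l) q = f (Λ k l) q := by
    refine eventually_all.2 fun k => eventually_all.2 fun l => ?_
    by_cases hkl : k = l
    · exact Eventually.of_forall fun q h => absurd hkl h
    · exact (hNF.eventually_eq _ (hΛ.mem_sheets k l hkl) (hcl k l hkl)).mono fun q h _ => h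
  refine hΛ.hasLocalField_of_faces (X := X) h ?_ ?_ ?_
  · intro k l hkl
    have h1 := hNF.normal _ (hΛ.mem_sheets k l hkl) (hcl k l hkl)
    have h2 := hNF.func _ (hΛ.mem_sheets k l hkl) (hcl k l hkl)
    exact (hW k l hkl).add hα1 ((h2.sub hα1 ((hW k l hkl).innerProd hα1 h1)).smul hα1 h1)
  · filter_upwards [hNFe, φ.open_source.eventually_mem h.mem_source] with q hq hqs k l hkl hk hl
    obtain ⟨e1, e2⟩ := hq k l hkl ((hΛ.mem_closure_iff k l hkl q hqs).2 ⟨hk, hl⟩)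
    have h1 : inner ℝ (ν (Λ k l) q) (ν (Λ k l) q) = 1 := by
      rw [real_inner_self_eq_norm_sq, (hΛ.normal h hν hνreg hkl hqs hk hl).1, one_pow]
    simp only [X, e1, e2, inner_add_left, real_inner_smul_left, h1]
    ring
  · filter_upwards [hNFe, φ.open_source.eventually_mem h.mem_source, hsymm, hedge]
      with q hq hqs hs he k l k' l' hkl hkl' hk hl hk' hl'
    have hXe : ∀ a b c, a ≠ b → a ≠ c → b ≠ c → a ∈ active ℓ (φ q) → b ∈ active ℓ (φ q) →
        c ∈ active ℓ (φ q) → X a b q = W a b q := by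
      intro a b c hab hac hbc ha hb hc
      obtain ⟨e1, e2⟩ := hq a b hab ((hΛ.mem_closure_iff a b hab q hqs).2 ⟨ha, hb⟩)
      simp only [X, e1, e2, (he a b c hab hac hbc ha hb hc).2, sub_self, zero_smul, add_zero]
    have hXs : ∀ a b, a ≠ b → a ∈ active ℓ (φ q) → b ∈ active ℓ (φ q) → X a b q = X b a q := by
      intro a b hab ha hb
      simp only [X, hΛ.symm b a, hs a b hab ha hb]
    have hXc : ∀ a b c, a ≠ b → a ≠ c → a ∈ active ℓ (φ q) → b ∈ active ℓ (φ q) →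
        c ∈ active ℓ (φ q) → X a b q = X a c q := by
      intro a b c hab hac ha hb hc
      by_cases hbc : b = c
      · rw [hbc]
      rw [hXe a b c hab hac hbc ha hb hc, hXe a c b hac hab (Ne.symm hbc) ha hc hb,
        (he a b c hab hac hbc ha hb hc).1]
    by_cases e : k = k'
    · subst e
      exact hXc k l l' hkl hkl' hk hl hl'
    -- Two faces sharing no index are compared through the face of `k` and `k'`.
    · rw [hXc k l k' hkl e hk hl hk', hXs k k' e hk hk', hXc k' k l' (Ne.symm e) hkl' hk' hk hl']

/-- With two forms there are no edges: starting from the zero field, the correction alone gives fν.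
-/
theorem FanChart.hasLocalField_formsP (hα1 : α ≤ 1) (hU : IsOpen U)
    (hS : IsGeneralizedSurface α U S) (hor : IsOrientableIn U S) (hν : IsUnitNormal α S ν)
    (hνreg : C1AlphaFamily α U S ν) (hf : C1AlphaFamily α U S f) {p : E3}
    {φ : OpenPartialHomeomorph E3 E3} (h : FanChart α U S formsP p φ) :
    HasLocalField α S ν f p := by
  obtain ⟨Λ, hΛ⟩ := h.exists_faceSheets hS hor
  obtain ⟨N, F, hNF⟩ := exists_extendsAt hU hνreg hf (h.source_subset h.mem_source)
  refine hΛ.hasLocalField_of_edges hα1 hν hνreg h hNF (W := fun _ _ _ => 0)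
    (fun k l _ => c1AlphaAt_const 0) (Eventually.of_forall fun q k l _ _ _ => rfl)
    (Eventually.of_forall fun q k l j h1 h2 h3 => ?_)
  omega

/-- A field with the right normal component on the three faces meeting along an edge. -/
theorem FaceSheets.exists_edgeField (hα1 : α ≤ 1) {ι : Type*} [Finite ι] {ℓ : ι → E3}
    {p : E3} {φ : OpenPartialHomeomorph E3 E3} {Λ : ι → ι → Set E3}
    (hS : IsGeneralizedSurface α U S) (hor : IsOrientableIn U S)
    (hν : IsUnitNormal α S ν) (hνreg : C1AlphaFamily α U S ν) (hτ : IsOrientation S τ)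
    (hf : SignCondition α S ν τ f)
    (h : FanChart α U S ℓ p φ) (hΛ : FaceSheets α S ℓ φ Λ)
    {N : Set E3 → E3 → E3} {F : Set E3 → E3 → ℝ} (hNF : ExtendsAt α S ν f p N F)
    {k l j : ι} (hkl : k ≠ l) (hkj : k ≠ j) (hlj : l ≠ j) (v : E3) :
    ∃ W : E3 → E3, C1AlphaAt α W p ∧
      (∀ᶠ q in 𝓝 p, active ℓ (φ q) = {k, l, j} → ∀ a ∈ active ℓ (φ q), ∀ b ∈ active ℓ (φ q),
        a ≠ b → inner ℝ (W q) (ν (Λ a b) q) = f (Λ a b) q) ∧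
      (inner ℝ v (ν (Λ k l) p) = f (Λ k l) p → inner ℝ v (ν (Λ k j) p) = f (Λ k j) p →
        W p = v) := by
  have hcl : ∀ k l, k ≠ l → p ∈ closure (Λ k l) := fun k l hkl =>
    (hΛ.mem_closure_iff k l hkl p h.mem_source).2 (by simp [h.active_center])
  have hev := fun a b (hab : a ≠ b) =>
    hNF.eventually_eq _ (hΛ.mem_sheets a b hab) (hcl a b hab)
  have hgram := hΛ.gram_ne_zero h hν hνreg hkl hkj hlj h.mem_source
    (by simp [h.active_center]) (by simp [h.active_center]) (by simp [h.active_center])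
  obtain ⟨n1, f1⟩ := (hev k l hkl).self_of_nhds (hcl k l hkl)
  obtain ⟨n2, f2⟩ := (hev k j hkj).self_of_nhds (hcl k j hkj)
  rw [← n1, ← n2] at hgram
  -- The equations of two faces are solved near `p` with the extended data; the third one is needed
  -- only on the edge, where the sign condition implies it.
  obtain ⟨W, hW, hWe, hWp⟩ := exists_c1AlphaAt_inner_eq hα1
    (hNF.normal _ (hΛ.mem_sheets k l hkl) (hcl k l hkl))
    (hNF.normal _ (hΛ.mem_sheets k j hkj) (hcl k j hkj))
    (hNF.func _ (hΛ.mem_sheets k l hkl) (hcl k l hkl))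
    (hNF.func _ (hΛ.mem_sheets k j hkj) (hcl k j hkj)) hgram v
  rw [n1, n2, f1, f2] at hWp
  refine ⟨W, hW, ?_, hWp⟩
  filter_upwards [hWe, hev k l hkl, hev k j hkj, φ.open_source.eventually_mem h.mem_source]
    with q hq e1 e2 hqs ha a haa b hba hab
  have hk : k ∈ active ℓ (φ q) := by simp [ha]
  have hl : l ∈ active ℓ (φ q) := by simp [ha]
  have hj : j ∈ active ℓ (φ q) := by simp [ha]
  obtain ⟨e1, e1'⟩ := e1 ((hΛ.mem_closure_iff k l hkl q hqs).2 ⟨hk, hl⟩)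
  obtain ⟨e2, e2'⟩ := e2 ((hΛ.mem_closure_iff k j hkj q hqs).2 ⟨hk, hj⟩)
  rw [e1, e1', e2, e2'] at hq
  have h3 := hf.inner_eq_of_inner_eq hS hor hν hνreg hτ h hΛ hkl hkj hlj hqs ha hq.1 hq.2
  rw [ha] at haa hba
  rcases haa with rfl | rfl | rfl <;> rcases hba with rfl | rfl | rfl
  · exact absurd rfl hab
  · exact hq.1
  · exact hq.2
  · rw [hΛ.symm]; exact hq.1
  · exact absurd rfl hab
  · exact h3
  · rw [hΛ.symm]; exact hq.2
  · rw [hΛ.symm]; exact h3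
  · exact absurd rfl hab

/-- There is a single edge, so one edge field serves all three faces. -/
theorem FanChart.hasLocalField_fin_three (hα1 : α ≤ 1) (hU : IsOpen U)
    (hS : IsGeneralizedSurface α U S) (hor : IsOrientableIn U S) (hν : IsUnitNormal α S ν)
    (hνreg : C1AlphaFamily α U S ν) (hτ : IsOrientation S τ) (hf : C1AlphaFamily α U S f)
    (hsign : SignCondition α S ν τ f) {ℓ : Fin 3 → E3} {p : E3}
    {φ : OpenPartialHomeomorph E3 E3} (h : FanChart α U S ℓ p φ) :
    HasLocalField α S ν f p := by
  obtain ⟨Λ, hΛ⟩ := h.exists_faceSheets hS hor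
  obtain ⟨N, F, hNF⟩ := exists_extendsAt hU hνreg hf (h.source_subset h.mem_source)
  obtain ⟨W, hW, hWe, -⟩ := hΛ.exists_edgeField (k := 0) (l := 1) (j := 2) hα1 hS hor hν hνreg hτ
    hsign h hNF (by decide) (by decide) (by decide) 0
  refine hΛ.hasLocalField_of_edges hα1 hν hνreg h hNF (W := fun _ _ => W)
    (fun k l _ => hW) (Eventually.of_forall fun q k l _ _ _ => rfl) ?_
  filter_upwards [hWe] with q hq k l j h1 h2 h3 hk hl hj
  refine ⟨rfl, hq ?_ k hk l hl h1⟩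
  ext m
  have hm : m = k ∨ m = l ∨ m = j := by omega
  have hm' : m = 0 ∨ m = 1 ∨ m = 2 := by omega
  simp only [mem_insert_iff, mem_singleton_iff, hm', iff_true]
  rcases hm with rfl | rfl | rfl <;> assumption

end Local

/-! ### Local construction at a vertex -/

section Vertex

variable {α : ℝ≥0} {U S : Set E3} {ν : Set E3 → E3 → E3} {τ : E3 → E3} {f : Set E3 → E3 → ℝ}

/-- The normal to a face at the centre of a chart, in the coordinates of the chart. -/
theorem FaceSheets.exists_normal_eq {ι : Type*} [Finite ι] {ℓ : ι → E3}
    {p : E3} {φ : OpenPartialHomeomorph E3 E3} {Λ : ι → ι → Set E3}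
    (hν : IsUnitNormal α S ν) (hνreg : C1AlphaFamily α U S ν)
    (h : FanChart α U S ℓ p φ) (hΛ : FaceSheets α S ℓ φ Λ) {A : E3 ≃L[ℝ] E3}
    (hA : HasFDerivAt φ.symm (A.symm : E3 →L[ℝ] E3) (φ p)) {k l : ι} (hkl : k ≠ l) :
    ∃ c : ℝ, c ≠ 0 ∧ ∀ u, inner ℝ (A.symm u) (ν (Λ k l) p) =
      c * (inner ℝ (ℓ k) u - inner ℝ (ℓ l) u) := by
  classical
  obtain ⟨n1, no⟩ := hΛ.normal h hν hνreg hkl h.mem_source (by simp [h.active_center])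
    (by simp [h.active_center])
  rw [hA.fderiv] at no
  -- Both sides are linear forms vanishing on the plane where `k` and `l` agree, hence proportional;
  -- `u₀` normalizes the right-hand one to 1.
  obtain ⟨u₀, c₀, hu₀⟩ := h.indep fun i => if i = k then 1 else 0
  have hk0 : inner ℝ (ℓ k) u₀ - inner ℝ (ℓ l) u₀ = 1 := by simp [hu₀, hkl.symm]
  have key : ∀ u, inner ℝ (A.symm u) (ν (Λ k l) p) =
      inner ℝ (A.symm u₀) (ν (Λ k l) p) * (inner ℝ (ℓ k) u - inner ℝ (ℓ l) u) := by
    intro u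
    have h1 := no (u - (inner ℝ (ℓ k) u - inner ℝ (ℓ l) u) • u₀) (by
      simp only [inner_sub_right, real_inner_smul_right]
      linear_combination -(inner ℝ (ℓ k) u - inner ℝ (ℓ l) u) * hk0)
    rw [map_sub, map_smul, inner_sub_right, real_inner_smul_right] at h1
    simp only [ContinuousLinearEquiv.coe_coe] at h1
    rw [real_inner_comm (ν (Λ k l) p) (A.symm u), real_inner_comm (ν (Λ k l) p) (A.symm u₀)]
    linarith
  refine ⟨_, fun h0 => ?_, key⟩
  have := key (A (ν (Λ k l) p))
  rw [h0, zero_mul, A.symm_apply_apply, real_inner_self_eq_norm_sq, n1] at this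
  norm_num at this

/-- If, for each `m`, the equations for the faces avoiding `m` are solvable, then all the
equations at the vertex are solvable together. -/
theorem FaceSheets.exists_vertex_value {ℓ : Fin 4 → E3} {p : E3}
    {φ : OpenPartialHomeomorph E3 E3} {Λ : Fin 4 → Fin 4 → Set E3}
    (hν : IsUnitNormal α S ν) (hνreg : C1AlphaFamily α U S ν)
    (h : FanChart α U S ℓ p φ) (hΛ : FaceSheets α S ℓ φ Λ) {w : Fin 4 → E3}
    (hw : ∀ m a b, a ≠ m → b ≠ m → a ≠ b →
      inner ℝ (w m) (ν (Λ a b) p) = f (Λ a b) p) :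
    ∃ v : E3, ∀ a b, a ≠ b → inner ℝ v (ν (Λ a b) p) = f (Λ a b) p := by
  obtain ⟨A, -, hA⟩ := h.exists_equiv h.mem_source
  have hc : ∀ a b, ∃ c : ℝ, a ≠ b → c ≠ 0 ∧ ∀ u, inner ℝ (A.symm u) (ν (Λ a b) p) =
      c * (inner ℝ (ℓ a) u - inner ℝ (ℓ b) u) := by
    intro a b
    by_cases hab : a = b
    · exact ⟨0, fun h => absurd hab h⟩
    · obtain ⟨c, hc⟩ := hΛ.exists_normal_eq hν hνreg h hA hab
      exact ⟨c, fun _ => hc⟩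
  choose c hc using hc
  have hu : ∀ m a b, a ≠ m → b ≠ m → a ≠ b →
      inner ℝ (ℓ a) (A (w m)) - inner ℝ (ℓ b) (A (w m)) = f (Λ a b) p / c a b := by
    intro m a b ham hbm hab
    obtain ⟨h1, h2⟩ := hc a b hab
    have := h2 (A (w m))
    rw [A.symm_apply_apply, hw m a b ham hbm hab] at this
    rw [this, mul_div_cancel_left₀ _ h1]
  have hex : ∀ a b d : Fin 4, ∃ m, a ≠ m ∧ b ≠ m ∧ d ≠ m := by decide
  -- In chart coordinates the equations prescribe differences of forms. Since `a`, `b` and 0 always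
  -- avoid some `m`, the prescribed differences are additive, and those with the form 0 determine
  -- the rest.
  obtain ⟨u, c₀, hu₀⟩ := h.indep fun a => if a = 0 then 0 else f (Λ a 0) p / c a 0
  have hfin : ∀ a b, a ≠ b →
      inner ℝ (ℓ a) u - inner ℝ (ℓ b) u = f (Λ a b) p / c a b := by
    intro a b hab
    obtain ⟨m, ham, hbm, h0m⟩ := hex a b 0
    rw [hu₀, hu₀, ← hu m a b ham hbm hab]
    by_cases ha : a = 0
    · subst ha
      rw [if_pos rfl, if_neg hab.symm, ← hu m b 0 hbm h0m hab.symm]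
      ring
    · by_cases hb : b = 0
      · subst hb
        rw [if_pos rfl, if_neg ha, ← hu m a 0 ham h0m ha]
        ring
      · rw [if_neg ha, if_neg hb, ← hu m a 0 ham h0m ha, ← hu m b 0 hbm h0m hb]
        ring
  refine ⟨A.symm u, fun a b hab => ?_⟩
  obtain ⟨h1, h2⟩ := hc a b hab
  rw [h2, hfin a b hab, mul_div_cancel₀ _ h1]

/-- Edge `m` is the one where all forms except `m` are active. Its field is built as at a `Y`-point;
the task is to interpolate, on each face, between the fields of the two edges bordering it. -/
theorem FanChart.hasLocalField_fin_four (hα1 : α ≤ 1) (hU : IsOpen U)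
    (hS : IsGeneralizedSurface α U S) (hor : IsOrientableIn U S) (hν : IsUnitNormal α S ν)
    (hνreg : C1AlphaFamily α U S ν) (hτ : IsOrientation S τ) (hf : C1AlphaFamily α U S f)
    (hsign : SignCondition α S ν τ f) {ℓ : Fin 4 → E3} {p : E3}
    {φ : OpenPartialHomeomorph E3 E3} (h : FanChart α U S ℓ p φ)
    (hinj : ∀ v, (∀ i j, inner ℝ (ℓ i) v = inner ℝ (ℓ j) v) → v = 0) :
    HasLocalField α S ν f p := by
  obtain ⟨Λ, hΛ⟩ := h.exists_faceSheets hS hor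
  obtain ⟨N, F, hNF⟩ := exists_extendsAt hU hνreg hf (h.source_subset h.mem_source)
  have hps := h.mem_source
  have hcl : ∀ k l, k ≠ l → p ∈ closure (Λ k l) := fun k l hkl =>
    (hΛ.mem_closure_iff k l hkl p hps).2 (by simp [h.active_center])
  have htriple : ∀ m i : Fin 4, i ∈ ({m + 1, m + 2, m + 3} : Set (Fin 4)) ↔ i ≠ m := by
    intro m i
    simp only [mem_insert_iff, mem_singleton_iff]
    omega
  have hedge : ∀ (m : Fin 4) (v : E3), ∃ W : E3 → E3, C1AlphaAt α W p ∧
      (∀ᶠ q in 𝓝 p, active ℓ (φ q) = {m + 1, m + 2, m + 3} → ∀ a ∈ active ℓ (φ q),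
        ∀ b ∈ active ℓ (φ q), a ≠ b → inner ℝ (W q) (ν (Λ a b) q) = f (Λ a b) q) ∧
      (inner ℝ v (ν (Λ (m + 1) (m + 2)) p) = f (Λ (m + 1) (m + 2)) p →
        inner ℝ v (ν (Λ (m + 1) (m + 3)) p) = f (Λ (m + 1) (m + 3)) p → W p = v) := fun m v =>
    hΛ.exists_edgeField hα1 hS hor hν hνreg hτ hsign h hNF (by omega) (by omega) (by omega) v
  -- directions of the edges
  have hP : ∀ m, ∃ (P : E3) (c : ℝ), ∀ i, inner ℝ (ℓ i) P = (if i = m then 1 else 0) + c :=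
    fun m => h.indep fun i => if i = m then 1 else 0
  choose P c hP using hP
  -- At positive multiples of `P m` every form but `m` is minimal, so edge `m` is adherent to the
  -- vertex.
  have hray : ∀ m, p ∈ closure (φ.source ∩ φ ⁻¹' {x | active ℓ x = {m + 1, m + 2, m + 3}}) := by
    intro m
    refine φ.mem_closure_preimage_of_ray (v := P m) hps fun s hs => ?_
    rw [h.map_center, zero_add, mem_ofPred, active_smul hs]
    ext i
    rw [htriple]
    constructor
    · rintro hi rfl
      have := hi (i + 1)
      rw [hP, hP, if_pos rfl, if_neg (by omega)] at this
      linarith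
    · intro hi j
      rw [hP, hP, if_neg hi]
      split_ifs <;> linarith
  have hvertex : ∀ m (W : E3 → E3), C1AlphaAt α W p →
      (∀ᶠ q in 𝓝 p, active ℓ (φ q) = {m + 1, m + 2, m + 3} → ∀ a ∈ active ℓ (φ q),
        ∀ b ∈ active ℓ (φ q), a ≠ b → inner ℝ (W q) (ν (Λ a b) q) = f (Λ a b) q) →
      ∀ a b, a ≠ m → b ≠ m → a ≠ b → inner ℝ (W p) (ν (Λ a b) p) = f (Λ a b) p := by
    intro m W hW hWe a b ham hbm hab
    have hK := hΛ.mem_sheets a b hab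
    have hev := hNF.eventually_eq _ hK (hcl a b hab)
    obtain ⟨e1, e2⟩ := hev.self_of_nhds (hcl a b hab)
    rw [← e1, ← e2, ← sub_eq_zero]
    refine eq_of_mem_closure (g := fun q => inner ℝ (W q) (N (Λ a b) q) - F (Λ a b) q)
      ((hW.continuousAt.inner (hNF.normal _ hK (hcl a b hab)).continuousAt).sub
        (hNF.func _ hK (hcl a b hab)).continuousAt) (hray m) ?_
    filter_upwards [hWe, hev] with q hq hqe hqr
    have ha : a ∈ active ℓ (φ q) := by rw [hqr.2, htriple]; exact ham
    have hb : b ∈ active ℓ (φ q) := by rw [hqr.2, htriple]; exact hbm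
    obtain ⟨e1, e2⟩ := hqe ((hΛ.mem_closure_iff a b hab q hqr.1).2 ⟨ha, hb⟩)
    rw [e1, e2, hq hqr.2 a ha b hb hab, sub_self]
  obtain ⟨v, hv⟩ : ∃ v : E3, ∀ a b, a ≠ b → inner ℝ v (ν (Λ a b) p) = f (Λ a b) p := by
    choose W hW hWe _ using fun m => hedge m 0
    exact hΛ.exists_vertex_value hν hνreg h (w := fun m => W m p)
      fun m => hvertex m (W m) (hW m) (hWe m)
  choose W hW hWe hWp using fun m => hedge m v
  -- The edge fields are rebuilt with the prescribed value `v`: it solves the vertex equations, so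
  -- it is attained.
  have hWv : ∀ m, W m p = v := fun m => hWp m (hv _ _ (by omega)) (hv _ _ (by omega))
  -- On edge `m` the map `π m k` is the identity, as x minus its image has all forms equal; where
  -- the forms `m` and `k` agree it is zero. On the face of `k` and `l` it does not depend on which
  -- of the two is used.
  let π : Fin 4 → Fin 4 → E3 → E3 := fun m k x => (inner ℝ (ℓ m) x - inner ℝ (ℓ k) x) • P m
  let Ψ : Fin 4 → Fin 4 → E3 → E3 := fun m k q => φ.symm (π m k (φ q))
  have hsymm0 : φ.symm 0 = p := by rw [← h.map_center, φ.left_inv hps]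
  have hΨp : ∀ m k, Ψ m k p = p := by
    intro m k
    simp [Ψ, π, h.map_center, hsymm0]
  have hΨ : ∀ m k, C1AlphaAt α (Ψ m k) p := by
    intro m k
    have h1 : C1AlphaAt α (fun q => π m k (φ q)) p := by
      refine (h.regular p hps).contDiff_comp hα1 (g := π m k) (ContDiff.contDiffAt ?_)
      exact (((contDiff_const.inner ℝ contDiff_id).sub (contDiff_const.inner ℝ contDiff_id)).smul
        contDiff_const)
    have h2 : C1AlphaAt α φ.symm (π m k (φ p)) := by
      have : π m k (φ p) = 0 := by simp [π, h.map_center]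
      rw [this]
      exact h.regular_symm 0 h.mem_target_center
    exact C1AlphaAt.comp φ.symm h2 h1
  -- The indices `m` different from `k` and `l` are the two edges bordering the face. On either edge
  -- the other term is W(p) - v = 0, so only the right edge field remains.
  let X : Fin 4 → Fin 4 → E3 → E3 := fun k l q =>
    v + ∑ m ∈ Finset.univ.filter (fun m => m ≠ k ∧ m ≠ l), (W m (Ψ m k q) - v)
  have hX : ∀ k l, C1AlphaAt α (X k l) p := by
    intro k l
    refine (c1AlphaAt_const v).add hα1 (C1AlphaAt.sum hα1 fun m _ => ?_)
    refine C1AlphaAt.sub hα1 ?_ (c1AlphaAt_const v)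
    exact C1AlphaAt.comp (W m) (by rw [hΨp]; exact hW m) (hΨ m k)
  have hWedge : ∀ m, ∀ᶠ q in 𝓝 p, ∀ a b, a ≠ m → b ≠ m → a ≠ b →
      (∀ i, i ≠ m → i ∈ active ℓ (φ q)) → inner ℝ (W m q) (ν (Λ a b) q) = f (Λ a b) q := by
    intro m
    filter_upwards [hWe m, φ.open_source.eventually_mem hps] with q hq hqs a b ham hbm hab hact
    -- If the omitted form is active too, all four agree and the point is the vertex, where the
    -- equations hold by passing to the limit.
    by_cases hm : m ∈ active ℓ (φ q)
    · have hall : ∀ i, i ∈ active ℓ (φ q) := fun i => by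
        by_cases hi : i = m
        · rw [hi]; exact hm
        · exact hact i hi
      have h0 : φ q = 0 := hinj _ fun i j => active_eq (hall i) (hall j)
      have : q = p := by rw [← φ.left_inv hqs, h0, hsymm0]
      rw [this]
      exact hvertex m (W m) (hW m) (hWe m) a b ham hbm hab
    · refine hq ?_ a (hact a ham) b (hact b hbm) hab
      ext i
      rw [htriple]
      exact ⟨fun hi e => hm (e ▸ hi), hact i⟩
  refine hΛ.hasLocalField_of_edges hα1 hν hνreg h hNF (W := X) (fun k l _ => hX k l) ?_ ?_
  · refine Eventually.of_forall fun q k l hkl hk hl => ?_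
    have e : ∀ m, Ψ m k q = Ψ m l q := fun m => by simp only [Ψ, π, active_eq hk hl]
    simp only [X, e, and_comm]
  · filter_upwards [eventually_all.2 hWedge, φ.open_source.eventually_mem hps]
      with q hq hqs k l j hkl hkj hlj hk hl hj
    have hex : ∀ a b d : Fin 4, a ≠ b → a ≠ d → b ≠ d →
        ∃ m, a ≠ m ∧ b ≠ m ∧ d ≠ m ∧ ∀ i, i ≠ m → i = a ∨ i = b ∨ i = d := by decide
    obtain ⟨m, hkm, hlm, hjm, hcov⟩ := hex k l j hkl hkj hlj
    have hact : ∀ i, i ≠ m → i ∈ active ℓ (φ q) := by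
      intro i hi
      rcases hcov i hi with rfl | rfl | rfl <;> assumption
    have hΨm : Ψ m k q = q := by
      have : φ q - π m k (φ q) = 0 := by
        refine hinj _ fun i i' => ?_
        have hval : ∀ i, inner ℝ (ℓ i) (φ q - π m k (φ q)) = inner ℝ (ℓ k) (φ q) -
            (inner ℝ (ℓ m) (φ q) - inner ℝ (ℓ k) (φ q)) * c m := by
          intro i
          simp only [π, inner_sub_right, real_inner_smul_right, hP]
          by_cases hi : i = m
          · rw [hi, if_pos rfl]; ring
          · rw [if_neg hi, active_eq (hact i hi) hk]; ring
        rw [hval, hval]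
      simp only [Ψ, ← sub_eq_zero.1 this, φ.left_inv hqs]
    have hΨo : ∀ i, i ≠ m → Ψ i k q = p := by
      intro i hi
      simp only [Ψ, π, active_eq (hact i hi) hk, sub_self, zero_smul, hsymm0]
    have hXm : ∀ b, k ≠ b → b ≠ m → X k b q = W m q := by
      intro b hkb hbm
      have hs : ∑ i ∈ Finset.univ.filter (fun i => i ≠ k ∧ i ≠ b), (W i (Ψ i k q) - v) =
          W m (Ψ m k q) - v := by
        refine Finset.sum_eq_single m (fun i _ hi => ?_) fun hm => ?_
        · rw [hΨo i hi, hWv, sub_self]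
        · exact absurd (Finset.mem_filter.2 ⟨Finset.mem_univ m, hkm.symm, hbm.symm⟩) hm
      simp only [X]
      rw [hs, hΨm, add_sub_cancel]
    rw [hXm l hkl hlm, hXm j hkj hjm]
    exact ⟨rfl, hq m k l hkm hlm hkl hact⟩

end Vertex

/-! ### Globalization -/

section Global

variable {α : ℝ≥0} {U S : Set E3} {ν : Set E3 → E3 → E3} {τ : E3 → E3} {f : Set E3 → E3 → ℝ}

/-- Some neighbourhood of the point misses the closure of every sheet, so any field will do. -/
theorem hasLocalField_of_notMem (hS : IsGeneralizedSurface α U S) {p : E3}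
    (hp : p ∈ U) (hpS : p ∉ S) : HasLocalField α S ν f p := by
  have hcS : p ∉ closure S := fun h => hpS (hS.relClosed ⟨h, hp⟩)
  refine ⟨(closure S)ᶜ, isClosed_closure.isOpen_compl, hcS, 0, ?_⟩
  rintro K hK x ⟨hxK, hx⟩
  exact absurd (closure_mono (fun y hy => (subset_of_mem_components hK hy).1) hxK) hx

theorem SignCondition.hasLocalField (hα1 : α ≤ 1) (hU : IsOpen U)
    (hS : IsGeneralizedSurface α U S) (hor : IsOrientableIn U S) (hν : IsUnitNormal α S ν)
    (hνreg : C1AlphaFamily α U S ν) (hτ : IsOrientation S τ) (hf : C1AlphaFamily α U S f)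
    (hsign : SignCondition α S ν τ f) {p : E3} (hp : p ∈ U) : HasLocalField α S ν f p := by
  by_cases hpS : p ∈ S
  · obtain ⟨φ, -, ⟨hφ, -⟩ | hφ | hφ⟩ := hS.exists_fanChart hpS
    · exact hφ.hasLocalField_formsP hα1 hU hS hor hν hνreg hf
    · exact hφ.hasLocalField_fin_three hα1 hU hS hor hν hνreg hτ hf hsign
    · exact hφ.hasLocalField_fin_four hα1 hU hS hor hν hνreg hτ hf hsign
        eq_zero_of_inner_tetraVertex_eq
  · exact hasLocalField_of_notMem hS hp hpS

-- Local solutions may be averaged: the weights sum to 1 and the equation is affine, so smooth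
-- weights keep both the equation and the regularity.
open scoped Manifold ContDiff in
theorem isCompatible_of_hasLocalField (hα1 : α ≤ 1) (hU : IsOpen U)
    (h : ∀ p ∈ U, HasLocalField α S ν f p) : IsCompatible α U S ν f := by
  classical
  let O : TopologicalSpace.Opens E3 := ⟨U, hU⟩
  have : LocallyCompactSpace O := hU.locallyCompactSpace
  have h' : ∀ p : O, ∃ N : Set E3, IsOpen N ∧ (p : E3) ∈ N ∧ ∃ V : E3 → E3,
      ∀ K ∈ sheets α S, ∀ x ∈ closure K ∩ N,
        C1AlphaWithinAt α V (closure K) x ∧ f K x = inner ℝ (V x) (ν K x) := fun p => h p p.2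
  choose N hNo hpN V hV using h'
  obtain ⟨ρ, hρ⟩ := SmoothPartitionOfUnity.exists_isSubordinate 𝓘(ℝ, E3)
    (isClosed_univ (X := O)) (fun p : O => (Subtype.val ⁻¹' N p : Set O))
    (fun p => (hNo p).preimage continuous_subtype_val)
    (fun p _ => mem_iUnion.2 ⟨p, hpN p⟩)
  -- The partition of unity lives on `U` regarded as a manifold; its functions are extended by 0,
  -- and the regularity of the extension is used only at points of `U`.
  let r : O → E3 → ℝ := fun i x => if hx : x ∈ U then ρ i ⟨x, hx⟩ else 0
  have hr : ∀ i (x : O), r i x = ρ i x := fun i x => dif_pos x.2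
  have hrs : ∀ i, ∀ x ∈ U, C1AlphaAt α (r i) x := by
    intro i x hx
    refine c1AlphaAt_of_contDiffAt hα1 ?_
    have h1 : ContMDiffAt 𝓘(ℝ, E3) 𝓘(ℝ, ℝ) ∞ (fun y : O => r i y) ⟨x, hx⟩ := by
      have : (fun y : O => r i y) = ρ i := funext (hr i)
      rw [this]
      exact (ρ i).contMDiff _
    have h2 := (contMDiffAt_subtype_iff (U := O)).1 h1
    exact (contMDiffAt_iff_contDiffAt.1 h2).of_le (WithTop.coe_le_coe.2 (le_top (a := (2 : ℕ∞))))
  let W : E3 → E3 := fun x => ∑ᶠ i, r i x • V i x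
  have hWsum : ∀ (x : O), ∀ᶠ y in 𝓝 (x : E3),
      W y = ∑ i ∈ ρ.fintsupport x, r i y • V i y := by
    intro x
    have h1 := ρ.eventually_finsupport_subset (x₀ := x)
    rw [nhds_subtype_eq_comap, eventually_comap] at h1
    filter_upwards [h1, hU.mem_nhds x.2] with y hy hyU
    have h2 := hy ⟨y, hyU⟩ rfl
    refine finsum_eq_sum_of_support_subset _ fun i hi => ?_
    refine Finset.mem_coe.2 (h2 ((ρ.mem_finsupport (x₀ := ⟨y, hyU⟩)).2 fun h0 => hi ?_))
    have : r i y = 0 := (hr i ⟨y, hyU⟩).trans h0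
    simp only [this, zero_smul]
  have hmem : ∀ (x : O), ∀ i ∈ ρ.fintsupport x, (x : E3) ∈ N i := fun x i hi =>
    hρ i ((ρ.mem_fintsupport_iff x i).1 hi)
  refine ⟨W, fun K hK => c1AlphaOn_iff.2 ?_, ?_⟩
  · rintro x ⟨hxK, hxU⟩
    have hG : ∀ i, ∃ G : E3 → E3, i ∈ ρ.fintsupport ⟨x, hxU⟩ →
        C1AlphaAt α G x ∧ ∀ᶠ y in 𝓝 x, y ∈ closure K → G y = V i y := by
      intro i
      by_cases hi : i ∈ ρ.fintsupport ⟨x, hxU⟩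
      · obtain ⟨G, hG⟩ := (hV i K hK x ⟨hxK, hmem ⟨x, hxU⟩ i hi⟩).1
        exact ⟨G, fun _ => hG⟩
      · exact ⟨0, fun h => absurd h hi⟩
    choose G hG using hG
    refine ⟨fun y => ∑ i ∈ ρ.fintsupport ⟨x, hxU⟩, r i y • G i y,
      C1AlphaAt.sum hα1 fun i hi => (hrs i x hxU).smul hα1 (hG i hi).1, ?_⟩
    have hall : ∀ᶠ y in 𝓝 x, ∀ i ∈ ρ.fintsupport ⟨x, hxU⟩, y ∈ closure K → G i y = V i y :=
      (Finset.eventually_all _).2 fun i hi => (hG i hi).2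
    filter_upwards [hWsum ⟨x, hxU⟩, hall] with y hy hy' hyK
    rw [hy]
    exact Finset.sum_congr rfl fun i hi => by rw [hy' i hi hyK.1]
  · rintro K hK x ⟨hxK, hxU⟩
    rw [(hWsum ⟨x, hxU⟩).self_of_nhds, sum_inner]
    have h1 : ∀ i ∈ ρ.fintsupport ⟨x, hxU⟩,
        inner ℝ (r i x • V i x) (ν K x) = ρ i ⟨x, hxU⟩ * f K x := by
      intro i hi
      rw [real_inner_smul_left, ← (hV i K hK x ⟨hxK, hmem ⟨x, hxU⟩ i hi⟩).2]
      exact congrArg (· * f K x) (hr i ⟨x, hxU⟩)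
    rw [Finset.sum_congr rfl h1, ← Finset.sum_mul,
      ρ.sum_finsupport' _ (mem_univ _) (ρ.finsupport_subset_fintsupport _), one_mul]

end Global

end PlateauSurface

open PlateauSurface
theorem proposition1 (α : ℝ≥0) (hα0 : 0 < α) (hα1 : α < 1)
    (U : Set E3) (hU : IsOpen U) (S : Set E3)
    (hS : IsGeneralizedSurface α U S) (hor : IsOrientableIn U S)
    (ν : Set E3 → E3 → E3) (hν : IsUnitNormal α S ν) (hνreg : C1AlphaFamily α U S ν)
    (τ : E3 → E3) (hτ : IsOrientation S τ)
    (f : Set E3 → E3 → ℝ) (hf : C1AlphaFamily α U S f) :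
    IsCompatible α U S ν f ↔
      ∀ L ∈ yCurves S, ∀ Λ : Fin 3 → Set E3,
        Function.Injective Λ → range Λ = sheetsAlong α S L →
          ∀ p ∈ L, ∑ i, sheetSign (Λ i) (ν (Λ i) p) p (τ p) * f (Λ i) p = 0 := by
  constructor
  · exact fun h => h.signCondition hS hor hν hνreg hτ
  · intro h
    have hsign : SignCondition α S ν τ f := h
    exact isCompatible_of_hasLocalField hα1.le hU fun p hp =>
      hsign.hasLocalField hα1.le hU hS hor hν hνreg hτ hf hp
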